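/- **Setting.** Let $n\ge 1$, fix a coordinate $x=x_\ell$ of $\mathbb C^n$. Consider Pfaffian systems $du=\Omega u$, $$\Omega=\sum_{i=1}^n\Big(A_{x_i}+\sum_{j\ne i}A_{x_ix_j}x_j\Big)dx_i+\sum_{H}A_H\,d\log f_H ,$$ where $A_{x_i},A_{x_ix_j}=A_{x_jx_i},A_H\in\mathrm{End}(V)$, $V$ is a finite-dimensional complex vector space, $H$ runs through affine hyperplanes of $\mathbb C^n$ with defining polynomials $f_H$, only finitely many $A_H$ are nonzero, and $\Omega\wedge\Omega=0$. Put $S_x(\boldsymbol x)=A_x+\sum_{j\ne\ell}A_{xx_j}x_j$. If $f_H$ depends on $x$, write $f_H=(f_H)_x\,(x-a_H)$ with $a_H$ affine in the other variables, $a_H(0)$ its constant term and $(a_H)_y$ its coefficient of a variable $y$. Write $\Omega\sim\Omega'$ if $\Omega'=P\Omega P^{-1}$ for a constant linear isomorphism $P$ between the underlying spaces. Let $T,S$ be finite sets of affine hyperplanes all of which depend on $x$, such that at most one of $T$ and $S$ contains a hyperplane depending also on another variable. Let $\mathfrak P_{T,S}$ be the set of such $\Omega$ (of any rank $\dim V\geq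 0$) for which $A_x$ and all $A_{xx_j}$ are diagonalizable; $A_{xx_j}=0$ for all $j\neq\ell$ if $T$ contains a hyperplane depending also on another variable; every $H$ depending on $x$ with $A_H\ne0$ lies in $T$; and $\{\det(x-S_x(\boldsymbol x))=0\}\subseteq\bigcup_{H\in S}H$. Let $\mathfrak P^{irr}_{T,S}$ be the set of $\Omega\in\mathfrak P_{T,S}$ of rank at least one that are irreducible in the $x$-direction (no subspace other than $0$ and $V$ is invariant under $A_x$, all $A_{xx_j}$ and all $A_H$, $H\in T$) and have $A_H\ne0$ for at least one $H\in T$; the last condition excludes only systems of rank one. **Middle Laplace transforms.** For $\varepsilon=1$ (resp. $\varepsilon=-1$), $\mathcal L^{x}(\Omega)$ (resp. $\mathcal L^{-x}(\Omega)$) is the system on $V^T$, with $v=(v_H)_{H\in T}$, whose coefficients act on the $H$-th copy of $V$ by $$B_x=-\varepsilon a_H(0),\qquad B_{xy}=B_{yx}=-\varepsilon(a_H)_y,\qquad B_y=A_y+a_H(0)A_{yx}+(a_H)_yA_x,\qquad B_{yz}=A_{yz}$$ ($y,z$ distinct variables other than $x$), and whose residue along $G$ maps $v$ to the vector with $H$-th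 component $$-E_G\sum_{H'\in T}A_{H'}v_{H'}\quad(G\text{ depends on }x),\qquad A_Gv_H+\sum_{H'\in T:\;G=\{a_H=a_{H'}\}}A_{H'}(v_H-v_{H'})\quad(\text{otherwise}),$$ where $E_G$ is the projection onto the joint eigenspace of $A_x,A_{xx_j}$ on which $S_x(\boldsymbol x)$ is multiplication by $\varepsilon a_G$, along the other joint eigenspaces. $\mathcal{ML}^{\pm x}(\Omega)$ is the system induced by $\mathcal L^{\pm x}(\Omega)$ on $V^T/\mathcal K$, $\mathcal K=\bigoplus_{H\in T}\ker A_H$. For $\lambda\in\mathbb C^{S}$ put $add_{-\lambda}(\Omega)=\Omega-\sum_{H\in S}\lambda_H\,d\log f_H$ and $$mc_\lambda^{x}:=\mathcal{ML}^{-x}\circ add_{-\lambda}\circ\mathcal{ML}^{x},$$ where $\mathcal{ML}^{-x}$ is formed with the set $S$ in place of $T$. Call $\lambda$ *admissible* for $\Omega$ if the residues of $add_{-\lambda}(\mathcal{ML}^x(\Omega))$ along the hyperplanes in $S$ are not all zero. (For $\Omega\in\mathfrak P^{irr}_{T,S}$ this fails only if $\mathcal{ML}^x(\Omega)$ has rank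 one and residues $\lambda_H$, $H\in S$; then $mc^x_\lambda(\Omega)$ has rank $0$.) **Statement.** 1. For every $\Omega\in\mathfrak P_{T,S}$ and $\lambda\in\mathbb C^S$ the middle convolution $mc^x_\lambda(\Omega)$ is well defined (the subspaces $\mathcal K$ of $\mathcal L^{x}(\Omega)$ and of $\mathcal L^{-x}(add_{-\lambda}\mathcal{ML}^x(\Omega))$ are invariant), and it belongs to $\mathfrak P_{T,S}$. 2. For every $\Omega\in\mathfrak P^{irr}_{T,S}$: (i) $mc^x_\lambda(\Omega)\in\mathfrak P^{irr}_{T,S}$ for every $\lambda\in\mathbb C^S$ admissible for $\Omega$; in particular it is irreducible in the $x$-direction; (ii) $mc^x_0(\Omega)\sim\Omega$; (iii) $mc^x_\lambda\circ mc^x_\mu(\Omega)\sim mc^x_{\lambda+\mu}(\Omega)$ for all $\lambda,\mu\in\mathbb C^S$ with $\mu$ admissible for $\Omega$. 3. For every $\lambda\in\mathbb C^S$, $mc^x_\lambda$ induces a map on the $\sim$-classes of $\mathfrak P_{T,S}$, and this map restricts to a bijection from the classes of those $\Omega\in\mathfrak P^{irr}_{T,S}$ for which $\lambda$ is admissible onto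 the classes of those for which $-\lambda$ is admissible. -/

import Mathlib

/-!
Linear Pfaffian systems `du = Ω u` on `ℂⁿ`,
`Ω = ∑ᵢ (A_{xᵢ} + ∑_{j ≠ i} A_{xᵢxⱼ} xⱼ) dxᵢ + ∑_H A_H d log f_H`,
their middle Laplace transforms and the generalized middle convolution.
-/

universe u v

noncomputable section

open scoped Classical

namespace Pfaffian

/-! ### Affine hyperplanes -/

/-- An affine hyperplane in `ℂⁿ`, as a set of points. -/
@[ext]
structure Hyperplane (n : ℕ) where
  carrier : Set (Fin n → ℂ)
  exists_eq : ∃ (c : Fin n → ℂ) (d : ℂ), c ≠ 0 ∧ carrier = {x | ∑ i, c i * x i + d = 0}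

namespace Hyperplane

variable {n : ℕ}

/-- The linear coefficients `(f_H)_{xᵢ}` of a defining polynomial `f_H` of `H`; `f_H` is unique up
to a nonzero constant factor, on which neither `d log f_H` nor `a_H` depends. -/
def coeff (H : Hyperplane n) : Fin n → ℂ := H.exists_eq.choose

/-- The constant term of the same defining polynomial `f_H`. -/
def constTerm (H : Hyperplane n) : ℂ := H.exists_eq.choose_spec.choose

/-- The defining polynomial `f_H`. -/
def poly (H : Hyperplane n) (x : Fin n → ℂ) : ℂ := ∑ i, H.coeff i * x i + H.constTerm

/-- `f_H` depends on the variable `x_ℓ`. -/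
def DependsOn (H : Hyperplane n) (l : Fin n) : Prop := H.coeff l ≠ 0

/-- If `f_H` depends on `x_ℓ`, then `f_H = (f_H)_{x_ℓ} (x_ℓ - a_H)` with an affine function `a_H`
of the other variables. This is the constant term of `a_H`. -/
def aConst (l : Fin n) (H : Hyperplane n) : ℂ := -(H.constTerm / H.coeff l)

/-- The coefficient `(a_H)_z` of the variable `z = x_j` in `a_H`. -/
def aCoeff (l : Fin n) (H : Hyperplane n) (j : Fin n) : ℂ :=
  if j = l then 0 else -(H.coeff j / H.coeff l)

/-- The affine function `a_H`. -/
def aFun (l : Fin n) (H : Hyperplane n) (x : Fin n → ℂ) : ℂ :=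
  H.aConst l + ∑ j, H.aCoeff l j * x j

/-- Some hyperplane of the arrangement `T` depends on `x_ℓ` and on another variable as well. -/
def HasMixed (l : Fin n) (T : Finset (Hyperplane n)) : Prop :=
  ∃ H ∈ T, H.DependsOn l ∧ ∃ j, j ≠ l ∧ H.DependsOn j

end Hyperplane

/-! ### Pfaffian systems -/

/-- The coefficients of an `End(V)`-valued `1`-form
`Ω = ∑ᵢ (A_{xᵢ} + ∑_{j ≠ i} A_{xᵢxⱼ} xⱼ) dxᵢ + ∑_H A_H d log f_H`. The residue `A_H` is recorded
for every hyperplane (`A_H = 0` if `H` does not occur). By the linear independence of the forms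
`dxᵢ`, `xⱼ dxᵢ`, `d log f_H`, the form and its coefficients determine each other. -/
@[ext]
structure System (n : ℕ) (V : Type u) [AddCommGroup V] [Module ℂ V] where
  /-- `const i` is `A_{xᵢ}`. -/
  const : Fin n → Module.End ℂ V
  /-- `lin i j` is `A_{xᵢxⱼ}` for `i ≠ j`; the diagonal is put to zero in `System.Mem`. -/
  lin : Fin n → Fin n → Module.End ℂ V
  /-- `res H` is `A_H`. -/
  res : Hyperplane n → Module.End ℂ V

/-- The endomorphism of `ι → V` that acts on the `i`-th copy of `V` by `f i`. -/
def blockDiag {ι : Type*} {V : Type u} [AddCommGroup V] [Module ℂ V] (f : ι → Module.End ℂ V) :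
    Module.End ℂ (ι → V) :=
  LinearMap.pi fun i => f i ∘ₗ LinearMap.proj i

/-- The endomorphism of `V ⧸ K` induced by `f`, if `f` maps `K` into itself (and `0` otherwise). -/
def quotMap {V : Type u} [AddCommGroup V] [Module ℂ V] (K : Submodule ℂ V) (f : Module.End ℂ V) :
    Module.End ℂ (V ⧸ K) :=
  if h : K ≤ K.comap f then K.mapQ K f h else 0

namespace System

variable {n : ℕ} {V : Type u} [AddCommGroup V] [Module ℂ V]
  {W : Type v} [AddCommGroup W] [Module ℂ W]

/-- `S_{xᵢ}(x) = A_{xᵢ} + ∑_{j ≠ i} A_{xᵢxⱼ} xⱼ`. -/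
def polyPart (Ω : System n V) (i : Fin n) (x : Fin n → ℂ) : Module.End ℂ V :=
  Ω.const i + ∑ j ∈ Finset.univ.erase i, x j • Ω.lin i j

/-- The coefficient `Ω_{xᵢ}` of `dxᵢ` in `Ω`, evaluated at a point `x`. -/
def eval (Ω : System n V) (i : Fin n) (x : Fin n → ℂ) : Module.End ℂ V :=
  Ω.polyPart i x + ∑ᶠ H : Hyperplane n, (H.coeff i / H.poly x) • Ω.res H

/-- `Ω ∧ Ω = 0` on the complement of the singular hyperplanes. -/
def Integrable (Ω : System n V) : Prop :=
  ∀ x : Fin n → ℂ, (∀ H, Ω.res H ≠ 0 → x ∉ H.carrier) →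
    ∀ i j, Ω.eval i x * Ω.eval j x = Ω.eval j x * Ω.eval i x

/-- The class `𝔓_{T,S}` of systems in the direction `x_ℓ`, on spaces of any finite dimension. -/
structure Mem (l : Fin n) (T S : Finset (Hyperplane n)) (Ω : System n V) : Prop where
  finite : {H | Ω.res H ≠ 0}.Finite
  lin_self : ∀ i, Ω.lin i i = 0
  lin_symm : ∀ i j, Ω.lin i j = Ω.lin j i
  integrable : Ω.Integrable
  /-- `A_{x_ℓ}` is diagonalizable. -/
  diag_const : ⨆ c : ℂ, Module.End.eigenspace (Ω.const l) c = ⊤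
  /-- The `A_{x_ℓ z}` are diagonalizable. -/
  diag_lin : ∀ j, j ≠ l → ⨆ c : ℂ, Module.End.eigenspace (Ω.lin l j) c = ⊤
  lin_eq_zero : Hyperplane.HasMixed l T → ∀ j, j ≠ l → Ω.lin l j = 0
  /-- The singular hyperplanes that depend on `x_ℓ` belong to `T`. -/
  res_mem : ∀ H : Hyperplane n, H.DependsOn l → Ω.res H ≠ 0 → H ∈ T
  /-- The hyperplanes that make up `det (x_ℓ - S_{x_ℓ}(x)) = 0` belong to `S`. -/
  det_subset : {x : Fin n → ℂ | LinearMap.det (x l • (1 : Module.End ℂ V) - Ω.polyPart l x) = 0} ⊆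
    ⋃ H ∈ S, H.carrier

/-- Irreducibility in the direction `x_ℓ` (the rank being at least one): no invariant subspaces of
`A_{x_ℓ}`, the `A_{x_ℓ xⱼ}` and the `A_H` with `H` depending on `x_ℓ`, except the trivial ones. -/
def Irreducible (l : Fin n) (Ω : System n V) : Prop :=
  Nontrivial V ∧ ∀ U : Submodule ℂ V, U ≤ U.comap (Ω.const l) →
    (∀ j, j ≠ l → U ≤ U.comap (Ω.lin l j)) →
    (∀ H : Hyperplane n, H.DependsOn l → U ≤ U.comap (Ω.res H)) → U = ⊥ ∨ U = ⊤

/-- Some residue along a hyperplane of `T` is nonzero. For systems that are irreducible in the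
direction `x_ℓ` and whose singular hyperplanes depending on `x_ℓ` lie in `T`, this excludes
precisely the systems of rank one without finite singularities in the direction `x_ℓ`. -/
def HasPole (T : Finset (Hyperplane n)) (Ω : System n V) : Prop := ∃ H ∈ T, Ω.res H ≠ 0

/-- The class `𝔓^irr_{T,S}`. -/
structure MemIrr (l : Fin n) (T S : Finset (Hyperplane n)) (Ω : System n V) : Prop where
  mem : Ω.Mem l T S
  irreducible : Ω.Irreducible l
  hasPole : Ω.HasPole T

/-! ### Gauge equivalence -/

/-- The constant gauge transform of `Ω` by `P`. -/
def conj (P : V ≃ₗ[ℂ] W) (Ω : System n V) : System n W where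
  const i := P.conj (Ω.const i)
  lin i j := P.conj (Ω.lin i j)
  res H := P.conj (Ω.res H)

/-- `Ω ∼ Ω'`. -/
def GaugeEquiv (Ω : System n V) (Ω' : System n W) : Prop := ∃ P : V ≃ₗ[ℂ] W, Ω' = Ω.conj P

/-! ### The (inverse) Laplace transform in the direction `x_ℓ`

In the following `ε = 1` gives `𝓛^{x_ℓ}` and `ε = -1` gives the inverse transform `𝓛^{-x_ℓ}`. -/

/-- For a hyperplane `G` depending on `x_ℓ`: the joint eigenspace of `A_{x_ℓ}` and the `A_{x_ℓ z}`
on which `S_{x_ℓ}(x)` is multiplication by the affine function `ε a_G`. -/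
def eigSpace (eps : ℂ) (l : Fin n) (Ω : System n V) (G : Hyperplane n) : Submodule ℂ V :=
  Module.End.eigenspace (Ω.const l) (eps * G.aConst l) ⊓
    ⨅ j, ⨅ _ : j ≠ l, Module.End.eigenspace (Ω.lin l j) (eps * G.aCoeff l j)

/-- The sum of the joint eigenspaces of `S_{x_ℓ}(x)` that belong to other eigenvalues. -/
def eigCompl (eps : ℂ) (l : Fin n) (Ω : System n V) (G : Hyperplane n) : Submodule ℂ V :=
  ⨆ G' : Hyperplane n, ⨆ _ : G'.DependsOn l ∧ G' ≠ G, Ω.eigSpace eps l G'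

/-- The projection of `V` onto the joint eigenspace of `S_{x_ℓ}(x)` for the eigenvalue `ε a_G`
along the other joint eigenspaces (zero if `ε a_G` is not an eigenvalue). For systems in `𝔓_{T,S}`
the matrices in question commute and are diagonalizable, so that `V` is the direct sum of the joint
eigenspaces. -/
def eigProj (eps : ℂ) (l : Fin n) (Ω : System n V) (G : Hyperplane n) : Module.End ℂ V :=
  if h : IsCompl (Ω.eigSpace eps l G) (Ω.eigCompl eps l G) then
    (Ω.eigSpace eps l G).projection (Ω.eigCompl eps l G) h
  else 0

/-- The Laplace transform `𝓛^{x_ℓ}(Ω)` (`ε = 1`) and the inverse Laplace transform `𝓛^{-x_ℓ}(Ω)`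
(`ε = -1`), on one copy of `V` for each hyperplane in `T = 𝓐_{x_ℓ}`. Write `x = x_ℓ` and let `y`,
`z` be other variables. On the copy `V_H` that belongs to `H ∈ T`
* `B_x = -ε a_H(0)`, `B_{xz} = B_{zx} = -ε (a_H)_z`;
* `B_y = A_y + a_H(0) A_{yx} + (a_H)_y A_x`, `B_{yz} = A_{yz}`.
The residues are
* `v ↦ (-E_G ∑_{H'} A_{H'} v_{H'})_H` along a hyperplane `G` depending on `x`, where `E_G` is the
  projection onto the eigenspace of `S_x(x)` for the eigenvalue `ε a_G`;
* `v ↦ (A_G v_H + ∑_{H' : G = {a_H = a_{H'}}} A_{H'} (v_H - v_{H'}))_H` along a hyperplane `G` not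
  depending on `x`.

These are the coefficients of the system satisfied by the transforms
`V_H = ∫ u / (t - a_H) e^{-ε x t} dt`. -/
def laplace (eps : ℂ) (l : Fin n) (T : Finset (Hyperplane n)) (Ω : System n V) :
    System n (T → V) where
  const i :=
    if i = l then blockDiag fun H => (-eps * H.1.aConst l) • 1
    else blockDiag fun H =>
      Ω.const i + H.1.aConst l • Ω.lin i l + H.1.aCoeff l i • Ω.const l
  lin i j :=
    if i = j then 0
    else if i = l then blockDiag fun H => (-eps * H.1.aCoeff l j) • 1
    else if j = l then blockDiag fun H => (-eps * H.1.aCoeff l i) • 1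
    else blockDiag fun _ => Ω.lin i j
  res G :=
    if G.DependsOn l then
      LinearMap.pi fun _ =>
        -(Ω.eigProj eps l G ∘ₗ ∑ H' : T, Ω.res H'.1 ∘ₗ LinearMap.proj H')
    else
      LinearMap.pi fun H =>
        Ω.res G ∘ₗ LinearMap.proj H +
          ∑ H' : T, if G.carrier = {x | H.1.aFun l x = H'.1.aFun l x} then
            Ω.res H'.1 ∘ₗ ((LinearMap.proj H : (T → V) →ₗ[ℂ] V) - LinearMap.proj H') else 0

/-- `𝒦 = ⊕_{H ∈ T} ker A_H`. -/
def kerSum (T : Finset (Hyperplane n)) (Ω : System n V) : Submodule ℂ (T → V) :=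
  Submodule.pi Set.univ fun H => LinearMap.ker (Ω.res H.1)

/-- `𝒦` is invariant under the (inverse) Laplace transform, so that the latter induces a system on
the quotient by `𝒦`. -/
def KerInvariant (eps : ℂ) (l : Fin n) (T : Finset (Hyperplane n)) (Ω : System n V) : Prop :=
  (∀ i, Ω.kerSum T ≤ (Ω.kerSum T).comap ((Ω.laplace eps l T).const i)) ∧
  (∀ i j, Ω.kerSum T ≤ (Ω.kerSum T).comap ((Ω.laplace eps l T).lin i j)) ∧
  ∀ G, Ω.kerSum T ≤ (Ω.kerSum T).comap ((Ω.laplace eps l T).res G)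

/-- The space on which the middle Laplace transform lives. -/
abbrev MLSpace (T : Finset (Hyperplane n)) (Ω : System n V) : Type u := (T → V) ⧸ Ω.kerSum T

/-- The middle Laplace transform `𝓜𝓛^{x_ℓ}(Ω)` (`ε = 1`) and the inverse middle Laplace transform
`𝓜𝓛^{-x_ℓ}(Ω)` (`ε = -1`): the system induced by the (inverse) Laplace transform on the quotient
by `𝒦`. -/
def middleLaplace (eps : ℂ) (l : Fin n) (T : Finset (Hyperplane n)) (Ω : System n V) :
    System n (Ω.MLSpace T) where
  const i := quotMap (Ω.kerSum T) ((Ω.laplace eps l T).const i)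
  lin i j := quotMap (Ω.kerSum T) ((Ω.laplace eps l T).lin i j)
  res G := quotMap (Ω.kerSum T) ((Ω.laplace eps l T).res G)

/-! ### Addition and middle convolution -/

/-- The addition `Ω ↦ Ω + ∑_{H ∈ S} α_H d log f_H`. -/
def addition (S : Finset (Hyperplane n)) (α : S → ℂ) (Ω : System n V) : System n V where
  const := Ω.const
  lin := Ω.lin
  res H := Ω.res H + if h : H ∈ S then α ⟨H, h⟩ • 1 else 0

/-- `add_{-λ} ∘ 𝓜𝓛^{x_ℓ}` applied to `Ω ∈ 𝔓_{T,S}`. -/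
def shiftedML (l : Fin n) (T S : Finset (Hyperplane n)) (lam : S → ℂ) (Ω : System n V) :
    System n (Ω.MLSpace T) :=
  (Ω.middleLaplace 1 l T).addition S (-lam)

/-- The space on which the middle convolution lives. -/
abbrev MCSpace (l : Fin n) (T S : Finset (Hyperplane n)) (lam : S → ℂ) (Ω : System n V) : Type u :=
  (Ω.shiftedML l T S lam).MLSpace S

/-- The generalized middle convolution
`mc_λ^{x_ℓ} = 𝓜𝓛^{-x_ℓ} ∘ add_{-λ}^{x_ℓ} ∘ 𝓜𝓛^{x_ℓ}` of `Ω ∈ 𝔓_{T,S}`. -/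
def mc (l : Fin n) (T S : Finset (Hyperplane n)) (lam : S → ℂ) (Ω : System n V) :
    System n (Ω.MCSpace l T S lam) :=
  (Ω.shiftedML l T S lam).middleLaplace (-1) l S

/-- `λ` is admissible for `Ω ∈ 𝔓^irr_{T,S}`: the residues of `add_{-λ}(𝓜𝓛^{x_ℓ}(Ω))` along the
hyperplanes in `S` are not all zero. -/
def Admissible (l : Fin n) (T S : Finset (Hyperplane n)) (lam : S → ℂ) (Ω : System n V) : Prop :=
  (Ω.shiftedML l T S lam).HasPole S

end System

/-! ### Gauge classes -/

/-- Systems of matrices of any size. -/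
abbrev MatrixSystem (n : ℕ) : Type := Σ N : ℕ, System n (Fin N → ℂ)

/-- Gauge equivalence of systems of matrices. -/
instance matrixSystemSetoid (n : ℕ) : Setoid (MatrixSystem n) where
  r A B := A.2.GaugeEquiv B.2
  iseqv :=
    { refl := fun A => ⟨LinearEquiv.refl ℂ _, by ext <;> simp [System.conj]⟩
      symm := by
        rintro ⟨N, A⟩ ⟨M, B⟩ ⟨P, hP⟩
        refine ⟨P.symm, ?_⟩
        dsimp only at P hP ⊢
        rw [hP]
        ext <;> simp [System.conj, LinearEquiv.conj_apply]
      trans := by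
        rintro ⟨N, A⟩ ⟨M, B⟩ ⟨L, C⟩ ⟨P, hP⟩ ⟨Q, hQ⟩
        refine ⟨P.trans Q, ?_⟩
        dsimp only at P Q hP hQ ⊢
        rw [hQ, hP]
        ext <;> simp [System.conj, LinearEquiv.conj_apply] }

/-- The set of gauge classes of systems. -/
abbrev GaugeClass (n : ℕ) : Type := Quotient (matrixSystemSetoid n)

/-- The gauge class of a system on a finite dimensional space: write it in any basis. -/
def gaugeClass {n : ℕ} {V : Type u} [AddCommGroup V] [Module ℂ V] [FiniteDimensional ℂ V]
    (Ω : System n V) : GaugeClass n :=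
  Quotient.mk _ ⟨Module.finrank ℂ V, Ω.conj (Module.finBasis ℂ V).equivFun⟩

/-- The classes in `𝔐^irr_{T,S}` of the systems for which `λ` is admissible. -/
def irrClasses {n : ℕ} (l : Fin n) (T S : Finset (Hyperplane n)) (lam : S → ℂ) :
    Set (GaugeClass n) :=
  {c | ∃ (N : ℕ) (Ω : System n (Fin N → ℂ)),
    Ω.MemIrr l T S ∧ Ω.Admissible l T S lam ∧ gaugeClass Ω = c}

end Pfaffian

end

/-!
At a point `p` and for the distinguished variable `x = x_ℓ`, a system in `𝔓_{T,S}` on `V` is written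
with `W = V^T`, `D = diag (a_H(p))`, `P v = ∑ A_H v_H` and the diagonal embedding `Q : V → W` as
`Ω_x = S + P (x - D)⁻¹ Q` and `Ω_{xᵢ} = x dSᵢ + Nᵢ - P dDᵢ (x - D)⁻¹ Q`. The Laplace transform on
`W` is `-ε D - Q (x - ε S)⁻¹ P` and `-ε x dDᵢ + Mᵢ + ε Q dSᵢ (x - ε S)⁻¹ P`, with the roles of `V`
and `W` exchanged. Integrability amounts to a list of relations between these maps (`DualDatum`),
which is symmetric under the exchange (`DualDatum.swap`). That an integrable system satisfies the
relations at generic points is `System.Tame.dualDatum`, an expansion into partial fractions in `x`;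
conversely the relations make the coefficients commute. Identities between systems at generic points
are identities between their coefficients, since the forms `dxᵢ`, `xⱼ dxᵢ` and `d log f_H` are
linearly independent (`eq_zero_of_form_eq_zero`). In this way the transform of an integrable system
is integrable, and it preserves `𝒦` (`System.Adapted.laplace`, `System.Adapted.kerInvariant`).

The transforms thus act between the classes `System.Adapted ε l T S`, in which the singular
hyperplanes that depend on `x` belong to `T` and `S_x` is diagonalizable with eigenvalues `ε a_G`,
`G ∈ S`: the transform turns singular hyperplanes into eigenvalues and eigenvalues into singular
hyperplanes, so that `ε` changes its sign and `T`, `S` are exchanged. For `ε = 1` the class is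
`𝔓_{T,S}`. Additions along the singular hyperplanes preserve the classes, so `mc_λ` preserves
`𝔓_{T,S}`.

For an irreducible system with a pole, the transform is irreducible and has a pole
(`System.Adapted.middleLaplace_irreducible`, `System.Adapted.middleLaplace_hasPole`), and the
inverse transform leads back to the system one started with
(`System.Adapted.middleLaplace_middleLaplace`): the map `(w_G)_G ↦ ∑_G E_G P w_G` is a morphism from
the Laplace transform of the middle transform onto the system, and its kernel is `𝒦`. Hence `mc_0(Ω)
∼ Ω`, and `mc_λ ∘ mc_μ ∼ mc_{λ+μ}` because the inner transforms in `𝓜𝓛^{-x} ∘ add_{-λ} ∘ 𝓜𝓛^{x} ∘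
𝓜𝓛^{-x} ∘ add_{-μ} ∘ 𝓜𝓛^{x}` cancel. Since `mc_{-λ} ∘ mc_λ ∼ mc_0`, the maps on gauge classes
induced by `mc_λ` and `mc_{-λ}` are inverse to each other.
-/

universe w

noncomputable section

open scoped Classical
open Filter Topology

namespace Pfaffian

/-! ### Affine hyperplanes in general position -/

namespace Hyperplane

variable {n : ℕ}

theorem coeff_ne_zero (H : Hyperplane n) : H.coeff ≠ 0 :=
  H.exists_eq.choose_spec.choose_spec.1

theorem mem_carrier (H : Hyperplane n) (x : Fin n → ℂ) : x ∈ H.carrier ↔ H.poly x = 0 := by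
  have h := H.exists_eq.choose_spec.choose_spec.2
  constructor
  · intro hx
    rw [h] at hx
    exact hx
  · intro hx
    rw [h]
    exact hx

/-- The hyperplane `∑ cᵢ xᵢ + d = 0`. -/
def ofAffine (c : Fin n → ℂ) (d : ℂ) (hc : c ≠ 0) : Hyperplane n :=
  ⟨{x | ∑ i, c i * x i + d = 0}, c, d, hc, rfl⟩

/-- If a nonconstant affine function vanishes on the zero set of another one, then the two are
proportional. -/
theorem exists_eq_mul_of_forall_eq_zero {c c' : Fin n → ℂ} {d d' : ℂ} (hc : c ≠ 0) (hc' : c' ≠ 0)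
    (h : ∀ x : Fin n → ℂ, ∑ i, c i * x i + d = 0 → ∑ i, c' i * x i + d' = 0) :
    ∃ k : ℂ, k ≠ 0 ∧ (∀ i, c' i = k * c i) ∧ d' = k * d := by
  obtain ⟨m, hm⟩ := Function.ne_iff.mp hc
  simp only [Pi.zero_apply] at hm
  have key : ∀ j, ∀ s : ℂ, c' j * s + c' m * (-(d + c j * s) / c m) + d' = 0 := by
    intro j s
    have := h (Pi.single j s + Pi.single m (-(d + c j * s) / c m)) (by
      simp only [Pi.add_apply, mul_add, Finset.sum_add_distrib, Pi.single_apply, mul_ite, mul_zero,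
        Finset.sum_ite_eq', Finset.mem_univ, if_true]
      field_simp
      ring)
    simpa only [Pi.add_apply, mul_add, Finset.sum_add_distrib, Pi.single_apply, mul_ite, mul_zero,
      Finset.sum_ite_eq', Finset.mem_univ, if_true] using this
  have hd : d' = c' m / c m * d := by
    have := key m 0
    field_simp at this ⊢
    linear_combination this
  have hj : ∀ j, c' j = c' m / c m * c j := by
    intro j
    have := key j 1
    rw [hd] at this
    field_simp at this ⊢
    linear_combination this
  refine ⟨c' m / c m, ?_, hj, hd⟩
  intro h0
  apply hc'
  ext j
  rw [hj j, h0, zero_mul, Pi.zero_apply]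

theorem exists_eq_mul_of_carrier_eq {G : Hyperplane n} {c : Fin n → ℂ} {d : ℂ} (hc : c ≠ 0)
    (h : G.carrier = {x | ∑ i, c i * x i + d = 0}) :
    ∃ k : ℂ, k ≠ 0 ∧ (∀ i, G.coeff i = k * c i) ∧ G.constTerm = k * d := by
  refine exists_eq_mul_of_forall_eq_zero hc G.coeff_ne_zero fun x hx => ?_
  rw [← poly, ← mem_carrier, h]
  exact hx

theorem eq_of_carrier_subset {G H : Hyperplane n} (h : G.carrier ⊆ H.carrier) : G = H := by
  obtain ⟨k, hk, hc, hd⟩ := exists_eq_mul_of_forall_eq_zero G.coeff_ne_zero H.coeff_ne_zero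
    (d := G.constTerm) (d' := H.constTerm)
    fun x hx => (H.mem_carrier x).1 (h ((G.mem_carrier x).2 hx))
  ext x
  have : H.poly x = k * G.poly x := by
    simp only [poly, hc, hd, mul_add, Finset.mul_sum, mul_assoc]
  rw [mem_carrier, mem_carrier, this, mul_eq_zero, or_iff_right hk]

/-- The values of `f_H` on the line through `p` and `q`. -/
theorem poly_add_smul_sub (H : Hyperplane n) (p q : Fin n → ℂ) (s : ℂ) :
    H.poly (p + s • (q - p)) = H.poly p + s * (H.poly q - H.poly p) := by
  simp only [poly, Pi.add_apply, Pi.smul_apply, Pi.sub_apply, smul_eq_mul]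
  have : ∀ i, H.coeff i * (p i + s * (q i - p i)) =
      H.coeff i * p i + s * (H.coeff i * q i - H.coeff i * p i) := fun i => by ring
  simp only [this, Finset.sum_add_distrib, ← Finset.mul_sum, Finset.sum_sub_distrib]
  ring

theorem carrier_nonempty (H : Hyperplane n) : H.carrier.Nonempty := by
  obtain ⟨m, hm⟩ := Function.ne_iff.mp H.coeff_ne_zero
  refine ⟨Pi.single m (-H.constTerm / H.coeff m), ?_⟩
  rw [mem_carrier, poly]
  simp only [Pi.single_apply, mul_ite, mul_zero, Finset.sum_ite_eq', Finset.mem_univ, if_true]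
  simp only [Pi.zero_apply] at hm
  field_simp
  ring

theorem exists_notMem_carrier (H : Hyperplane n) : ∃ x, x ∉ H.carrier := by
  by_contra! h
  obtain ⟨m, hm⟩ := Function.ne_iff.mp H.coeff_ne_zero
  have h0 := (H.mem_carrier _).1 (h 0)
  have h1 := (H.mem_carrier _).1 (h (Pi.single m 1))
  simp only [poly, Pi.zero_apply, mul_zero, Finset.sum_const_zero, zero_add] at h0
  simp only [poly, Pi.single_apply, mul_ite, mul_zero, Finset.sum_ite_eq', Finset.mem_univ,
    if_true, h0, add_zero, mul_one] at h1
  exact hm h1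

/-- A hyperplane is not covered by finitely many other hyperplanes. -/
theorem exists_mem_forall_notMem (G : Hyperplane n) (F : Finset (Hyperplane n)) (hG : G ∉ F) :
    ∃ p ∈ G.carrier, ∀ H ∈ F, p ∉ H.carrier := by
  induction F using Finset.induction_on with
  | empty =>
    obtain ⟨p, hp⟩ := G.carrier_nonempty
    exact ⟨p, hp, by simp⟩
  | insert H F hHF ih =>
    obtain ⟨p, hp, hpF⟩ := ih fun h => hG (Finset.mem_insert_of_mem h)
    have hne : ¬ G.carrier ⊆ H.carrier := fun h =>
      hG (eq_of_carrier_subset h ▸ Finset.mem_insert_self _ _)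
    obtain ⟨q, hq, hqH⟩ := Set.not_subset.1 hne
    -- all but finitely many points of the line through `p` and `q` avoid the members of `F`
    have hfin : (⋃ H' ∈ insert H F, {s : ℂ | H'.poly (p + s • (q - p)) = 0}).Finite := by
      refine (insert H F).finite_toSet.biUnion fun H' hH' => Set.Subsingleton.finite ?_
      intro s hs s' hs'
      simp only [Set.mem_ofPred_eq, poly_add_smul_sub] at hs hs'
      by_contra hss
      have h1 : (s - s') * (H'.poly q - H'.poly p) = 0 := by linear_combination hs - hs'
      have h2 : H'.poly q - H'.poly p = 0 :=
        (mul_eq_zero.1 h1).resolve_left (sub_ne_zero.2 hss)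
      have h3 : H'.poly p = 0 := by linear_combination hs - s * h2
      rcases Finset.mem_insert.1 hH' with rfl | h
      · exact hqH ((mem_carrier _ _).2 (by linear_combination h2 + h3))
      · exact hpF H' h ((mem_carrier _ _).2 h3)
    obtain ⟨s, hs⟩ := hfin.exists_notMem
    simp only [Set.mem_iUnion, not_exists, Set.mem_ofPred_eq] at hs
    refine ⟨p + s • (q - p), ?_, fun H' hH' h => hs H' hH' ((mem_carrier _ _).1 h)⟩
    rw [mem_carrier] at hp hq ⊢
    rw [poly_add_smul_sub, hp, hq]
    ring

theorem continuous_poly (H : Hyperplane n) : Continuous H.poly := by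
  unfold poly
  fun_prop

theorem isClosed_carrier (H : Hyperplane n) : IsClosed H.carrier := by
  have : H.carrier = H.poly ⁻¹' {0} := by
    ext x
    simp [mem_carrier]
  rw [this]
  exact isClosed_singleton.preimage H.continuous_poly

theorem dense_compl_carrier (H : Hyperplane n) : Dense H.carrierᶜ := by
  intro p
  obtain ⟨q, hq⟩ := H.exists_notMem_carrier
  by_cases hp : p ∈ H.carrier
  · have ht : Tendsto (fun s : ℂ => p + s • (q - p)) (𝓝[≠] 0) (𝓝 p) := by
      have : Continuous fun s : ℂ => p + s • (q - p) := by fun_prop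
      simpa using (this.tendsto 0).mono_left nhdsWithin_le_nhds
    refine mem_closure_of_tendsto ht ?_
    filter_upwards [self_mem_nhdsWithin] with s hs
    rw [mem_carrier] at hp hq
    rw [Set.mem_compl_iff, mem_carrier, poly_add_smul_sub, hp, zero_add, sub_zero]
    exact mul_ne_zero hs hq
  · exact subset_closure hp

theorem dense_forall_notMem (F : Finset (Hyperplane n)) :
    Dense {x : Fin n → ℂ | ∀ H ∈ F, x ∉ H.carrier} := by
  induction F using Finset.induction_on with
  | empty => simp
  | insert H F hHF ih =>
    have := H.dense_compl_carrier.inter_of_isOpen_left ih H.isClosed_carrier.isOpen_compl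
    convert this using 1
    ext x
    simp

end Hyperplane

/-! ### Generic points and partial fractions -/

/-- The filter of sets that contain the complement of a finite union of hyperplanes. A property
that holds eventually along it is said to hold at generic points. -/
def generic (n : ℕ) : Filter (Fin n → ℂ) where
  sets := {s | ∃ F : Finset (Hyperplane n), ∀ x, (∀ H ∈ F, x ∉ H.carrier) → x ∈ s}
  univ_sets := ⟨∅, fun _ _ => trivial⟩
  sets_of_superset := by
    rintro s t ⟨F, hF⟩ hst
    exact ⟨F, fun _ hx => hst (hF _ hx)⟩
  inter_sets := by
    rintro s t ⟨F, hF⟩ ⟨F', hF'⟩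
    refine ⟨F ∪ F', fun x hx => ⟨hF x fun H hH => hx H ?_, hF' x fun H hH => hx H ?_⟩⟩
    · exact Finset.mem_union_left _ hH
    · exact Finset.mem_union_right _ hH

section Generic

variable {n : ℕ}

theorem eventually_generic_iff {p : (Fin n → ℂ) → Prop} :
    (∀ᶠ x in generic n, p x) ↔
      ∃ F : Finset (Hyperplane n), ∀ x, (∀ H ∈ F, x ∉ H.carrier) → p x := Iff.rfl

theorem eventually_notMem_carrier (H : Hyperplane n) : ∀ᶠ x in generic n, x ∉ H.carrier :=
  eventually_generic_iff.2 ⟨{H}, fun _ hx => hx H (Finset.mem_singleton_self H)⟩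

theorem eventually_poly_ne_zero (H : Hyperplane n) : ∀ᶠ x in generic n, H.poly x ≠ 0 := by
  filter_upwards [eventually_notMem_carrier H] with x hx
  rwa [H.mem_carrier] at hx

/-- A function that vanishes at generic points vanishes wherever it is continuous. -/
theorem eq_zero_of_eventually_generic {f : (Fin n → ℂ) → ℂ} {p : Fin n → ℂ}
    (hf : ContinuousAt f p) (h : ∀ᶠ x in generic n, f x = 0) : f p = 0 := by
  by_contra hp
  obtain ⟨F, hF⟩ := eventually_generic_iff.1 h
  have hmem : {x | f x ≠ 0} ∈ 𝓝 p := hf.eventually_ne hp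
  obtain ⟨x, hx, hxF⟩ := (Hyperplane.dense_forall_notMem F).inter_nhds_nonempty hmem
  exact hxF (hF x hx)

instance generic_neBot : (generic n).NeBot := by
  refine ⟨fun h => ?_⟩
  have := eq_zero_of_eventually_generic (n := n) (f := fun _ => 1) (p := 0) continuousAt_const
    (by rw [h]; trivial)
  exact one_ne_zero this

/-- The forms `dxᵢ`, `xⱼ dxᵢ` and `d log f_H` are linearly independent, over `ℂ`-vector spaces of
coefficients. This turns identities between systems at generic points into identities between their
coefficients. -/
theorem eq_zero_of_form_eq_zero {X : Type*} [AddCommGroup X] [Module ℂ X] {c : Fin n → X}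
    {L : Fin n → Fin n → X} {r : Hyperplane n → X} (hr : {H | r H ≠ 0}.Finite)
    (h : ∀ i, ∀ᶠ x in generic n, c i + ∑ j ∈ Finset.univ.erase i, x j • L i j +
      ∑ᶠ H : Hyperplane n, (H.coeff i / H.poly x) • r H = 0) :
    (∀ i, c i = 0) ∧ (∀ i j, i ≠ j → L i j = 0) ∧ ∀ H, r H = 0 := by
  have hsum : ∀ i x, ∑ᶠ H : Hyperplane n, (H.coeff i / H.poly x) • r H =
      ∑ H ∈ hr.toFinset, (H.coeff i / H.poly x) • r H := fun i x => by
    refine finsum_eq_sum_of_support_subset _ fun H hH => ?_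
    simp only [Set.Finite.coe_toFinset, Set.mem_ofPred_eq]
    rintro h0
    simp [h0] at hH
  simp only [hsum] at h
  have hscal : ∀ (φ : Module.Dual ℂ X) (i : Fin n), ∀ᶠ x in generic n,
      φ (c i) + ∑ j ∈ Finset.univ.erase i, x j * φ (L i j) +
      ∑ H ∈ hr.toFinset, (H.coeff i / H.poly x) * φ (r H) = 0 := by
    intro φ i
    filter_upwards [h i] with x hx
    have := congrArg φ hx
    simpa only [map_add, map_sum, map_smul, smul_eq_mul, map_zero] using this
  have hr0 : ∀ H, r H = 0 := by
    intro G
    by_contra hG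
    obtain ⟨φ, hφ⟩ : ∃ φ : Module.Dual ℂ X, φ (r G) ≠ 0 := by
      by_contra! h0
      exact hG ((Module.forall_dual_apply_eq_zero_iff ℂ _).1 h0)
    obtain ⟨i, hi⟩ := Function.ne_iff.mp G.coeff_ne_zero
    have hGm : G ∈ hr.toFinset := by simpa using hG
    obtain ⟨p, hpG, hp⟩ := G.exists_mem_forall_notMem (hr.toFinset.erase G)
      (Finset.notMem_erase _ _)
    rw [G.mem_carrier] at hpG
    -- the residue along `G`, as the value at a point of `G` on no other singular hyperplane
    let f : (Fin n → ℂ) → ℂ := fun x =>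
      G.poly x * (φ (c i) + ∑ j ∈ Finset.univ.erase i, x j * φ (L i j)) + G.coeff i * φ (r G) +
        ∑ H ∈ hr.toFinset.erase G, G.poly x * (H.coeff i / H.poly x) * φ (r H)
    have hf0 : f p = 0 := by
      refine eq_zero_of_eventually_generic ?_ ?_
      · have hG' : ContinuousAt G.poly p := G.continuous_poly.continuousAt
        refine ContinuousAt.add (ContinuousAt.add (hG'.mul ?_) continuousAt_const) ?_
        · exact (continuous_const.add
            (continuous_finsetSum _ fun j _ => by fun_prop)).continuousAt
        · refine tendsto_finsetSum _ fun H hH => ?_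
          have hne : H.poly p ≠ 0 := fun h0 => hp H hH ((H.mem_carrier _).2 h0)
          exact (hG'.mul (continuousAt_const.div H.continuous_poly.continuousAt hne)).mul
            continuousAt_const
      · filter_upwards [hscal φ i, eventually_poly_ne_zero G] with x hx hGx
        rw [← Finset.add_sum_erase _ _ hGm] at hx
        have := congrArg (fun z => G.poly x * z) hx
        simp only [mul_add, Finset.mul_sum, mul_zero] at this
        simp only [f, mul_add, Finset.mul_sum]
        rw [← this]
        have h1 : G.poly x * (G.coeff i / G.poly x * φ (r G)) = G.coeff i * φ (r G) := by
          field_simp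
        rw [h1, add_assoc, add_assoc, add_assoc]
        simp only [mul_assoc]
    have : f p = G.coeff i * φ (r G) := by
      simp [f, hpG]
    exact mul_ne_zero hi hφ (this ▸ hf0)
  have hlin : ∀ (φ : Module.Dual ℂ X) (i : Fin n) (x : Fin n → ℂ),
      φ (c i) + ∑ j ∈ Finset.univ.erase i, x j * φ (L i j) = 0 := by
    intro φ i x
    refine eq_zero_of_eventually_generic
      (f := fun x => φ (c i) + ∑ j ∈ Finset.univ.erase i, x j * φ (L i j))
      (continuous_const.add (continuous_finsetSum _ fun j _ => by fun_prop)).continuousAt ?_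
    filter_upwards [hscal φ i] with y hy
    simpa [hr0] using hy
  have hc : ∀ i, c i = 0 := fun i =>
    (Module.forall_dual_apply_eq_zero_iff ℂ _).1 fun φ => by simpa using hlin φ i 0
  refine ⟨hc, fun i j hij => (Module.forall_dual_apply_eq_zero_iff ℂ _).1 fun φ => ?_, hr0⟩
  have := hlin φ i (Pi.single j 1)
  simpa [hc, Pi.single_apply, hij.symm, Finset.sum_ite_eq'] using this

/-- A function `c₂ t² + c₁ t + c₀ + ∑ rₖ / (t - aₖ)` of one variable vanishes only if all its
coefficients do. -/
theorem eq_zero_of_partialFractions {X : Type*} [AddCommGroup X] [Module ℂ X] {ι : Type*}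
    [Fintype ι] {a : ι → ℂ} (ha : Function.Injective a) {c₂ c₁ c₀ : X} {r : ι → X}
    (h : ∀ t : ℂ, (∀ k, t ≠ a k) →
      t ^ 2 • c₂ + t • c₁ + c₀ + ∑ k, (1 / (t - a k)) • r k = 0) :
    c₂ = 0 ∧ c₁ = 0 ∧ c₀ = 0 ∧ ∀ k, r k = 0 := by
  have hscal : ∀ (φ : Module.Dual ℂ X) (t : ℂ), (∀ k, t ≠ a k) →
      t ^ 2 * φ c₂ + t * φ c₁ + φ c₀ + ∑ k, (1 / (t - a k)) * φ (r k) = 0 := by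
    intro φ t ht
    have := congrArg φ (h t ht)
    simpa only [map_add, map_sum, map_smul, smul_eq_mul, map_zero] using this
  have hev : ∀ s : ℂ, ∀ᶠ t in 𝓝[≠] s, ∀ k, t ≠ a k := by
    intro s
    rw [eventually_all]
    intro k
    by_cases hk : a k = s
    · rw [hk]
      exact self_mem_nhdsWithin
    · exact nhdsWithin_le_nhds (isOpen_ne.mem_nhds (Ne.symm hk))
  have hr : ∀ k, r k = 0 := fun m =>
    (Module.forall_dual_apply_eq_zero_iff ℂ _).1 fun φ => by
      let f : ℂ → ℂ := fun t => (t - a m) * (t ^ 2 * φ c₂ + t * φ c₁ + φ c₀) + φ (r m) +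
        ∑ k ∈ Finset.univ.erase m, (t - a m) * (1 / (t - a k)) * φ (r k)
      have hf : ContinuousAt f (a m) := by
        refine ContinuousAt.add (by fun_prop) (tendsto_finsetSum _ fun k hk => ?_)
        have hne : a m - a k ≠ 0 :=
          sub_ne_zero.2 fun h' => Finset.ne_of_mem_erase hk (ha h').symm
        have h1 : ContinuousAt (fun t : ℂ => t - a k) (a m) := by fun_prop
        have h2 : ContinuousAt (fun t : ℂ => t - a m) (a m) := by fun_prop
        exact (h2.mul (continuousAt_const.div h1 hne)).mul continuousAt_const
      have h0 : ∀ᶠ t in 𝓝[≠] (a m), f t = 0 := by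
        filter_upwards [hev (a m)] with t ht
        have h1 := hscal φ t ht
        have ht' : t - a m ≠ 0 := sub_ne_zero.2 (ht m)
        rw [← Finset.add_sum_erase _ _ (Finset.mem_univ m)] at h1
        have h2 := congrArg (fun z => (t - a m) * z) h1
        have h3 : (t - a m) * (1 / (t - a m) * φ (r m)) = φ (r m) := by
          field_simp
        simp only [mul_add, Finset.mul_sum, mul_zero, h3] at h2
        simp only [f, mul_add, mul_assoc]
        linear_combination h2
      have h1 : f (a m) = 0 := tendsto_nhds_unique
        (hf.tendsto.mono_left nhdsWithin_le_nhds)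
        (tendsto_const_nhds.congr' (h0.mono fun t ht => ht.symm))
      simpa [f] using h1
  have hpoly : ∀ (φ : Module.Dual ℂ X) (t : ℂ), t ^ 2 * φ c₂ + t * φ c₁ + φ c₀ = 0 := by
    intro φ s
    have hf : ContinuousAt (fun t : ℂ => t ^ 2 * φ c₂ + t * φ c₁ + φ c₀) s := by fun_prop
    have hf' := hf.tendsto.mono_left (nhdsWithin_le_nhds (s := {s}ᶜ))
    refine tendsto_nhds_unique hf' (tendsto_const_nhds.congr' ?_)
    filter_upwards [hev s] with t ht
    simpa [hr] using (hscal φ t ht).symm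
  refine ⟨?_, ?_, ?_, hr⟩ <;> refine (Module.forall_dual_apply_eq_zero_iff ℂ _).1 fun φ => ?_
  · linear_combination (hpoly φ 1 + hpoly φ (-1)) / 2 - hpoly φ 0
  · linear_combination (hpoly φ 1 - hpoly φ (-1)) / 2
  · linear_combination hpoly φ 0

end Generic

/-! ### The algebraic duality behind the Laplace transform -/

section Duality

variable {ι : Type*} {V : Type u} [AddCommGroup V] [Module ℂ V]
  {W : Type v} [AddCommGroup W] [Module ℂ W]

/-- For `R = (t - D)⁻¹`, the commutator of `S + P R Q` and `t dS + N - P dD R Q` is a polynomial in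
`t` plus a term linear in `R`: products of two resolvents cancel by the relations on `W`. -/
theorem commutator_eq_of_intertwining {S dS N : Module.End ℂ V} {D dD M R : Module.End ℂ W}
    {P : W →ₗ[ℂ] V} {Q : V →ₗ[ℂ] W} {t : ℂ}
    (hDR : ∀ w, t • R w = w + D (R w)) (hRD : ∀ w, t • R w = w + R (D w))
    (hRdD : ∀ w, R (dD w) = dD (R w))
    (hDM : ∀ w, D (M w) - M (D w) + (dD (Q (P w)) - Q (P (dD w))) = 0)
    (hMQ : ∀ v, M (Q v) = Q (N v) + dD (Q (S v)) + D (Q (dS v))) (v : V) :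
    (S + P ∘ₗ R ∘ₗ Q) ((t • dS + N - P ∘ₗ dD ∘ₗ R ∘ₗ Q) v) -
      (t • dS + N - P ∘ₗ dD ∘ₗ R ∘ₗ Q) ((S + P ∘ₗ R ∘ₗ Q) v) =
    t • (S (dS v) - dS (S v)) + (S (N v) - N (S v) + (P (Q (dS v)) - dS (P (Q v)))) +
      (P (M (R (Q v))) - N (P (R (Q v))) - S (P (dD (R (Q v)))) - dS (P (D (R (Q v))))) := by
  have e1 := hDR (Q v)
  have e2 := congrArg (fun w => P (R (M w))) e1
  have e3 := congrArg P (hRD (M (R (Q v))))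
  have e4 := congrArg (fun w => P (R w)) (hDM (R (Q v)))
  have e5 := congrArg (fun w => P (R w)) (hMQ v)
  have e6 := congrArg P (hRD (Q (dS v)))
  have e7 := congrArg P (hRdD (Q (S v)))
  have e8 := congrArg P (hRdD (Q (P (R (Q v)))))
  have e9 := congrArg (fun w => dS (P w)) e1
  simp only [LinearMap.add_apply, LinearMap.sub_apply, LinearMap.comp_apply, LinearMap.smul_apply,
    map_add, map_sub, map_smul, map_zero] at *
  linear_combination (norm := module) e6 - e9 - e7 - e5 - e8 + e4 - e2 + e3

/-- The analogue of `commutator_eq_of_intertwining` for two directions other than `x`. Here the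
relation for `P M` removes the resolvent altogether. -/
theorem commutator_eq_of_intertwining' {S dS dS' N N' : Module.End ℂ V}
    {D dD dD' M M' R : Module.End ℂ W} {P : W →ₗ[ℂ] V} {Q : V →ₗ[ℂ] W} {t : ℂ}
    (hDR : ∀ w, t • R w = w + D (R w)) (hRD : ∀ w, t • R w = w + R (D w))
    (hRdD : ∀ w, R (dD w) = dD (R w)) (hRdD' : ∀ w, R (dD' w) = dD' (R w))
    (hDdD : ∀ w, D (dD w) = dD (D w)) (hDdD' : ∀ w, D (dD' w) = dD' (D w))
    (hdD : ∀ w, dD (dD' w) = dD' (dD w))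
    (hDM : ∀ w, D (M w) - M (D w) + (dD (Q (P w)) - Q (P (dD w))) = 0)
    (hDM' : ∀ w, D (M' w) - M' (D w) + (dD' (Q (P w)) - Q (P (dD' w))) = 0)
    (hdDM : ∀ w, dD (M' w) - M' (dD w) + (M (dD' w) - dD' (M w)) = 0)
    (hPM : ∀ w, P (M w) = N (P w) + S (P (dD w)) + dS (P (D w)))
    (hPM' : ∀ w, P (M' w) = N' (P w) + S (P (dD' w)) + dS' (P (D w)))
    (hMQ : ∀ v, M (Q v) = Q (N v) + dD (Q (S v)) + D (Q (dS v)))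
    (hMQ' : ∀ v, M' (Q v) = Q (N' v) + dD' (Q (S v)) + D (Q (dS' v))) (v : V) :
    (t • dS + N - P ∘ₗ dD ∘ₗ R ∘ₗ Q) ((t • dS' + N' - P ∘ₗ dD' ∘ₗ R ∘ₗ Q) v) -
      (t • dS' + N' - P ∘ₗ dD' ∘ₗ R ∘ₗ Q) ((t • dS + N - P ∘ₗ dD ∘ₗ R ∘ₗ Q) v) =
    t ^ 2 • (dS (dS' v) - dS' (dS v)) +
      t • (dS (N' v) - N' (dS v) + (N (dS' v) - dS' (N v))) +
      (N (N' v) - N' (N v) - (dS (P (dD' (Q v))) - P (dD' (Q (dS v)))) -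
        (P (dD (Q (dS' v))) - dS' (P (dD (Q v))))) := by
  have e1 := hDR (Q v)
  have ea := congrArg (fun w => dS (P (dD' w))) e1
  have eb := congrArg (fun w => dS' (P (dD w))) e1
  have p1 := hPM (dD' (R (Q v)))
  have p2 := hPM' (dD (R (Q v)))
  have c1 := congrArg (fun w => S (P w)) (hdD (R (Q v)))
  have c2 := congrArg (fun w => dS (P w)) (hDdD' (R (Q v)))
  have c3 := congrArg (fun w => dS' (P w)) (hDdD (R (Q v)))
  have f1 := congrArg (fun w => P (dD w)) (hRD (Q (dS' v)))
  have f2 := congrArg (fun w => P (dD' w)) (hRD (Q (dS v)))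
  have g1 := congrArg (fun w => P (dD (R w))) (hMQ' v)
  have g2 := congrArg (fun w => P (dD' (R w))) (hMQ v)
  have k1 := congrArg (fun w => P (dD w)) (hRdD' (Q (S v)))
  have k2 := congrArg (fun w => P (dD' w)) (hRdD (Q (S v)))
  have k3 := congrArg P (hdD (R (Q (S v))))
  have r1 := congrArg P (hRdD (M' (Q v)))
  have r2 := congrArg P (hRdD' (M (Q v)))
  have r3 := congrArg P (hRdD (Q (P (dD' (R (Q v))))))
  have r4 := congrArg P (hRdD' (Q (P (dD (R (Q v))))))
  have s1 := congrArg P (hRD (M (dD' (R (Q v)))))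
  have s2 := congrArg P (hRD (M' (dD (R (Q v)))))
  have s3 := congrArg (fun w => P (R (dD (M' w)))) e1
  have s4 := congrArg (fun w => P (R (dD' (M w)))) e1
  have d1 := congrArg (fun w => P (R w)) (hdDM (R (Q v)))
  have d2 := congrArg (fun w => P (R w)) (hdDM (D (R (Q v))))
  have m1 := congrArg (fun w => P (R w)) (hDM (dD' (R (Q v))))
  have m2 := congrArg (fun w => P (R w)) (hDM' (dD (R (Q v))))
  have c4 := congrArg (fun w => P (R (Q (P w)))) (hdD (R (Q v)))
  have c5 := congrArg (fun w => P (R (M w))) (hDdD' (R (Q v)))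
  have c6 := congrArg (fun w => P (R (M' w))) (hDdD (R (Q v)))
  simp only [LinearMap.add_apply, LinearMap.sub_apply, LinearMap.comp_apply, LinearMap.smul_apply,
    map_add, map_sub, map_smul, map_zero] at *
  linear_combination (norm := module) eb - ea + p1 - p2 + c1 + c2 - c3 - f1 + f2 + g1 - g2 + k1 -
    k2 + k3 + r1 - r2 - r3 + r4 + s1 - s2 + s3 - s4 - t • d1 + m1 - m2 + c4 + c5 - c6 + d2

/-- The linear algebra of a system and its Laplace transform at a point `p`, in the directions
`xᵢ ≠ x`. On `V`, the form is `Ω_x = S + P (x - D)⁻¹ Q` and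
`Ω_{xᵢ} = x dSᵢ + Nᵢ - P dDᵢ (x - D)⁻¹ Q`; on `W`, the transform is `-ε D - Q (x - ε S)⁻¹ P` and
`-ε x dDᵢ + Mᵢ + ε Q dSᵢ (x - ε S)⁻¹ P`. The relations are what integrability means for the
coefficients; they are symmetric under `DualDatum.swap`. -/
structure DualDatum (S : Module.End ℂ V) (dS N : ι → Module.End ℂ V) (D : Module.End ℂ W)
    (dD M : ι → Module.End ℂ W) (P : W →ₗ[ℂ] V) (Q : V →ₗ[ℂ] W) : Prop where
  S_dS : ∀ i v, S (dS i v) = dS i (S v)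
  dS_dS : ∀ i j v, dS i (dS j v) = dS j (dS i v)
  D_dD : ∀ i w, D (dD i w) = dD i (D w)
  dD_dD : ∀ i j w, dD i (dD j w) = dD j (dD i w)
  S_N : ∀ i v, S (N i v) - N i (S v) + (P (Q (dS i v)) - dS i (P (Q v))) = 0
  D_M : ∀ i w, D (M i w) - M i (D w) + (dD i (Q (P w)) - Q (P (dD i w))) = 0
  dS_N : ∀ i j v, dS i (N j v) - N j (dS i v) + (N i (dS j v) - dS j (N i v)) = 0
  dD_M : ∀ i j w, dD i (M j w) - M j (dD i w) + (M i (dD j w) - dD j (M i w)) = 0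
  P_M : ∀ i w, P (M i w) = N i (P w) + S (P (dD i w)) + dS i (P (D w))
  M_Q : ∀ i v, M i (Q v) = Q (N i v) + dD i (Q (S v)) + D (Q (dS i v))
  N_N : ∀ i j v, N i (N j v) - N j (N i v) - (dS i (P (dD j (Q v))) - P (dD j (Q (dS i v)))) -
    (P (dD i (Q (dS j v))) - dS j (P (dD i (Q v)))) = 0
  M_M : ∀ i j w, M i (M j w) - M j (M i w) - (dD i (Q (dS j (P w))) - Q (dS j (P (dD i w)))) -
    (Q (dS i (P (dD j w))) - dD j (Q (dS i (P w)))) = 0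

section Curvature

variable {S dS dS' N N' : Module.End ℂ V} {D dD dD' M M' : Module.End ℂ W} {P : W →ₗ[ℂ] V}
  {Q : V →ₗ[ℂ] W}

/-- The part of the curvature of the transformed system that is regular in `x` commutes with `D`. -/
theorem curvature_comm
    (hDdD : ∀ w, D (dD w) = dD (D w)) (hDdD' : ∀ w, D (dD' w) = dD' (D w))
    (hdD : ∀ w, dD (dD' w) = dD' (dD w))
    (hDM : ∀ w, D (M w) - M (D w) + (dD (Q (P w)) - Q (P (dD w))) = 0)
    (hDM' : ∀ w, D (M' w) - M' (D w) + (dD' (Q (P w)) - Q (P (dD' w))) = 0)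
    (hdDM : ∀ w, dD (M' w) - M' (dD w) + (M (dD' w) - dD' (M w)) = 0)
    (hPM : ∀ w, P (M w) = N (P w) + S (P (dD w)) + dS (P (D w)))
    (hPM' : ∀ w, P (M' w) = N' (P w) + S (P (dD' w)) + dS' (P (D w)))
    (hMQ : ∀ v, M (Q v) = Q (N v) + dD (Q (S v)) + D (Q (dS v)))
    (hMQ' : ∀ v, M' (Q v) = Q (N' v) + dD' (Q (S v)) + D (Q (dS' v))) (w : W) :
    D (M (M' w) - M' (M w) - (dD (Q (dS' (P w))) - Q (dS' (P (dD w)))) -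
      (Q (dS (P (dD' w))) - dD' (Q (dS (P w))))) =
    M (M' (D w)) - M' (M (D w)) - (dD (Q (dS' (P (D w)))) - Q (dS' (P (dD (D w))))) -
      (Q (dS (P (dD' (D w)))) - dD' (Q (dS (P (D w))))) := by
  have a1 := hDM (M' w)
  have a2 := hDM' (M w)
  have a3 := congrArg M (hDM' w)
  have a4 := congrArg M' (hDM w)
  have b1 := congrArg (fun u => dD (Q u)) (hPM' w)
  have b2 := congrArg dD (hMQ' (P w))
  have b3 := congrArg (fun u => dD' (Q u)) (hPM w)
  have b4 := congrArg dD' (hMQ (P w))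
  have b5 := hMQ (P (dD' w))
  have b6 := congrArg Q (hPM (dD' w))
  have b7 := hMQ' (P (dD w))
  have b8 := congrArg Q (hPM' (dD w))
  have d1 := congrArg (fun u => Q (P u)) (hdDM w)
  have d2 := hdDM (Q (P w))
  have c1 := congrArg (fun u => Q (S (P u))) (hdD w)
  have c2 := hdD (Q (S (P w)))
  have c3 := congrArg (fun u => Q (dS (P u))) (hDdD' w)
  have c4 := congrArg (fun u => Q (dS' (P u))) (hDdD w)
  have c5 := hDdD (Q (dS' (P w)))
  have c6 := hDdD' (Q (dS (P w)))
  simp only [map_add, map_sub, map_zero] at *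
  linear_combination (norm := module) a1 - a2 + a3 - a4 - b1 + b2 + b3 - b4 + b5 - b6 - b7 + b8 +
    d1 - d2 - c1 + c2 - c3 + c4 - c5 + c6

/-- The part of the curvature of the transformed system that is regular in `x` vanishes on the
image of `Q`. -/
theorem curvature_apply
    (hSdS : ∀ v, S (dS v) = dS (S v)) (hSdS' : ∀ v, S (dS' v) = dS' (S v))
    (hdS : ∀ v, dS (dS' v) = dS' (dS v))
    (hDdD : ∀ w, D (dD w) = dD (D w)) (hDdD' : ∀ w, D (dD' w) = dD' (D w))
    (hdD : ∀ w, dD (dD' w) = dD' (dD w))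
    (hSN : ∀ v, S (N v) - N (S v) + (P (Q (dS v)) - dS (P (Q v))) = 0)
    (hSN' : ∀ v, S (N' v) - N' (S v) + (P (Q (dS' v)) - dS' (P (Q v))) = 0)
    (hDM : ∀ w, D (M w) - M (D w) + (dD (Q (P w)) - Q (P (dD w))) = 0)
    (hDM' : ∀ w, D (M' w) - M' (D w) + (dD' (Q (P w)) - Q (P (dD' w))) = 0)
    (hdSN : ∀ v, dS (N' v) - N' (dS v) + (N (dS' v) - dS' (N v)) = 0)
    (hdDM : ∀ w, dD (M' w) - M' (dD w) + (M (dD' w) - dD' (M w)) = 0)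
    (hMQ : ∀ v, M (Q v) = Q (N v) + dD (Q (S v)) + D (Q (dS v)))
    (hMQ' : ∀ v, M' (Q v) = Q (N' v) + dD' (Q (S v)) + D (Q (dS' v)))
    (hNN : ∀ v, N (N' v) - N' (N v) - (dS (P (dD' (Q v))) - P (dD' (Q (dS v)))) -
      (P (dD (Q (dS' v))) - dS' (P (dD (Q v)))) = 0) (v : V) :
    M (M' (Q v)) - M' (M (Q v)) - (dD (Q (dS' (P (Q v)))) - Q (dS' (P (dD (Q v))))) -
      (Q (dS (P (dD' (Q v)))) - dD' (Q (dS (P (Q v))))) = 0 := by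
  have a1 := congrArg M (hMQ' v)
  have a2 := congrArg M' (hMQ v)
  have a3 := hMQ (N' v)
  have a4 := hMQ' (N v)
  have a5 := hDM (Q (dS' v))
  have a6 := hDM' (Q (dS v))
  have a7 := congrArg D (hMQ (dS' v))
  have a8 := congrArg D (hMQ' (dS v))
  have b1 := congrArg (fun u => D (Q u)) (hdSN v)
  have b2 := congrArg (fun u => D (D (Q u))) (hdS v)
  have b3 := hdDM (Q (S v))
  have b4 := congrArg dD' (hMQ (S v))
  have b5 := congrArg dD (hMQ' (S v))
  have b6 := hdD (Q (S (S v)))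
  have c1 := congrArg (fun u => dD (Q u)) (hSN' v)
  have c2 := congrArg (fun u => dD' (Q u)) (hSN v)
  have c3 := congrArg Q (hNN v)
  have d1 := hDdD' (Q (S (dS v)))
  have d2 := congrArg (fun u => dD' (D (Q u))) (hSdS v)
  have d3 := hDdD (Q (S (dS' v)))
  have d4 := congrArg (fun u => dD (D (Q u))) (hSdS' v)
  simp only [map_add, map_sub, map_zero] at *
  linear_combination (norm := module) a1 - a2 + a3 - a4 - a5 + a6 + a7 - a8 + b1 + b2 + b3 + b4 -
    b5 - b6 + c1 - c2 + c3 - d1 - d2 + d3 + d4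

end Curvature

namespace DualDatum

variable {S : Module.End ℂ V} {dS N : ι → Module.End ℂ V} {D : Module.End ℂ W}
  {dD M : ι → Module.End ℂ W} {P : W →ₗ[ℂ] V} {Q : V →ₗ[ℂ] W}

/-- The Laplace transform exchanges the roles of `V` and `W`. -/
theorem swap (h : DualDatum S dS N D dD M P Q) {eps : ℂ} (he : eps * eps = 1) :
    DualDatum (-eps • D) (fun i => -eps • dD i) M (eps • S) (fun i => eps • dS i) N (-Q) P where
  S_dS i v := by simp [h.D_dD]
  dS_dS i j v := by simp [h.dD_dD i j]
  D_dD i v := by simp [h.S_dS]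
  dD_dD i j v := by simp [h.dS_dS i j]
  S_N i w := by
    have := h.D_M i w
    simp only [LinearMap.smul_apply, LinearMap.neg_apply, map_smul, map_neg]
    linear_combination (norm := module) (-eps) • this
  D_M i v := by
    have := h.S_N i v
    simp only [LinearMap.smul_apply, LinearMap.neg_apply, map_smul, map_neg]
    linear_combination (norm := module) eps • this
  dS_N i j w := by
    have := h.dD_M i j w
    simp only [LinearMap.smul_apply, map_smul]
    linear_combination (norm := module) (-eps) • this
  dD_M i j v := by
    have := h.dS_N i j v
    simp only [LinearMap.smul_apply, map_smul]
    linear_combination (norm := module) eps • this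
  P_M i v := by
    have := h.M_Q i v
    rcases mul_self_eq_one_iff.1 he with rfl | rfl <;>
    · simp only [LinearMap.smul_apply, LinearMap.neg_apply, map_smul, map_neg]
      linear_combination (norm := module) this
  M_Q i w := by
    have := h.P_M i w
    rcases mul_self_eq_one_iff.1 he with rfl | rfl <;>
    · simp only [LinearMap.smul_apply, map_smul]
      linear_combination (norm := module) -this
  N_N i j w := by
    have := h.M_M i j w
    rcases mul_self_eq_one_iff.1 he with rfl | rfl <;>
    · simp only [LinearMap.smul_apply, LinearMap.neg_apply, map_smul, map_neg]
      linear_combination (norm := module) this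
  M_M i j v := by
    have := h.N_N i j v
    rcases mul_self_eq_one_iff.1 he with rfl | rfl <;>
    · simp only [LinearMap.smul_apply, LinearMap.neg_apply, map_smul, map_neg]
      linear_combination (norm := module) this

variable {R : Module.End ℂ W} {t : ℂ}

/-- Integrability in the directions of `x` and `xᵢ`; the hypotheses say `R = (t - D)⁻¹`. -/
theorem commute_eval (h : DualDatum S dS N D dD M P Q) (hDR : ∀ w, t • R w = w + D (R w))
    (hRD : ∀ w, t • R w = w + R (D w)) (hRdD : ∀ i w, R (dD i w) = dD i (R w)) (i : ι) :
    Commute (S + P ∘ₗ R ∘ₗ Q) (t • dS i + N i - P ∘ₗ dD i ∘ₗ R ∘ₗ Q) := by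
  ext v
  rw [Module.End.mul_apply, Module.End.mul_apply, ← sub_eq_zero,
    commutator_eq_of_intertwining hDR hRD (hRdD i) (h.D_M i) (h.M_Q i), h.S_dS, h.S_N, h.P_M]
  module

/-- Integrability in the directions of `xᵢ` and `xⱼ`; the hypotheses say `R = (t - D)⁻¹`. -/
theorem commute_eval' (h : DualDatum S dS N D dD M P Q) (hDR : ∀ w, t • R w = w + D (R w))
    (hRD : ∀ w, t • R w = w + R (D w)) (hRdD : ∀ i w, R (dD i w) = dD i (R w)) (i j : ι) :
    Commute (t • dS i + N i - P ∘ₗ dD i ∘ₗ R ∘ₗ Q) (t • dS j + N j - P ∘ₗ dD j ∘ₗ R ∘ₗ Q) := by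
  ext v
  rw [Module.End.mul_apply, Module.End.mul_apply, ← sub_eq_zero,
    commutator_eq_of_intertwining' hDR hRD (hRdD i) (hRdD j) (h.D_dD i) (h.D_dD j) (h.dD_dD i j)
      (h.D_M i) (h.D_M j) (h.dD_M i j) (h.P_M i) (h.P_M j) (h.M_Q i) (h.M_Q j), h.dS_dS i j,
    h.dS_N, h.N_N]
  module

end DualDatum

end Duality

/-! ### The affine functions `a_H` -/

namespace Hyperplane

variable {n : ℕ} {l : Fin n}

theorem aCoeff_self (H : Hyperplane n) : H.aCoeff l l = 0 := if_pos rfl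

theorem DependsOn.poly_eq {H : Hyperplane n} (hH : H.DependsOn l) (x : Fin n → ℂ) :
    H.poly x = H.coeff l * (x l - H.aFun l x) := by
  have hl : H.coeff l ≠ 0 := hH
  have h1 : ∀ j, H.coeff l * (H.aCoeff l j * x j) = if j = l then 0 else -(H.coeff j * x j) := by
    intro j
    unfold aCoeff
    split_ifs
    · simp
    · field_simp
  rw [poly, aFun, aConst, mul_sub, mul_add, Finset.mul_sum]
  simp only [h1]
  rw [← Finset.add_sum_erase _ _ (Finset.mem_univ l),
    ← Finset.add_sum_erase Finset.univ (fun j => if j = l then 0 else _) (Finset.mem_univ l),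
    if_pos rfl, Finset.sum_congr rfl fun j hj => if_neg (Finset.ne_of_mem_erase hj),
    Finset.sum_neg_distrib]
  field_simp
  ring

theorem DependsOn.mem_carrier_iff {H : Hyperplane n} (hH : H.DependsOn l) (x : Fin n → ℂ) :
    x ∈ H.carrier ↔ x l = H.aFun l x := by
  rw [H.mem_carrier, hH.poly_eq, mul_eq_zero, or_iff_right (show H.coeff l ≠ 0 from hH),
    sub_eq_zero]

theorem DependsOn.coeff_div_poly {H : Hyperplane n} (hH : H.DependsOn l) (x : Fin n → ℂ) :
    H.coeff l / H.poly x = 1 / (x l - H.aFun l x) := by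
  have hl : H.coeff l ≠ 0 := hH
  rw [hH.poly_eq, div_mul_eq_div_div, div_self hl]

theorem DependsOn.coeff_div_poly_of_ne {H : Hyperplane n} (hH : H.DependsOn l) {i : Fin n}
    (hi : i ≠ l) (x : Fin n → ℂ) :
    H.coeff i / H.poly x = -(H.aCoeff l i * (1 / (x l - H.aFun l x))) := by
  rw [hH.poly_eq, div_mul_eq_div_div, aCoeff, if_neg hi]
  ring

theorem aFun_update (H : Hyperplane n) (p : Fin n → ℂ) (t : ℂ) :
    H.aFun l (Function.update p l t) = H.aFun l p := by
  unfold aFun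
  congr 1
  refine Finset.sum_congr rfl fun j _ => ?_
  by_cases hj : j = l
  · subst hj
    simp [aCoeff_self]
  · rw [Function.update_of_ne hj]

theorem poly_update {H : Hyperplane n} (hH : ¬ H.DependsOn l) (p : Fin n → ℂ) (t : ℂ) :
    H.poly (Function.update p l t) = H.poly p := by
  have hl : H.coeff l = 0 := not_not.1 hH
  unfold poly
  congr 1
  refine Finset.sum_congr rfl fun j _ => ?_
  by_cases hj : j = l
  · subst hj
    simp [hl]
  · rw [Function.update_of_ne hj]

/-- Two hyperplanes that depend on `x` agree if their functions `a_H` have the same coefficients. -/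
theorem eq_of_aConst_eq {H H' : Hyperplane n} (hH : H.DependsOn l) (hH' : H'.DependsOn l)
    (h0 : H.aConst l = H'.aConst l) (h : ∀ j, j ≠ l → H.aCoeff l j = H'.aCoeff l j) : H = H' := by
  ext x
  rw [hH.mem_carrier_iff, hH'.mem_carrier_iff]
  have : H.aFun l x = H'.aFun l x := by
    unfold aFun
    rw [h0]
    congr 1
    refine Finset.sum_congr rfl fun j _ => ?_
    by_cases hj : j = l
    · subst hj
      simp [aCoeff_self]
    · rw [h j hj]
  rw [this]

theorem setOf_aFun_eq (H H' : Hyperplane n) :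
    {x | H.aFun l x = H'.aFun l x} =
      {x | ∑ j, (H.aCoeff l j - H'.aCoeff l j) * x j + (H.aConst l - H'.aConst l) = 0} := by
  ext x
  simp only [Set.mem_ofPred_eq, aFun, sub_mul, Finset.sum_sub_distrib]
  constructor <;> intro h <;> linear_combination h

theorem aFun_sub (H H' : Hyperplane n) (x : Fin n → ℂ) : H.aFun l x - H'.aFun l x =
    ∑ j, (H.aCoeff l j - H'.aCoeff l j) * x j + (H.aConst l - H'.aConst l) := by
  simp only [aFun, sub_mul, Finset.sum_sub_distrib]
  ring

/-- If `a_H - a_{H'}` is constant, then `{a_H = a_{H'}}` is no hyperplane. -/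
theorem exists_aCoeff_ne {G H H' : Hyperplane n}
    (h : G.carrier = {x | H.aFun l x = H'.aFun l x}) :
    (fun j => H.aCoeff l j - H'.aCoeff l j) ≠ 0 := by
  intro h0
  have h1 : ∀ j, H.aCoeff l j - H'.aCoeff l j = 0 := fun j => congrFun h0 j
  rw [setOf_aFun_eq] at h
  simp only [h1, zero_mul, Finset.sum_const_zero, zero_add] at h
  obtain ⟨x, hx⟩ := G.carrier_nonempty
  obtain ⟨y, hy⟩ := G.exists_notMem_carrier
  rw [h] at hx hy
  exact hy hx

theorem not_dependsOn_of_carrier_eq {G H H' : Hyperplane n}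
    (h : G.carrier = {x | H.aFun l x = H'.aFun l x}) : ¬ G.DependsOn l := by
  obtain ⟨k, -, hc, -⟩ := exists_eq_mul_of_carrier_eq (exists_aCoeff_ne h)
    (h.trans (setOf_aFun_eq H H'))
  rw [DependsOn, not_not, hc l, aCoeff_self, aCoeff_self, sub_zero, mul_zero]

/-- The hyperplane `{a_H = a_{H'}}`, if there is one, contributes `d log (a_H - a_{H'})`. If
`a_H - a_{H'}` is constant, both sides vanish. -/
theorem sum_collision (H H' : Hyperplane n) {B : Finset (Hyperplane n)}
    (hB : ∀ G : Hyperplane n, G.carrier = {x | H.aFun l x = H'.aFun l x} → G ∈ B)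
    (i : Fin n) (p : Fin n → ℂ) :
    ∑ G ∈ B, (if G.carrier = {x | H.aFun l x = H'.aFun l x} then G.coeff i / G.poly p else 0) =
      (H.aCoeff l i - H'.aCoeff l i) / (H.aFun l p - H'.aFun l p) := by
  by_cases hc : (fun j => H.aCoeff l j - H'.aCoeff l j) = 0
  · rw [Finset.sum_eq_zero fun G _ => if_neg fun h => exists_aCoeff_ne h hc,
      show H.aCoeff l i - H'.aCoeff l i = 0 from congrFun hc i, zero_div]
  · let G := ofAffine (fun j => H.aCoeff l j - H'.aCoeff l j) (H.aConst l - H'.aConst l) hc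
    have hG : G.carrier = {x | H.aFun l x = H'.aFun l x} := (setOf_aFun_eq H H').symm
    rw [Finset.sum_eq_single G, if_pos hG]
    · obtain ⟨k, hk, hcf, hd⟩ := exists_eq_mul_of_carrier_eq (G := G) hc rfl
      have : G.poly p = k * (H.aFun l p - H'.aFun l p) := by
        rw [aFun_sub, poly, hd, mul_add, Finset.mul_sum]
        simp only [hcf, mul_assoc]
      rw [hcf, this, mul_div_mul_left _ _ hk]
    · intro G' _ hne
      refine if_neg fun h => hne ?_
      ext1
      rw [h, hG]
    · intro h
      exact absurd (hB G hG) h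

theorem finite_collisions (l : Fin n) (T : Finset (Hyperplane n)) :
    {G : Hyperplane n | ∃ H ∈ T, ∃ H' ∈ T, G.carrier = {x | H.aFun l x = H'.aFun l x}}.Finite := by
  have hfin : ((fun q : Hyperplane n × Hyperplane n => {x | q.1.aFun l x = q.2.aFun l x}) ''
      ((T ×ˢ T : Finset _) : Set (Hyperplane n × Hyperplane n))).Finite :=
    (Finset.finite_toSet _).image _
  refine (hfin.preimage (f := Hyperplane.carrier) ?_).subset ?_
  · intro G _ G' _ h
    exact Hyperplane.ext h
  · rintro G ⟨H, hH, H', hH', h⟩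
    exact ⟨(H, H'), by simp [hH, hH'], h.symm⟩

theorem eventually_aFun_ne {H H' : Hyperplane n} (hH : H.DependsOn l) (hH' : H'.DependsOn l)
    (hne : H ≠ H') : ∀ᶠ x in generic n, H.aFun l x ≠ H'.aFun l x := by
  by_cases hc : (fun j => H.aCoeff l j - H'.aCoeff l j) = 0
  · have h1 : ∀ j, H.aCoeff l j - H'.aCoeff l j = 0 := fun j => congrFun hc j
    have h2 : H.aConst l - H'.aConst l ≠ 0 := fun h =>
      hne (eq_of_aConst_eq hH hH' (sub_eq_zero.1 h) fun j _ => sub_eq_zero.1 (h1 j))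
    refine Eventually.of_forall fun x hx => h2 ?_
    have := aFun_sub (l := l) H H' x
    simp only [h1, zero_mul, Finset.sum_const_zero, zero_add, hx, sub_self] at this
    exact this.symm
  · filter_upwards [eventually_notMem_carrier (ofAffine _ (H.aConst l - H'.aConst l) hc)]
      with x hx h
    apply hx
    change ∑ j, (H.aCoeff l j - H'.aCoeff l j) * x j + (H.aConst l - H'.aConst l) = 0
    rw [← aFun_sub, h, sub_self]

theorem eventually_injective_aFun {T : Finset (Hyperplane n)} (hT : ∀ H ∈ T, H.DependsOn l) :
    ∀ᶠ x in generic n, Function.Injective fun H : T => H.1.aFun l x := by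
  have : ∀ᶠ x in generic n, ∀ H H' : T, H ≠ H' → H.1.aFun l x ≠ H'.1.aFun l x := by
    simp only [eventually_all]
    intro H H' hne
    exact eventually_aFun_ne (hT _ H.2) (hT _ H'.2) fun h => hne (Subtype.ext h)
  filter_upwards [this] with x hx H H' h
  by_contra hne
  exact hx H H' hne h

end Hyperplane

/-! ### The Laplace transform at a point -/

section Blocks

variable {ι : Type*} {V : Type u} [AddCommGroup V] [Module ℂ V]

/-- The endomorphism of `ι → V` that multiplies the `k`-th component by `a k`. -/
def diagOp (V : Type u) [AddCommGroup V] [Module ℂ V] (a : ι → ℂ) : Module.End ℂ (ι → V) :=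
  blockDiag fun k => a k • 1

@[simp]
theorem blockDiag_apply (f : ι → Module.End ℂ V) (w : ι → V) (k : ι) :
    blockDiag f w k = f k (w k) := rfl

@[simp]
theorem diagOp_apply (a : ι → ℂ) (w : ι → V) (k : ι) : diagOp V a w k = a k • w k := rfl

/-- The diagonal embedding of `V` into `ι → V`. -/
def constMap (ι : Type*) (V : Type u) [AddCommGroup V] [Module ℂ V] : V →ₗ[ℂ] (ι → V) :=
  LinearMap.pi fun _ => LinearMap.id

@[simp]
theorem constMap_apply (v : V) (k : ι) : constMap ι V v k = v := rfl

end Blocks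

namespace System

variable {n : ℕ} {V : Type u} [AddCommGroup V] [Module ℂ V]

/-- The map `v ↦ ∑_{H ∈ T} A_H v_H`. -/
def resSum (T : Finset (Hyperplane n)) (Ω : System n V) : (T → V) →ₗ[ℂ] V :=
  ∑ H : T, Ω.res H.1 ∘ₗ LinearMap.proj H

@[simp]
theorem resSum_apply (T : Finset (Hyperplane n)) (Ω : System n V) (w : T → V) :
    Ω.resSum T w = ∑ H : T, Ω.res H.1 (w H) := by
  simp [resSum, LinearMap.sum_apply]

/-- The part of the coefficient of `dxᵢ` that does not involve the variable `x = x_ℓ`: the value at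
`x = 0` of the part that is regular there. -/
def slice (Ω : System n V) (l i : Fin n) (p : Fin n → ℂ) : Module.End ℂ V :=
  Ω.const i + ∑ j ∈ (Finset.univ.erase i).erase l, p j • Ω.lin i j +
    ∑ᶠ G : Hyperplane n, if G.DependsOn l then 0 else (G.coeff i / G.poly p) • Ω.res G

/-- The conditions on a system in `𝔓_{T,S}` that do not involve the eigenvalues of its polynomial
part. -/
structure Tame (l : Fin n) (T : Finset (Hyperplane n)) (Ω : System n V) : Prop where
  finite : {H | Ω.res H ≠ 0}.Finite
  lin_self : ∀ i, Ω.lin i i = 0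
  lin_symm : ∀ i j, Ω.lin i j = Ω.lin j i
  integrable : Ω.Integrable
  lin_eq_zero : Hyperplane.HasMixed l T → ∀ j, j ≠ l → Ω.lin l j = 0
  res_mem : ∀ H : Hyperplane n, H.DependsOn l → Ω.res H ≠ 0 → H ∈ T

theorem Mem.tame {l : Fin n} {T S : Finset (Hyperplane n)} {Ω : System n V} (h : Ω.Mem l T S) :
    Ω.Tame l T :=
  ⟨h.finite, h.lin_self, h.lin_symm, h.integrable, h.lin_eq_zero, h.res_mem⟩

variable {l : Fin n} {T : Finset (Hyperplane n)} {Ω : System n V}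

theorem polyPart_update (p : Fin n → ℂ) (t : ℂ) :
    Ω.polyPart l (Function.update p l t) = Ω.polyPart l p := by
  unfold polyPart
  congr 1
  refine Finset.sum_congr rfl fun j hj => ?_
  rw [Function.update_of_ne (Finset.ne_of_mem_erase hj)]

theorem slice_update (i : Fin n) (p : Fin n → ℂ) (t : ℂ) :
    Ω.slice l i (Function.update p l t) = Ω.slice l i p := by
  unfold slice
  congr 1
  · congr 1
    refine Finset.sum_congr rfl fun j hj => ?_
    rw [Function.update_of_ne (Finset.ne_of_mem_erase hj)]
  · refine finsum_congr fun G => ?_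
    by_cases hG : G.DependsOn l
    · rw [if_pos hG, if_pos hG]
    · rw [if_neg hG, if_neg hG, Hyperplane.poly_update hG]

/-- Sums over all hyperplanes split into those that depend on `x`, which lie in `T`, and the
others. -/
theorem finsum_res_eq (hfin : {H | Ω.res H ≠ 0}.Finite)
    (hmem : ∀ H : Hyperplane n, H.DependsOn l → Ω.res H ≠ 0 → H ∈ T)
    (hT : ∀ H ∈ T, H.DependsOn l) (c : Hyperplane n → ℂ) :
    ∑ᶠ H, c H • Ω.res H =
      (∑ᶠ G : Hyperplane n, if G.DependsOn l then 0 else c G • Ω.res G) +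
        ∑ H : T, c H.1 • Ω.res H.1 := by
  have h1 : (∑ H : T, c H.1 • Ω.res H.1) =
      ∑ᶠ G : Hyperplane n, if G.DependsOn l then c G • Ω.res G else 0 := by
    rw [finsum_eq_sum_of_support_subset (s := T)]
    · rw [← Finset.sum_coe_sort T]
      exact Finset.sum_congr rfl fun H _ => (if_pos (hT _ H.2)).symm
    · intro G hG
      by_cases hd : G.DependsOn l
      · refine hmem G hd fun h => hG ?_
        simp [h]
      · exact absurd (if_neg hd) hG
  rw [h1, ← finsum_add_distrib]
  · refine finsum_congr fun G => ?_
    by_cases hd : G.DependsOn l <;> simp [hd]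
  · refine hfin.subset fun G hG h => hG ?_
    simp [h]
  · refine hfin.subset fun G hG h => hG ?_
    simp [h]

/-- The coefficient of `dx`. -/
theorem eval_self (hfin : {H | Ω.res H ≠ 0}.Finite)
    (hmem : ∀ H : Hyperplane n, H.DependsOn l → Ω.res H ≠ 0 → H ∈ T)
    (hT : ∀ H ∈ T, H.DependsOn l) (x : Fin n → ℂ) :
    Ω.eval l x = Ω.polyPart l x +
      ∑ H : T, (1 / (x l - H.1.aFun l x)) • Ω.res H.1 := by
  rw [eval, finsum_res_eq hfin hmem hT]
  rw [finsum_eq_zero_of_forall_eq_zero, zero_add]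
  · congr 1
    exact Finset.sum_congr rfl fun H _ => by rw [(hT _ H.2).coeff_div_poly]
  · intro G
    by_cases hd : G.DependsOn l
    · rw [if_pos hd]
    · rw [if_neg hd, show G.coeff l = 0 from not_not.1 hd, zero_div, zero_smul]

/-- The coefficient of `dxᵢ` for the other variables. -/
theorem eval_of_ne (hfin : {H | Ω.res H ≠ 0}.Finite) (hsymm : ∀ i j, Ω.lin i j = Ω.lin j i)
    (hmem : ∀ H : Hyperplane n, H.DependsOn l → Ω.res H ≠ 0 → H ∈ T)
    (hT : ∀ H ∈ T, H.DependsOn l) {i : Fin n} (hi : i ≠ l) (x : Fin n → ℂ) :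
    Ω.eval i x = x l • Ω.lin l i + Ω.slice l i x -
      ∑ H : T, (H.1.aCoeff l i * (1 / (x l - H.1.aFun l x))) • Ω.res H.1 := by
  rw [eval, finsum_res_eq hfin hmem hT, polyPart, slice,
    ← Finset.add_sum_erase _ _ (Finset.mem_erase.2 ⟨hi.symm, Finset.mem_univ l⟩), hsymm i l]
  have : ∑ H : T, (H.1.coeff i / H.1.poly x) • Ω.res H.1 =
      -∑ H : T, (H.1.aCoeff l i * (1 / (x l - H.1.aFun l x))) • Ω.res H.1 := by
    rw [← Finset.sum_neg_distrib]
    exact Finset.sum_congr rfl fun H _ => by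
      rw [(hT _ H.2).coeff_div_poly_of_ne hi, neg_smul]
  rw [this]
  abel

/-- The products of `A_{x xᵢ}` and the coefficients of the `a_H`, `H ∈ T`, vanish. This removes the
quadratic terms in the other variables that the transform would have otherwise. -/
theorem Tame.cross (h : Ω.Tame l T) (hT : ∀ H ∈ T, H.DependsOn l) {H : Hyperplane n} (hH : H ∈ T)
    {i : Fin n} (hi : i ≠ l) (j : Fin n) (v : V) : H.aCoeff l j • Ω.lin l i v = 0 := by
  by_cases hm : Hyperplane.HasMixed l T
  · rw [h.lin_eq_zero hm i hi, LinearMap.zero_apply, smul_zero]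
  · by_cases hj : j = l
    · rw [hj, H.aCoeff_self, zero_smul]
    · have : H.coeff j = 0 := by
        by_contra hne
        exact hm ⟨H, hH, hT H hH, j, hj, hne⟩
      rw [Hyperplane.aCoeff, if_neg hj, this, zero_div, neg_zero, zero_smul]

/-- The blocks of the transformed system in the directions `xᵢ ≠ x`: on the diagonal, the
restriction of `Ω_{xᵢ} + (a_H)_{xᵢ} Ω_x` to `H`. -/
theorem Tame.laplace_slice (h : Ω.Tame l T) (hT : ∀ H ∈ T, H.DependsOn l) (eps : ℂ) {i : Fin n}
    (hi : i ≠ l) (p : Fin n → ℂ) (w : T → V) (H : T) :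
    (Ω.laplace eps l T).slice l i p w H = Ω.slice l i p (w H) + H.1.aFun l p • Ω.lin l i (w H) +
      H.1.aCoeff l i • Ω.polyPart l p (w H) +
      ∑ H' : T, ((H.1.aCoeff l i - H'.1.aCoeff l i) / (H.1.aFun l p - H'.1.aFun l p)) •
        Ω.res H'.1 (w H - w H') := by
  let B : Finset (Hyperplane n) := h.finite.toFinset ∪ (Hyperplane.finite_collisions l T).toFinset
  have hB1 : ∀ G, Ω.res G ≠ 0 → G ∈ B := fun G hG => by simp [B, hG]
  have hB2 : ∀ H H' : T, ∀ G : Hyperplane n,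
      G.carrier = {x | H.1.aFun l x = H'.1.aFun l x} → G ∈ B := fun H H' G hG =>
    Finset.mem_union_right _ ((Hyperplane.finite_collisions l T).mem_toFinset.2
      ⟨H.1, H.2, H'.1, H'.2, hG⟩)
  have e1 : (∑ᶠ G : Hyperplane n, if G.DependsOn l then 0 else
      (G.coeff i / G.poly p) • (Ω.laplace eps l T).res G) =
      ∑ G ∈ B, if G.DependsOn l then 0 else
        (G.coeff i / G.poly p) • (Ω.laplace eps l T).res G := by
    refine finsum_eq_sum_of_support_subset _ fun G hG => ?_
    by_contra hGB
    apply hG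
    change (if G.DependsOn l then 0 else _) = _
    by_cases hd : G.DependsOn l
    · rw [if_pos hd]
    · rw [if_neg hd]
      have hr : Ω.res G = 0 := by
        by_contra hne
        exact hGB (hB1 G hne)
      have hc : ∀ H H' : T, ¬ G.carrier = {x | H.1.aFun l x = H'.1.aFun l x} :=
        fun H H' hG => hGB (hB2 H H' G hG)
      have : (Ω.laplace eps l T).res G = 0 := by
        refine LinearMap.ext fun w => funext fun k => ?_
        simp [laplace, hd, hr, hc]
      rw [this, smul_zero]
  have e2 : (∑ᶠ G : Hyperplane n, if G.DependsOn l then 0 else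
      (G.coeff i / G.poly p) • Ω.res G) =
      ∑ G ∈ B, if G.DependsOn l then 0 else (G.coeff i / G.poly p) • Ω.res G := by
    refine finsum_eq_sum_of_support_subset _ fun G hG => hB1 G fun h0 => hG ?_
    simp [h0]
  have e3 : ∀ G ∈ B, (if G.DependsOn l then 0 else
        (G.coeff i / G.poly p) • (Ω.laplace eps l T).res G) w H =
      (if G.DependsOn l then 0 else (G.coeff i / G.poly p) • Ω.res G) (w H) +
      ∑ H' : T, (if G.carrier = {x | H.1.aFun l x = H'.1.aFun l x} then
        G.coeff i / G.poly p else 0) • Ω.res H'.1 (w H - w H') := by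
    intro G _
    by_cases hd : G.DependsOn l
    · rw [if_pos hd, if_pos hd, Finset.sum_eq_zero]
      · simp
      · intro H' _
        rw [if_neg fun h' => Hyperplane.not_dependsOn_of_carrier_eq h' hd, zero_smul]
    · rw [if_neg hd, if_neg hd]
      simp only [laplace, if_neg hd, LinearMap.smul_apply, Pi.smul_apply, LinearMap.pi_apply,
        LinearMap.add_apply, LinearMap.comp_apply, LinearMap.proj_apply, smul_add,
        LinearMap.sum_apply, Finset.smul_sum]
      congr 1
      refine Finset.sum_congr rfl fun H' _ => ?_
      split_ifs <;> simp
  -- the terms of degree two in the variables other than `x`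
  have e4 : (∑ j, H.1.aCoeff l j * p j) • Ω.lin l i (w H) = 0 := by
    rw [Finset.sum_smul]
    refine Finset.sum_eq_zero fun j _ => ?_
    rw [mul_comm, mul_smul, h.cross hT H.2 hi, smul_zero]
  have e5 : H.1.aCoeff l i • Ω.polyPart l p (w H) = H.1.aCoeff l i • Ω.const l (w H) := by
    rw [polyPart, LinearMap.add_apply, smul_add, LinearMap.sum_apply, Finset.smul_sum,
      Finset.sum_eq_zero, add_zero]
    intro j hj
    rw [LinearMap.smul_apply, smul_comm, h.cross hT H.2 (Finset.ne_of_mem_erase hj), smul_zero]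
  rw [slice, slice, e1, e2, e5, Hyperplane.aFun, add_smul, e4]
  simp only [LinearMap.add_apply, LinearMap.sum_apply, Pi.add_apply, Finset.sum_apply]
  rw [Finset.sum_congr rfl e3, Finset.sum_add_distrib, Finset.sum_comm (s := B)]
  have e6 : ∀ H' : T, ∑ G ∈ B, (if G.carrier = {x | H.1.aFun l x = H'.1.aFun l x} then
        G.coeff i / G.poly p else 0) • Ω.res H'.1 (w H - w H') =
      ((H.1.aCoeff l i - H'.1.aCoeff l i) / (H.1.aFun l p - H'.1.aFun l p)) •
        Ω.res H'.1 (w H - w H') := by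
    intro H'
    rw [← Finset.sum_smul, Hyperplane.sum_collision _ _ (hB2 H H')]
  rw [Finset.sum_congr rfl fun H' _ => e6 H']
  have e7 : (Ω.laplace eps l T).const i w H = Ω.const i (w H) +
      H.1.aConst l • Ω.lin l i (w H) + H.1.aCoeff l i • Ω.const l (w H) := by
    simp [laplace, hi, h.lin_symm i l]
  have e8 : ∀ j ∈ (Finset.univ.erase i).erase l,
      (p j • (Ω.laplace eps l T).lin i j) w H = (p j • Ω.lin i j) (w H) := by
    intro j hj
    simp only [Finset.mem_erase, Finset.mem_univ, and_true] at hj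
    simp [laplace, hi, hj.1, Ne.symm hj.2]
  rw [e7, Finset.sum_congr rfl e8]
  abel

end System

/-! ### The relations at a generic point -/

section Blocks

variable {ι : Type*} [Fintype ι] {V : Type u} [AddCommGroup V] [Module ℂ V]
  {U : Type v} [AddCommGroup U] [Module ℂ U]

/-- Eigenvectors for distinct eigenvalues that add up to zero vanish. -/
theorem eq_zero_of_sum_eigenvectors {B : Module.End ℂ U} {a : ι → ℂ} (ha : Function.Injective a)
    {u : ι → U} (hu : ∀ k, B (u k) = a k • u k) (hsum : ∑ k, u k = 0) (k : ι) : u k = 0 := by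
  have hind := (B.eigenspaces_iSupIndep).comp ha
  exact (iSupIndep_iff_finsetSum_eq_zero_imp_eq_zero _).1 hind Finset.univ u
    (fun k _ => Module.End.mem_eigenspace_iff.2 (hu k)) hsum k (Finset.mem_univ k)

/-- A linear map out of `ι → V` vanishes if it vanishes on the diagonal and intertwines
multiplication by distinct scalars `aₖ` on the components with an endomorphism. -/
theorem eq_zero_of_intertwines_diagOp {B : Module.End ℂ U} {a : ι → ℂ}
    (ha : Function.Injective a) {f : (ι → V) →ₗ[ℂ] U} (hf : ∀ w, B (f w) = f (diagOp V a w))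
    (h0 : ∀ v, f (constMap ι V v) = 0) : f = 0 := by
  refine LinearMap.pi_ext fun k v => ?_
  refine eq_zero_of_sum_eigenvectors (u := fun k => f (Pi.single k v)) ha (B := B) ?_ ?_ k
  · intro k
    rw [hf, ← map_smul]
    congr 1
    ext m
    by_cases hm : m = k
    · subst hm
      simp
    · simp [hm]
  · rw [← map_sum, ← h0 v]
    congr 1
    ext m
    simp [Finset.sum_apply, Pi.single_apply]

end Blocks

namespace System

variable {n : ℕ} {V : Type u} [AddCommGroup V] [Module ℂ V] {l : Fin n}
  {T : Finset (Hyperplane n)} {Ω : System n V}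

theorem eval_self_eq_comp (hfin : {H | Ω.res H ≠ 0}.Finite)
    (hmem : ∀ H : Hyperplane n, H.DependsOn l → Ω.res H ≠ 0 → H ∈ T)
    (hT : ∀ H ∈ T, H.DependsOn l) (x : Fin n → ℂ) :
    Ω.eval l x = Ω.polyPart l x + Ω.resSum T ∘ₗ
      diagOp V (fun H : T => 1 / (x l - H.1.aFun l x)) ∘ₗ constMap T V := by
  rw [eval_self hfin hmem hT]
  ext v
  simp [LinearMap.sum_apply]

theorem eval_of_ne_eq_comp (hfin : {H | Ω.res H ≠ 0}.Finite)
    (hsymm : ∀ i j, Ω.lin i j = Ω.lin j i)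
    (hmem : ∀ H : Hyperplane n, H.DependsOn l → Ω.res H ≠ 0 → H ∈ T)
    (hT : ∀ H ∈ T, H.DependsOn l) {i : Fin n} (hi : i ≠ l) (x : Fin n → ℂ) :
    Ω.eval i x = x l • Ω.lin l i + Ω.slice l i x - Ω.resSum T ∘ₗ
      diagOp V (fun H : T => H.1.aCoeff l i) ∘ₗ
        diagOp V (fun H : T => 1 / (x l - H.1.aFun l x)) ∘ₗ constMap T V := by
  rw [eval_of_ne hfin hsymm hmem hT hi]
  ext v
  simp [LinearMap.sum_apply, mul_smul]

/-- The relations of `DualDatum` hold for an integrable system at generic points. The relations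
between `D`, `dD`, `M` and `Q` hold by the definition of the transform; expanding the commutators of
the coefficients of `Ω` into partial fractions in `x` gives the other ones, except for the last,
which holds because an endomorphism that commutes with `D` and kills the diagonal is zero. -/
theorem Tame.dualDatum (h : Ω.Tame l T) (hT : ∀ H ∈ T, H.DependsOn l) (eps : ℂ) :
    ∀ᶠ p in generic n, DualDatum (ι := {i // i ≠ l}) (Ω.polyPart l p) (fun i => Ω.lin l i)
      (fun i => Ω.slice l i p) (diagOp V fun H : T => H.1.aFun l p)
      (fun i => diagOp V fun H : T => H.1.aCoeff l i) (fun i => (Ω.laplace eps l T).slice l i p)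
      (Ω.resSum T) (constMap T V) := by
  have hsing : ∀ᶠ p in generic n, ∀ G, Ω.res G ≠ 0 → p ∉ G.carrier := by
    have := (eventually_all_finite h.finite (l := generic n)
      (p := fun G x => x ∉ G.carrier)).2 fun G _ => eventually_notMem_carrier G
    filter_upwards [this] with p hp G hG using hp G hG
  filter_upwards [Hyperplane.eventually_injective_aFun hT, hsing] with p hinj hp
  -- the parts of the relations that the block form of the transform gives for all systems
  have hMQ : ∀ (i : {i // i ≠ l}) (v : V), (Ω.laplace eps l T).slice l i p (constMap T V v) =
      constMap T V (Ω.slice l i p v) +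
        diagOp V (fun H : T => H.1.aCoeff l i) (constMap T V (Ω.polyPart l p v)) +
        diagOp V (fun H : T => H.1.aFun l p) (constMap T V (Ω.lin l i v)) := by
    intro i v
    ext H
    rw [h.laplace_slice hT eps i.2]
    simp only [constMap_apply, sub_self, map_zero, smul_zero, Finset.sum_const_zero, add_zero,
      Pi.add_apply, diagOp_apply]
    abel
  have hratio : ∀ (i : Fin n) (H H' : T), ((H.1.aCoeff l i - H'.1.aCoeff l i) /
      (H.1.aFun l p - H'.1.aFun l p)) * (H.1.aFun l p - H'.1.aFun l p) =
        H.1.aCoeff l i - H'.1.aCoeff l i := by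
    intro i H H'
    by_cases hH : H = H'
    · subst hH
      simp
    · exact div_mul_cancel₀ _ (sub_ne_zero.2 fun h' => hH (hinj h'))
  have hDM : ∀ (i : {i // i ≠ l}) (w : T → V),
      diagOp V (fun H : T => H.1.aFun l p) ((Ω.laplace eps l T).slice l i p w) -
        (Ω.laplace eps l T).slice l i p (diagOp V (fun H : T => H.1.aFun l p) w) +
        (diagOp V (fun H : T => H.1.aCoeff l i) (constMap T V (Ω.resSum T w)) -
          constMap T V (Ω.resSum T (diagOp V (fun H : T => H.1.aCoeff l i) w))) = 0 := by
    intro i w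
    ext H
    simp only [Pi.add_apply, Pi.sub_apply, diagOp_apply, h.laplace_slice hT eps i.2,
      constMap_apply, resSum_apply, map_smul, smul_add, Finset.smul_sum, map_sub, smul_sub,
      Pi.zero_apply, Finset.sum_sub_distrib]
    have key : ∀ H' : T, (H.1.aCoeff l i - H'.1.aCoeff l i) • Ω.res H'.1 (w H') -
        (H.1.aFun l p - H'.1.aFun l p) • ((H.1.aCoeff l i - H'.1.aCoeff l i) /
          (H.1.aFun l p - H'.1.aFun l p)) • Ω.res H'.1 (w H') = 0 := by
      intro H'
      rw [smul_smul, mul_comm, hratio, sub_self]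
    have := Finset.sum_congr rfl fun H' (_ : H' ∈ (Finset.univ : Finset T)) => key H'
    simp only [sub_smul, Finset.sum_sub_distrib, Finset.sum_const_zero] at this
    simp only [smul_comm (H.1.aFun l p)] at this ⊢
    simp only [smul_comm _ (Hyperplane.aFun l _ p)] at this ⊢
    linear_combination (norm := module) this
  have hdDM : ∀ (i j : {i // i ≠ l}) (w : T → V),
      diagOp V (fun H : T => H.1.aCoeff l i) ((Ω.laplace eps l T).slice l j p w) -
        (Ω.laplace eps l T).slice l j p (diagOp V (fun H : T => H.1.aCoeff l i) w) +
        ((Ω.laplace eps l T).slice l i p (diagOp V (fun H : T => H.1.aCoeff l j) w) -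
          diagOp V (fun H : T => H.1.aCoeff l j) ((Ω.laplace eps l T).slice l i p w)) = 0 := by
    intro i j w
    ext H
    simp only [Pi.add_apply, Pi.sub_apply, diagOp_apply, h.laplace_slice hT eps i.2,
      h.laplace_slice hT eps j.2, Pi.zero_apply]
    set κ : Fin n → T → ℂ := fun i H' => (H.1.aCoeff l i - H'.1.aCoeff l i) /
      (H.1.aFun l p - H'.1.aFun l p) with hκ
    have e : H.1.aCoeff l i • ∑ H' : T, κ j H' • Ω.res H'.1 (w H - w H') -
        ∑ H' : T, κ j H' • Ω.res H'.1 (H.1.aCoeff l i • w H - H'.1.aCoeff l i • w H') +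
        (∑ H' : T, κ i H' • Ω.res H'.1 (H.1.aCoeff l j • w H - H'.1.aCoeff l j • w H') -
          H.1.aCoeff l j • ∑ H' : T, κ i H' • Ω.res H'.1 (w H - w H')) = 0 := by
      rw [Finset.smul_sum, Finset.smul_sum, ← Finset.sum_sub_distrib, ← Finset.sum_sub_distrib,
        ← Finset.sum_add_distrib]
      refine Finset.sum_eq_zero fun H' _ => ?_
      have key : κ i H' * (H.1.aCoeff l j - H'.1.aCoeff l j) -
          κ j H' * (H.1.aCoeff l i - H'.1.aCoeff l i) = 0 := by
        simp only [hκ]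
        ring
      simp only [map_sub, map_smul]
      linear_combination (norm := module) key • Ω.res H'.1 (w H')
    simp only [map_smul, smul_add]
    linear_combination (norm := module) e
  have hDdD : ∀ (i : {i // i ≠ l}) (w : T → V),
      diagOp V (fun H : T => H.1.aFun l p) (diagOp V (fun H : T => H.1.aCoeff l i) w) =
        diagOp V (fun H : T => H.1.aCoeff l i) (diagOp V (fun H : T => H.1.aFun l p) w) :=
    fun i w => funext fun H => smul_comm _ _ _
  have hdD : ∀ (i j : {i // i ≠ l}) (w : T → V),
      diagOp V (fun H : T => H.1.aCoeff l i) (diagOp V (fun H : T => H.1.aCoeff l j) w) =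
        diagOp V (fun H : T => H.1.aCoeff l j) (diagOp V (fun H : T => H.1.aCoeff l i) w) :=
    fun i j w => funext fun H => smul_comm _ _ _
  -- integrability along the line through `p` in the direction of `x`
  let R : ℂ → Module.End ℂ (T → V) := fun t => diagOp V fun H : T => 1 / (t - H.1.aFun l p)
  have hcomm : ∀ t : ℂ, (∀ H : T, t ≠ H.1.aFun l p) → ∀ i j,
      Ω.eval i (Function.update p l t) * Ω.eval j (Function.update p l t) =
        Ω.eval j (Function.update p l t) * Ω.eval i (Function.update p l t) := by
    intro t ht
    refine h.integrable _ fun G hG hmem => ?_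
    by_cases hd : G.DependsOn l
    · rw [hd.mem_carrier_iff, Function.update_self, Hyperplane.aFun_update] at hmem
      exact ht ⟨G, h.res_mem G hd hG⟩ hmem
    · rw [G.mem_carrier, Hyperplane.poly_update hd, ← G.mem_carrier] at hmem
      exact hp G hG hmem
  have hevl : ∀ t, Ω.eval l (Function.update p l t) =
      Ω.polyPart l p + Ω.resSum T ∘ₗ R t ∘ₗ constMap T V := by
    intro t
    rw [eval_self_eq_comp h.finite h.res_mem hT, polyPart_update, Function.update_self]
    simp only [Hyperplane.aFun_update]
    rfl
  have hevi : ∀ (i : {i // i ≠ l}) t, Ω.eval i (Function.update p l t) =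
      t • Ω.lin l i + Ω.slice l i p -
        Ω.resSum T ∘ₗ diagOp V (fun H : T => H.1.aCoeff l i) ∘ₗ R t ∘ₗ constMap T V := by
    intro i t
    rw [eval_of_ne_eq_comp h.finite h.lin_symm h.res_mem hT i.2, slice_update,
      Function.update_self]
    simp only [Hyperplane.aFun_update]
    rfl
  have hDR : ∀ t : ℂ, (∀ H : T, t ≠ H.1.aFun l p) → ∀ w,
      t • R t w = w + diagOp V (fun H : T => H.1.aFun l p) (R t w) := by
    intro t ht w
    ext H
    have h1 : t - H.1.aFun l p ≠ 0 := sub_ne_zero.2 (ht H)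
    simp only [R, Pi.add_apply, Pi.smul_apply, diagOp_apply]
    have : (t - H.1.aFun l p) * (1 / (t - H.1.aFun l p)) = 1 := by field_simp
    linear_combination (norm := module) this • w H
  have hRD : ∀ t : ℂ, (∀ H : T, t ≠ H.1.aFun l p) → ∀ w,
      t • R t w = w + R t (diagOp V (fun H : T => H.1.aFun l p) w) := by
    intro t ht w
    rw [hDR t ht]
    congr 1
    exact funext fun H => smul_comm _ _ _
  have hRdD : ∀ (t : ℂ) (i : {i // i ≠ l}) (w : T → V),
      R t (diagOp V (fun H : T => H.1.aCoeff l i) w) =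
        diagOp V (fun H : T => H.1.aCoeff l i) (R t w) :=
    fun t i w => funext fun H => smul_comm _ _ _
  have hRsum : ∀ (t : ℂ) (v : V), R t (constMap T V v) =
      ∑ H : T, (1 / (t - H.1.aFun l p)) • (Pi.single H v : T → V) := by
    intro t v
    ext H
    simp [R, Finset.sum_apply, Pi.single_apply]
  -- the partial fractions of `[Ω_x, Ω_{xᵢ}]`
  have hone : ∀ (i : {i // i ≠ l}) (v : V),
      Ω.polyPart l p (Ω.lin l i v) = Ω.lin l i (Ω.polyPart l p v) ∧
      Ω.polyPart l p (Ω.slice l i p v) - Ω.slice l i p (Ω.polyPart l p v) +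
        (Ω.resSum T (constMap T V (Ω.lin l i v)) - Ω.lin l i (Ω.resSum T (constMap T V v))) = 0 ∧
      ∀ H : T, Ω.resSum T ((Ω.laplace eps l T).slice l i p (Pi.single H v)) -
        Ω.slice l i p (Ω.resSum T (Pi.single H v)) -
        Ω.polyPart l p (Ω.resSum T (diagOp V (fun H : T => H.1.aCoeff l i) (Pi.single H v))) -
        Ω.lin l i (Ω.resSum T (diagOp V (fun H : T => H.1.aFun l p) (Pi.single H v))) = 0 := by
    intro i v
    have := eq_zero_of_partialFractions hinj (c₂ := (0 : V))
      (c₁ := Ω.polyPart l p (Ω.lin l i v) - Ω.lin l i (Ω.polyPart l p v))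
      (c₀ := Ω.polyPart l p (Ω.slice l i p v) - Ω.slice l i p (Ω.polyPart l p v) +
        (Ω.resSum T (constMap T V (Ω.lin l i v)) - Ω.lin l i (Ω.resSum T (constMap T V v))))
      (r := fun H : T => Ω.resSum T ((Ω.laplace eps l T).slice l i p (Pi.single H v)) -
        Ω.slice l i p (Ω.resSum T (Pi.single H v)) -
        Ω.polyPart l p (Ω.resSum T (diagOp V (fun H : T => H.1.aCoeff l i) (Pi.single H v))) -
        Ω.lin l i (Ω.resSum T (diagOp V (fun H : T => H.1.aFun l p) (Pi.single H v)))) ?_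
    · exact ⟨sub_eq_zero.1 this.2.1, this.2.2.1, this.2.2.2⟩
    · intro t ht
      have h1 := LinearMap.congr_fun (hcomm t ht l i) v
      rw [hevl, hevi, Module.End.mul_apply, Module.End.mul_apply, ← sub_eq_zero,
        commutator_eq_of_intertwining (hDR t ht) (hRD t ht) (hRdD t i) (hDM i) (hMQ i)] at h1
      simp only [hRsum, map_sum, map_smul, ← Finset.sum_sub_distrib, ← smul_sub] at h1
      rw [smul_zero, zero_add]
      exact h1
  have hPM : ∀ (i : {i // i ≠ l}) (w : T → V),
      Ω.resSum T ((Ω.laplace eps l T).slice l i p w) = Ω.slice l i p (Ω.resSum T w) +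
        Ω.polyPart l p (Ω.resSum T (diagOp V (fun H : T => H.1.aCoeff l i) w)) +
        Ω.lin l i (Ω.resSum T (diagOp V (fun H : T => H.1.aFun l p) w)) := by
    intro i w
    rw [← Finset.univ_sum_single w]
    simp only [map_sum, ← Finset.sum_add_distrib]
    refine Finset.sum_congr rfl fun H _ => ?_
    linear_combination (norm := module) (hone i (w H)).2.2 H
  -- the coefficients of the polynomial `[Ω_{xᵢ}, Ω_{xⱼ}]` in `x`
  have htwo : ∀ (i j : {i // i ≠ l}) (v : V),
      Ω.lin l i (Ω.lin l j v) - Ω.lin l j (Ω.lin l i v) = 0 ∧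
      Ω.lin l i (Ω.slice l j p v) - Ω.slice l j p (Ω.lin l i v) +
        (Ω.slice l i p (Ω.lin l j v) - Ω.lin l j (Ω.slice l i p v)) = 0 ∧
      Ω.slice l i p (Ω.slice l j p v) - Ω.slice l j p (Ω.slice l i p v) -
        (Ω.lin l i (Ω.resSum T (diagOp V (fun H : T => H.1.aCoeff l j) (constMap T V v))) -
          Ω.resSum T (diagOp V (fun H : T => H.1.aCoeff l j) (constMap T V (Ω.lin l i v)))) -
        (Ω.resSum T (diagOp V (fun H : T => H.1.aCoeff l i) (constMap T V (Ω.lin l j v))) -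
          Ω.lin l j (Ω.resSum T (diagOp V (fun H : T => H.1.aCoeff l i) (constMap T V v)))) =
        0 := by
    intro i j v
    have := eq_zero_of_partialFractions hinj (r := fun _ => (0 : V)) (fun t ht => by
      have h1 := LinearMap.congr_fun (hcomm t ht i j) v
      rw [hevi, hevi, Module.End.mul_apply, Module.End.mul_apply, ← sub_eq_zero,
        commutator_eq_of_intertwining' (hDR t ht) (hRD t ht) (hRdD t i) (hRdD t j) (hDdD i)
          (hDdD j) (hdD i j) (hDM i) (hDM j) (hdDM i j) (hPM i) (hPM j) (hMQ i) (hMQ j)] at h1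
      simp only [smul_zero, Finset.sum_const_zero, add_zero]
      exact h1)
    exact ⟨this.1, this.2.1, this.2.2.1⟩
  refine
    { S_dS := fun i v => (hone i v).1
      dS_dS := fun i j v => sub_eq_zero.1 (htwo i j v).1
      D_dD := hDdD
      dD_dD := hdD
      S_N := fun i v => (hone i v).2.1
      D_M := hDM
      dS_N := fun i j v => (htwo i j v).2.1
      dD_M := hdDM
      P_M := hPM
      M_Q := hMQ
      N_N := fun i j v => (htwo i j v).2.2
      M_M := fun i j => ?_ }
  have hX := eq_zero_of_intertwines_diagOp (B := diagOp V fun H : T => H.1.aFun l p) hinj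
    (f := (Ω.laplace eps l T).slice l i p ∘ₗ (Ω.laplace eps l T).slice l j p -
      (Ω.laplace eps l T).slice l j p ∘ₗ (Ω.laplace eps l T).slice l i p -
      (diagOp V (fun H : T => H.1.aCoeff l i) ∘ₗ constMap T V ∘ₗ Ω.lin l j ∘ₗ Ω.resSum T -
        constMap T V ∘ₗ Ω.lin l j ∘ₗ Ω.resSum T ∘ₗ diagOp V (fun H : T => H.1.aCoeff l i)) -
      (constMap T V ∘ₗ Ω.lin l i ∘ₗ Ω.resSum T ∘ₗ diagOp V (fun H : T => H.1.aCoeff l j) -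
        diagOp V (fun H : T => H.1.aCoeff l j) ∘ₗ constMap T V ∘ₗ Ω.lin l i ∘ₗ Ω.resSum T))
    (fun w => curvature_comm (hDdD i) (hDdD j) (hdD i j) (hDM i) (hDM j) (hdDM i j) (hPM i)
      (hPM j) (hMQ i) (hMQ j) w)
    (fun v => curvature_apply (fun v => (hone i v).1) (fun v => (hone j v).1)
      (fun v => sub_eq_zero.1 (htwo i j v).1) (hDdD i) (hDdD j) (hdD i j)
      (fun v => (hone i v).2.1) (fun v => (hone j v).2.1) (hDM i) (hDM j)
      (fun v => (htwo i j v).2.1) (hdDM i j) (hMQ i) (hMQ j) (fun v => (htwo i j v).2.2) v)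
  exact fun w => LinearMap.congr_fun hX w

end System

namespace System

/-! ### Morphisms of systems and generic points -/

section Intertwines

variable {n : ℕ} {V : Type u} [AddCommGroup V] [Module ℂ V] {W : Type v} [AddCommGroup W]
  [Module ℂ W] {Ω : System n V} {Ω' : System n W}

/-- A linear map that intertwines the coefficients of two systems. -/
structure Intertwines (Φ : V →ₗ[ℂ] W) (Ω : System n V) (Ω' : System n W) : Prop where
  const : ∀ i v, Φ (Ω.const i v) = Ω'.const i (Φ v)
  lin : ∀ i j v, Φ (Ω.lin i j v) = Ω'.lin i j (Φ v)
  res : ∀ H v, Φ (Ω.res H v) = Ω'.res H (Φ v)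

theorem Intertwines.polyPart {Φ : V →ₗ[ℂ] W} (h : Intertwines Φ Ω Ω') (i : Fin n)
    (x : Fin n → ℂ) (v : V) : Φ (Ω.polyPart i x v) = Ω'.polyPart i x (Φ v) := by
  simp [System.polyPart, h.const, h.lin, LinearMap.sum_apply]

theorem eval_apply (hfin : {H | Ω.res H ≠ 0}.Finite) (i : Fin n) (x : Fin n → ℂ) (v : V) :
    Ω.eval i x v = Ω.polyPart i x v +
      ∑ᶠ H : Hyperplane n, (H.coeff i / H.poly x) • Ω.res H v := by
  rw [eval, LinearMap.add_apply]
  congr 1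
  have h1 : (Function.support fun H : Hyperplane n => (H.coeff i / H.poly x) • Ω.res H).Finite :=
    hfin.subset fun H hH h0 => hH (by simp [h0])
  exact (LinearMap.applyₗ (R := ℂ) v).toAddMonoidHom.map_finsum h1

theorem Intertwines.eval {Φ : V →ₗ[ℂ] W} (h : Intertwines Φ Ω Ω')
    (hfin : {H | Ω.res H ≠ 0}.Finite) (hfin' : {H | Ω'.res H ≠ 0}.Finite) (i : Fin n)
    (x : Fin n → ℂ) (v : V) : Φ (Ω.eval i x v) = Ω'.eval i x (Φ v) := by
  rw [eval_apply hfin, eval_apply hfin', map_add, h.polyPart]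
  congr 1
  rw [← LinearMap.toAddMonoidHom_coe, AddMonoidHom.map_finsum]
  · refine finsum_congr fun H => ?_
    rw [LinearMap.toAddMonoidHom_coe, map_smul, h.res]
  · exact hfin.subset fun H hH h0 => hH (by simp [h0])

theorem Intertwines.comp {X : Type w} [AddCommGroup X] [Module ℂ X] {Ω'' : System n X}
    {Φ : V →ₗ[ℂ] W} {Ψ : W →ₗ[ℂ] X} (h' : Intertwines Ψ Ω' Ω'') (h : Intertwines Φ Ω Ω') :
    Intertwines (Ψ ∘ₗ Φ) Ω Ω'' where
  const i v := by simp [h.const, h'.const]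
  lin i j v := by simp [h.lin, h'.lin]
  res H v := by simp [h.res, h'.res]

theorem Intertwines.gaugeEquiv {P : V ≃ₗ[ℂ] W} (h : Intertwines P.toLinearMap Ω Ω') :
    Ω.GaugeEquiv Ω' := by
  refine ⟨P, ?_⟩
  ext : 1
  · ext i v
    have := h.const i (P.symm v)
    simp only [LinearEquiv.coe_coe, LinearEquiv.apply_symm_apply] at this
    simp [conj, LinearEquiv.conj_apply, this]
  · ext i j v
    have := h.lin i j (P.symm v)
    simp only [LinearEquiv.coe_coe, LinearEquiv.apply_symm_apply] at this
    simp [conj, LinearEquiv.conj_apply, this]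
  · ext H v
    have := h.res H (P.symm v)
    simp only [LinearEquiv.coe_coe, LinearEquiv.apply_symm_apply] at this
    simp [conj, LinearEquiv.conj_apply, this]

theorem intertwines_conj (P : V ≃ₗ[ℂ] W) (Ω : System n V) :
    Intertwines P.toLinearMap Ω (Ω.conj P) where
  const i v := by simp [conj, LinearEquiv.conj_apply]
  lin i j v := by simp [conj, LinearEquiv.conj_apply]
  res H v := by simp [conj, LinearEquiv.conj_apply]

theorem GaugeEquiv.exists_intertwines (h : Ω.GaugeEquiv Ω') :
    ∃ P : V ≃ₗ[ℂ] W, Intertwines P.toLinearMap Ω Ω' := by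
  obtain ⟨P, rfl⟩ := h
  exact ⟨P, intertwines_conj P Ω⟩

theorem Intertwines.symm {P : V ≃ₗ[ℂ] W} (h : Intertwines P.toLinearMap Ω Ω') :
    Intertwines P.symm.toLinearMap Ω' Ω where
  const i w := by
    have := h.const i (P.symm w)
    simp only [LinearEquiv.coe_coe, LinearEquiv.apply_symm_apply] at this
    simp [← this]
  lin i j w := by
    have := h.lin i j (P.symm w)
    simp only [LinearEquiv.coe_coe, LinearEquiv.apply_symm_apply] at this
    simp [← this]
  res H w := by
    have := h.res H (P.symm w)
    simp only [LinearEquiv.coe_coe, LinearEquiv.apply_symm_apply] at this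
    simp [← this]

theorem GaugeEquiv.symm (h : Ω.GaugeEquiv Ω') : Ω'.GaugeEquiv Ω := by
  obtain ⟨P, hP⟩ := h.exists_intertwines
  exact hP.symm.gaugeEquiv

theorem GaugeEquiv.trans {X : Type w} [AddCommGroup X] [Module ℂ X] {Ω'' : System n X}
    (h : Ω.GaugeEquiv Ω') (h' : Ω'.GaugeEquiv Ω'') : Ω.GaugeEquiv Ω'' := by
  obtain ⟨P, hP⟩ := h.exists_intertwines
  obtain ⟨Q, hQ⟩ := h'.exists_intertwines
  exact Intertwines.gaugeEquiv (P := P.trans Q) (hQ.comp hP)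

/-- Linear relations between the values of two systems at generic points are relations between
their coefficients. -/
theorem coeff_eq_of_eval_eq {X : Type*} [AddCommGroup X] [Module ℂ X]
    {A : Module.End ℂ V →ₗ[ℂ] X} {B : Module.End ℂ W →ₗ[ℂ] X}
    (hfin : {H | Ω.res H ≠ 0}.Finite) (hfin' : {H | Ω'.res H ≠ 0}.Finite)
    (h : ∀ i, ∀ᶠ x in generic n, A (Ω.eval i x) = B (Ω'.eval i x)) :
    (∀ i, A (Ω.const i) = B (Ω'.const i)) ∧
      (∀ i j, i ≠ j → A (Ω.lin i j) = B (Ω'.lin i j)) ∧ ∀ H, A (Ω.res H) = B (Ω'.res H) := by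
  have hA : ∀ i x, A (Ω.eval i x) = A (Ω.const i) +
      ∑ j ∈ Finset.univ.erase i, x j • A (Ω.lin i j) +
      ∑ᶠ H : Hyperplane n, (H.coeff i / H.poly x) • A (Ω.res H) := by
    intro i x
    rw [System.eval, System.polyPart, map_add, map_add, map_sum]
    simp only [map_smul]
    congr 1
    rw [← LinearMap.toAddMonoidHom_coe, AddMonoidHom.map_finsum]
    · exact finsum_congr fun H => by rw [LinearMap.toAddMonoidHom_coe, map_smul]
    · exact hfin.subset fun H hH h0 => hH (by simp [h0])
  have hB : ∀ i x, B (Ω'.eval i x) = B (Ω'.const i) +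
      ∑ j ∈ Finset.univ.erase i, x j • B (Ω'.lin i j) +
      ∑ᶠ H : Hyperplane n, (H.coeff i / H.poly x) • B (Ω'.res H) := by
    intro i x
    rw [System.eval, System.polyPart, map_add, map_add, map_sum]
    simp only [map_smul]
    congr 1
    rw [← LinearMap.toAddMonoidHom_coe, AddMonoidHom.map_finsum]
    · exact finsum_congr fun H => by rw [LinearMap.toAddMonoidHom_coe, map_smul]
    · exact hfin'.subset fun H hH h0 => hH (by simp [h0])
  obtain ⟨h1, h2, h3⟩ := eq_zero_of_form_eq_zero (c := fun i => A (Ω.const i) - B (Ω'.const i))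
    (L := fun i j => A (Ω.lin i j) - B (Ω'.lin i j))
    (r := fun H => A (Ω.res H) - B (Ω'.res H))
    ((hfin.union hfin').subset fun H hH => by
      by_contra h0
      simp only [Set.mem_union, Set.mem_ofPred_eq, not_or, not_not] at h0
      exact hH (by simp [h0.1, h0.2]))
    (fun i => by
      filter_upwards [h i] with x hx
      rw [hA, hB, ← sub_eq_zero] at hx
      rw [← hx]
      simp only [smul_sub, Finset.sum_sub_distrib]
      rw [finsum_sub_distrib]
      · abel
      · exact hfin.subset fun H hH h0 => hH (by simp [h0])
      · exact hfin'.subset fun H hH h0 => hH (by simp [h0]))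
  exact ⟨fun i => sub_eq_zero.1 (h1 i), fun i j hij => sub_eq_zero.1 (h2 i j hij),
    fun H => sub_eq_zero.1 (h3 H)⟩

theorem Intertwines.of_eval {Φ : V →ₗ[ℂ] W} (hfin : {H | Ω.res H ≠ 0}.Finite)
    (hfin' : {H | Ω'.res H ≠ 0}.Finite) (hself : ∀ i, Ω.lin i i = 0)
    (hself' : ∀ i, Ω'.lin i i = 0)
    (h : ∀ i, ∀ᶠ x in generic n, ∀ v, Φ (Ω.eval i x v) = Ω'.eval i x (Φ v)) :
    Intertwines Φ Ω Ω' := by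
  obtain ⟨h1, h2, h3⟩ := coeff_eq_of_eval_eq (A := LinearMap.llcomp ℂ V V W Φ)
    (B := (LinearMap.lcomp ℂ W Φ : Module.End ℂ W →ₗ[ℂ] (V →ₗ[ℂ] W))) hfin hfin' (fun i => by
      filter_upwards [h i] with x hx
      exact LinearMap.ext hx)
  refine ⟨fun i v => LinearMap.congr_fun (h1 i) v, fun i j v => ?_,
    fun H v => LinearMap.congr_fun (h3 H) v⟩
  by_cases hij : i = j
  · subst hij
    simp [hself, hself']
  · exact LinearMap.congr_fun (h2 i j hij) v

theorem continuousAt_eval (hfin : {H | Ω.res H ≠ 0}.Finite) {x : Fin n → ℂ}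
    (hx : ∀ H, Ω.res H ≠ 0 → x ∉ H.carrier) (i : Fin n) (φ : Module.Dual ℂ V) (v : V) :
    ContinuousAt (fun y => φ (Ω.eval i y v)) x := by
  have : (fun y => φ (Ω.eval i y v)) = fun y => φ (Ω.const i v) +
      ∑ j ∈ Finset.univ.erase i, y j * φ (Ω.lin i j v) +
      ∑ H ∈ hfin.toFinset, (H.coeff i / H.poly y) * φ (Ω.res H v) := by
    funext y
    rw [eval, finsum_eq_sum_of_support_subset (s := hfin.toFinset)]
    · simp [polyPart, LinearMap.sum_apply]
    · intro H hH
      simp only [Set.Finite.coe_toFinset, Set.mem_ofPred_eq]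
      intro h0
      exact hH (by simp [h0])
  rw [this]
  refine ContinuousAt.add ?_ (tendsto_finsetSum _ fun H hH => ?_)
  · exact (continuous_const.add (continuous_finsetSum _ fun j _ => by fun_prop)).continuousAt
  · have hne : H.poly x ≠ 0 := by
      rw [Ne, ← H.mem_carrier]
      exact hx H (by simpa using hH)
    exact (continuousAt_const.div H.continuous_poly.continuousAt hne).mul continuousAt_const

/-- It suffices to check integrability at generic points. -/
theorem integrable_of_eventually [FiniteDimensional ℂ V] (hfin : {H | Ω.res H ≠ 0}.Finite)
    (h : ∀ i j, ∀ᶠ x in generic n, Ω.eval i x * Ω.eval j x = Ω.eval j x * Ω.eval i x) :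
    Ω.Integrable := by
  intro x hx i j
  ext v
  rw [← sub_eq_zero]
  refine (Module.forall_dual_apply_eq_zero_iff ℂ _).1 fun φ => ?_
  let b := Module.finBasis ℂ V
  have hexp : ∀ i j y, φ ((Ω.eval i y * Ω.eval j y) v) =
      ∑ m, b.coord m (Ω.eval j y v) * φ (Ω.eval i y (b m)) := by
    intro i j y
    conv_lhs => rw [Module.End.mul_apply, ← b.sum_repr (Ω.eval j y v)]
    simp only [map_sum, map_smul, smul_eq_mul, Module.Basis.coord_apply]
  have hc : ∀ i j, ContinuousAt (fun y => φ ((Ω.eval i y * Ω.eval j y) v)) x := by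
    intro i j
    simp only [hexp]
    exact tendsto_finsetSum _ fun m _ =>
      (continuousAt_eval hfin hx j _ _).mul (continuousAt_eval hfin hx i _ _)
  have := eq_zero_of_eventually_generic ((hc i j).sub (hc j i)) (by
    filter_upwards [h i j] with y hy
    rw [Pi.sub_apply, hy, sub_self])
  simpa using this

theorem eventually_integrable (hfin : {H | Ω.res H ≠ 0}.Finite) (h : Ω.Integrable) :
    ∀ᶠ x in generic n, ∀ i j, Ω.eval i x * Ω.eval j x = Ω.eval j x * Ω.eval i x := by
  have := (eventually_all_finite hfin (l := generic n)
    (p := fun G x => x ∉ G.carrier)).2 fun G _ => eventually_notMem_carrier G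
  filter_upwards [this] with x hx i j
  exact h x hx i j

end Intertwines

/-! ### Eigenspaces of the polynomial part -/

section Eigenspaces

variable {n : ℕ} {V : Type u} [AddCommGroup V] [Module ℂ V] {W : Type v} [AddCommGroup W]
  [Module ℂ W] {eps : ℂ} {l : Fin n} {T S : Finset (Hyperplane n)} {Ω : System n V}
  {Ω' : System n W}

theorem mem_eigSpace_iff {G : Hyperplane n} {v : V} : v ∈ Ω.eigSpace eps l G ↔
    Ω.const l v = (eps * G.aConst l) • v ∧
      ∀ j, j ≠ l → Ω.lin l j v = (eps * G.aCoeff l j) • v := by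
  simp [eigSpace, Submodule.mem_inf, Submodule.mem_iInf]

theorem polyPart_apply_of_mem {G : Hyperplane n} {v : V} (hv : v ∈ Ω.eigSpace eps l G)
    (p : Fin n → ℂ) : Ω.polyPart l p v = (eps * G.aFun l p) • v := by
  rw [mem_eigSpace_iff] at hv
  have h1 : ∀ j ∈ Finset.univ.erase l, (p j • Ω.lin l j) v = (eps * (G.aCoeff l j * p j)) • v := by
    intro j hj
    rw [LinearMap.smul_apply, hv.2 j (Finset.ne_of_mem_erase hj), smul_smul]
    congr 1
    ring
  rw [polyPart, LinearMap.add_apply, LinearMap.sum_apply, Finset.sum_congr rfl h1, hv.1,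
    ← Finset.sum_smul, ← add_smul, Hyperplane.aFun, ← Finset.mul_sum, ← mul_add,
    ← Finset.add_sum_erase Finset.univ _ (Finset.mem_univ l), Hyperplane.aCoeff_self, zero_mul,
    zero_add]

theorem Intertwines.mem_eigSpace {Φ : V →ₗ[ℂ] W} (h : Intertwines Φ Ω Ω') {G : Hyperplane n}
    {v : V} (hv : v ∈ Ω.eigSpace eps l G) : Φ v ∈ Ω'.eigSpace eps l G := by
  rw [mem_eigSpace_iff] at hv ⊢
  refine ⟨?_, fun j hj => ?_⟩
  · rw [← h.const, hv.1, map_smul]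
  · rw [← h.lin, hv.2 j hj, map_smul]

/-- The class of systems between which the Laplace transform `𝓛^{x}` (`ε = 1`) or `𝓛^{-x}`
(`ε = -1`) acts: the singular hyperplanes that depend on `x` belong to `T`, and `S_x(x)` is
diagonalizable with eigenvalues `ε a_G`, `G ∈ S`. For `ε = 1` this is `𝔓_{T,S}`. -/
structure Adapted (eps : ℂ) (l : Fin n) (T S : Finset (Hyperplane n)) (Ω : System n V) : Prop
    extends Ω.Tame l T where
  iSup_eigSpace : ⨆ G ∈ S, Ω.eigSpace eps l G = ⊤

theorem Adapted.linearMap_ext (h : Ω.Adapted eps l T S) {f g : V →ₗ[ℂ] W}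
    (hfg : ∀ G ∈ S, ∀ v ∈ Ω.eigSpace eps l G, f v = g v) : f = g := by
  have : (⊤ : Submodule ℂ V) ≤ LinearMap.eqLocus f g := by
    rw [← h.iSup_eigSpace]
    exact iSup₂_le fun G hG v hv => hfg G hG v hv
  exact LinearMap.ext fun v => this Submodule.mem_top

theorem disjoint_eigSpace (heps : eps ≠ 0) (hS : ∀ G ∈ S, G.DependsOn l) {G : Hyperplane n}
    (hG : G.DependsOn l) :
    Disjoint (Ω.eigSpace eps l G) (⨆ G' ∈ S.erase G, Ω.eigSpace eps l G') := by
  have : ∀ᶠ p in generic n, ∀ G' ∈ S.erase G, G.aFun l p ≠ G'.aFun l p := by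
    rw [eventually_all_finset]
    intro G' hG'
    exact Hyperplane.eventually_aFun_ne hG (hS G' (Finset.mem_of_mem_erase hG'))
      (Finset.ne_of_mem_erase hG').symm
  obtain ⟨p, hp⟩ := this.exists
  refine ((Ω.polyPart l p).eigenspaces_iSupIndep (eps * G.aFun l p)).mono ?_ ?_
  · intro v hv
    exact Module.End.mem_eigenspace_iff.2 (polyPart_apply_of_mem hv p)
  · refine iSup₂_le fun G' hG' => ?_
    refine le_trans ?_ (le_iSup₂ (f := fun c (_ : c ≠ eps * G.aFun l p) =>
      (Ω.polyPart l p).eigenspace c) (eps * G'.aFun l p) ?_)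
    · intro v hv
      exact Module.End.mem_eigenspace_iff.2 (polyPart_apply_of_mem hv p)
    · intro h
      exact hp G' hG' (mul_left_cancel₀ heps h).symm

theorem Adapted.eigSpace_eq_bot (h : Ω.Adapted eps l T S) (heps : eps ≠ 0)
    (hS : ∀ G ∈ S, G.DependsOn l) {G : Hyperplane n} (hG : G.DependsOn l) (hGS : G ∉ S) :
    Ω.eigSpace eps l G = ⊥ := by
  have := disjoint_eigSpace (Ω := Ω) heps hS hG
  rwa [Finset.erase_eq_of_notMem hGS, h.iSup_eigSpace, disjoint_top] at this

theorem Adapted.isCompl (h : Ω.Adapted eps l T S) (heps : eps ≠ 0)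
    (hS : ∀ G ∈ S, G.DependsOn l) {G : Hyperplane n} (hG : G.DependsOn l) :
    IsCompl (Ω.eigSpace eps l G) (Ω.eigCompl eps l G) := by
  have hle : Ω.eigCompl eps l G ≤ ⨆ G' ∈ S.erase G, Ω.eigSpace eps l G' := by
    refine iSup₂_le fun G' hG' => ?_
    by_cases hGS : G' ∈ S
    · exact le_iSup₂ (f := fun G' (_ : G' ∈ S.erase G) => Ω.eigSpace eps l G') G'
        (Finset.mem_erase.2 ⟨hG'.2, hGS⟩)
    · rw [h.eigSpace_eq_bot heps hS hG'.1 hGS]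
      exact bot_le
  refine ⟨(disjoint_eigSpace heps hS hG).mono_right hle, ?_⟩
  rw [codisjoint_iff_le_sup, ← h.iSup_eigSpace]
  refine iSup₂_le fun G' hG' => ?_
  by_cases hGG : G' = G
  · rw [hGG]
    exact le_sup_left
  · exact le_trans (le_iSup₂ (f := fun G' (_ : G'.DependsOn l ∧ G' ≠ G) => Ω.eigSpace eps l G') G'
      ⟨hS G' hG', hGG⟩) le_sup_right

theorem Adapted.eigProj_apply_self (h : Ω.Adapted eps l T S) (heps : eps ≠ 0)
    (hS : ∀ G ∈ S, G.DependsOn l) {G : Hyperplane n} (hG : G.DependsOn l) {v : V}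
    (hv : v ∈ Ω.eigSpace eps l G) : Ω.eigProj eps l G v = v := by
  rw [eigProj, dif_pos (h.isCompl heps hS hG)]
  exact Submodule.projection_apply_left _ ⟨v, hv⟩

theorem Adapted.eigProj_apply_of_ne (h : Ω.Adapted eps l T S) (heps : eps ≠ 0)
    (hS : ∀ G ∈ S, G.DependsOn l) {G G' : Hyperplane n} (hG : G.DependsOn l)
    (hG' : G'.DependsOn l) (hne : G' ≠ G) {v : V} (hv : v ∈ Ω.eigSpace eps l G') :
    Ω.eigProj eps l G v = 0 := by
  rw [eigProj, dif_pos (h.isCompl heps hS hG), Submodule.projection_apply_eq_zero_iff]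
  exact le_iSup₂ (f := fun G' (_ : G'.DependsOn l ∧ G' ≠ G) => Ω.eigSpace eps l G') G'
    ⟨hG', hne⟩ hv

theorem Adapted.eigProj_mem (h : Ω.Adapted eps l T S) (heps : eps ≠ 0)
    (hS : ∀ G ∈ S, G.DependsOn l) {G : Hyperplane n} (hG : G.DependsOn l) (v : V) :
    Ω.eigProj eps l G v ∈ Ω.eigSpace eps l G := by
  rw [eigProj, dif_pos (h.isCompl heps hS hG)]
  exact Submodule.projection_apply_mem _ _

theorem Adapted.eigProj_eq_zero (h : Ω.Adapted eps l T S) (heps : eps ≠ 0)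
    (hS : ∀ G ∈ S, G.DependsOn l) {G : Hyperplane n} (hG : G.DependsOn l) (hGS : G ∉ S) :
    Ω.eigProj eps l G = 0 := by
  ext v
  have := h.eigProj_mem heps hS hG v
  rwa [h.eigSpace_eq_bot heps hS hG hGS, Submodule.mem_bot] at this

theorem Adapted.sum_eigProj (h : Ω.Adapted eps l T S) (heps : eps ≠ 0)
    (hS : ∀ G ∈ S, G.DependsOn l) (v : V) : ∑ G : S, Ω.eigProj eps l G.1 v = v := by
  have : ∑ G : S, Ω.eigProj eps l G.1 = LinearMap.id := by
    refine h.linearMap_ext fun G hG v hv => ?_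
    rw [LinearMap.sum_apply, Finset.sum_eq_single ⟨G, hG⟩]
    · exact h.eigProj_apply_self heps hS (hS G hG) hv
    · intro G' _ hne
      exact h.eigProj_apply_of_ne heps hS (hS _ G'.2) (hS G hG)
        (fun h' => hne (Subtype.ext h'.symm)) hv
    · simp
  simpa [LinearMap.sum_apply] using LinearMap.congr_fun this v

/-- An endomorphism that acts by a scalar on each joint eigenspace commutes with the projections. -/
theorem Adapted.eigProj_comp (h : Ω.Adapted eps l T S) (heps : eps ≠ 0)
    (hS : ∀ G ∈ S, G.DependsOn l) {f : Module.End ℂ V} {c : Hyperplane n → ℂ}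
    (hf : ∀ G, ∀ v ∈ Ω.eigSpace eps l G, f v = c G • v) {G : Hyperplane n}
    (hG : G.DependsOn l) (v : V) : Ω.eigProj eps l G (f v) = c G • Ω.eigProj eps l G v := by
  have : Ω.eigProj eps l G ∘ₗ f = c G • Ω.eigProj eps l G := by
    refine h.linearMap_ext fun G' hG' v hv => ?_
    rw [LinearMap.comp_apply, hf G' v hv, map_smul, LinearMap.smul_apply]
    by_cases hne : G' = G
    · rw [hne]
    · rw [h.eigProj_apply_of_ne heps hS hG (hS _ hG') hne hv, smul_zero, smul_zero]
  exact LinearMap.congr_fun this v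

theorem Intertwines.eigProj {Φ : V →ₗ[ℂ] W} (hΦ : Intertwines Φ Ω Ω')
    (h : Ω.Adapted eps l T S) (h' : Ω'.Adapted eps l T S) (heps : eps ≠ 0)
    (hS : ∀ G ∈ S, G.DependsOn l) {G : Hyperplane n} (hG : G.DependsOn l) (v : V) :
    Φ (Ω.eigProj eps l G v) = Ω'.eigProj eps l G (Φ v) := by
  have : Φ ∘ₗ Ω.eigProj eps l G = Ω'.eigProj eps l G ∘ₗ Φ := by
    refine h.linearMap_ext fun G' hG' v hv => ?_
    rw [LinearMap.comp_apply, LinearMap.comp_apply]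
    by_cases hne : G' = G
    · subst hne
      rw [h.eigProj_apply_self heps hS hG hv,
        h'.eigProj_apply_self heps hS hG (hΦ.mem_eigSpace hv)]
    · rw [h.eigProj_apply_of_ne heps hS hG (hS _ hG') hne hv, map_zero,
        h'.eigProj_apply_of_ne heps hS hG (hS _ hG') hne (hΦ.mem_eigSpace hv)]
  exact LinearMap.congr_fun this v

/-- Quotients of adapted systems are adapted. -/
theorem Adapted.of_surjective [FiniteDimensional ℂ W] (h : Ω.Adapted eps l T S)
    {Φ : V →ₗ[ℂ] W} (hΦ : Intertwines Φ Ω Ω') (hsurj : Function.Surjective Φ) :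
    Ω'.Adapted eps l T S := by
  have hzero : ∀ {f : Module.End ℂ V} {g : Module.End ℂ W}, (∀ v, Φ (f v) = g (Φ v)) → f = 0 →
      g = 0 := by
    intro f g hfg hf
    ext w
    obtain ⟨v, rfl⟩ := hsurj w
    rw [← hfg, hf, LinearMap.zero_apply, map_zero, LinearMap.zero_apply]
  have hres : ∀ H, Ω'.res H ≠ 0 → Ω.res H ≠ 0 := fun H hH h0 => hH (hzero (hΦ.res H) h0)
  have hfin : {H | Ω'.res H ≠ 0}.Finite := h.finite.subset hres
  refine ⟨⟨hfin, fun i => hzero (hΦ.lin i i) (h.lin_self i), fun i j => ?_, ?_,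
    fun hm j hj => hzero (hΦ.lin l j) (h.lin_eq_zero hm j hj),
    fun H hd hH => h.res_mem H hd (hres H hH)⟩, ?_⟩
  · ext w
    obtain ⟨v, rfl⟩ := hsurj w
    rw [← hΦ.lin, ← hΦ.lin, h.lin_symm]
  · refine integrable_of_eventually hfin fun i j => ?_
    filter_upwards [eventually_integrable h.finite h.integrable] with x hx
    ext w
    obtain ⟨v, rfl⟩ := hsurj w
    have := congrArg Φ (LinearMap.congr_fun (hx i j) v)
    simp only [Module.End.mul_apply, hΦ.eval h.finite hfin] at this
    exact this
  · rw [eq_top_iff, ← LinearMap.range_eq_top.2 hsurj, LinearMap.range_eq_map,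
      ← h.iSup_eigSpace, Submodule.map_iSup]
    refine iSup_le fun G => ?_
    rw [Submodule.map_iSup]
    refine iSup_le fun hG => ?_
    refine le_trans ?_ (le_iSup₂ (f := fun G (_ : G ∈ S) => Ω'.eigSpace eps l G) G hG)
    rintro _ ⟨v, hv, rfl⟩
    exact hΦ.mem_eigSpace hv

theorem Adapted.of_gaugeEquiv [FiniteDimensional ℂ W] (h : Ω.Adapted eps l T S)
    (he : Ω.GaugeEquiv Ω') : Ω'.Adapted eps l T S := by
  obtain ⟨P, hP⟩ := he.exists_intertwines
  exact h.of_surjective hP P.surjective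

end Eigenspaces

/-! ### The Laplace transform of an integrable system -/

section Laplace

variable {n : ℕ} {V : Type u} [AddCommGroup V] [Module ℂ V] {eps : ℂ} {l : Fin n}
  {T S : Finset (Hyperplane n)} {Ω : System n V}

theorem laplace_const_self :
    (Ω.laplace eps l T).const l = diagOp V fun H : T => -eps * H.1.aConst l := by
  simp only [laplace, if_true]
  rfl

theorem laplace_lin_self {j : Fin n} (hj : j ≠ l) :
    (Ω.laplace eps l T).lin l j = diagOp V fun H : T => -eps * H.1.aCoeff l j := by
  simp only [laplace, if_neg hj.symm, if_true]
  rfl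

theorem laplace_res_apply {G : Hyperplane n} (hG : G.DependsOn l) (w : T → V) :
    (Ω.laplace eps l T).res G w = constMap T V (-Ω.eigProj eps l G (Ω.resSum T w)) := by
  ext H
  simp [laplace, hG]

theorem laplace_polyPart (p : Fin n → ℂ) :
    (Ω.laplace eps l T).polyPart l p = -eps • diagOp V fun H : T => H.1.aFun l p := by
  refine LinearMap.ext fun w => funext fun H => ?_
  have h1 : ∀ j ∈ Finset.univ.erase l, (p j • (Ω.laplace eps l T).lin l j) w H =
      (-eps * (H.1.aCoeff l j * p j)) • w H := by
    intro j hj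
    rw [laplace_lin_self (Finset.ne_of_mem_erase hj), LinearMap.smul_apply, Pi.smul_apply,
      diagOp_apply, smul_smul]
    congr 1
    ring
  rw [polyPart, LinearMap.add_apply, Pi.add_apply, LinearMap.sum_apply, Finset.sum_apply,
    Finset.sum_congr rfl h1, laplace_const_self, diagOp_apply, ← Finset.sum_smul,
    LinearMap.smul_apply, Pi.smul_apply, diagOp_apply, smul_smul, Hyperplane.aFun, ← add_smul,
    ← Finset.mul_sum, ← Finset.add_sum_erase Finset.univ _ (Finset.mem_univ l),
    Hyperplane.aCoeff_self, zero_mul, zero_add, mul_add]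

/-- The copy of `V` that belongs to `H` is an eigenspace of the transform. -/
theorem single_mem_eigSpace_laplace (H : T) (v : V) :
    (Pi.single H v : T → V) ∈ (Ω.laplace eps l T).eigSpace (-eps) l H.1 := by
  have hdiag : ∀ a : T → ℂ, diagOp V a (Pi.single H v) = a H • Pi.single H v := by
    intro a
    ext H'
    by_cases h : H' = H
    · subst h
      simp
    · simp [h]
  rw [mem_eigSpace_iff]
  refine ⟨?_, fun j hj => ?_⟩
  · rw [laplace_const_self, hdiag]
  · rw [laplace_lin_self hj, hdiag]

theorem Adapted.laplace_finite (h : Ω.Adapted eps l T S) (heps : eps ≠ 0)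
    (hS : ∀ G ∈ S, G.DependsOn l) : {G | (Ω.laplace eps l T).res G ≠ 0}.Finite := by
  refine ((S.finite_toSet.union h.finite).union (Hyperplane.finite_collisions l T)).subset ?_
  intro G hG
  by_contra h0
  simp only [Set.mem_union, Finset.mem_coe, Set.mem_ofPred_eq, not_or, not_not, not_exists,
    not_and] at h0
  apply hG
  refine LinearMap.ext fun w => ?_
  by_cases hd : G.DependsOn l
  · rw [laplace_res_apply hd, h.eigProj_eq_zero heps hS hd h0.1.1]
    simp
  · have hc : ∀ H H' : T, ¬ G.carrier = {x | H.1.aFun l x = H'.1.aFun l x} :=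
      fun H H' => h0.2 H.1 H.2 H'.1 H'.2
    funext H
    simp [laplace, hd, h0.1.2, hc]

theorem Adapted.laplace_res_mem (h : Ω.Adapted eps l T S) (heps : eps ≠ 0)
    (hS : ∀ G ∈ S, G.DependsOn l) (G : Hyperplane n) (hG : G.DependsOn l)
    (hne : (Ω.laplace eps l T).res G ≠ 0) : G ∈ S := by
  by_contra hGS
  apply hne
  refine LinearMap.ext fun w => ?_
  rw [laplace_res_apply hG, h.eigProj_eq_zero heps hS hG hGS]
  simp

theorem Adapted.laplace_lin_symm (h : Ω.Adapted eps l T S) (i j : Fin n) :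
    (Ω.laplace eps l T).lin i j = (Ω.laplace eps l T).lin j i := by
  by_cases hij : i = j
  · rw [hij]
  · by_cases hi : i = l
    · subst hi
      simp [laplace, hij, Ne.symm hij]
    · by_cases hj : j = l
      · subst hj
        simp [laplace, hij, Ne.symm hij]
      · simp [laplace, hij, Ne.symm hij, hi, hj, h.lin_symm i j]

/-- The resolvent `(t - ε S_x(p))⁻¹` of the polynomial part of an adapted system, written in terms
of the projections onto the joint eigenspaces. -/
def resolvent (eps : ℂ) (l : Fin n) (S : Finset (Hyperplane n)) (Ω : System n V)
    (p : Fin n → ℂ) (t : ℂ) : Module.End ℂ V :=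
  ∑ G : S, (1 / (t - G.1.aFun l p)) • Ω.eigProj eps l G.1

theorem Adapted.eval_laplace_self (h : Ω.Adapted eps l T S) (heps : eps ≠ 0)
    (hS : ∀ G ∈ S, G.DependsOn l) (x : Fin n → ℂ) (w : T → V) :
    (Ω.laplace eps l T).eval l x w = -eps • diagOp V (fun H : T => H.1.aFun l x) w -
      constMap T V (Ω.resolvent eps l S x (x l) (Ω.resSum T w)) := by
  rw [eval_self (h.laplace_finite heps hS) (h.laplace_res_mem heps hS) hS, laplace_polyPart,
    LinearMap.add_apply, LinearMap.sum_apply, resolvent, LinearMap.sum_apply, map_sum,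
    sub_eq_add_neg, ← Finset.sum_neg_distrib]
  congr 1
  refine Finset.sum_congr rfl fun G _ => ?_
  rw [LinearMap.smul_apply, laplace_res_apply (hS _ G.2), LinearMap.smul_apply, map_smul, map_neg,
    smul_neg]

theorem Adapted.eval_laplace_of_ne (h : Ω.Adapted eps l T S) (he : eps * eps = 1)
    (hS : ∀ G ∈ S, G.DependsOn l) {i : Fin n} (hi : i ≠ l) (x : Fin n → ℂ) (w : T → V) :
    (Ω.laplace eps l T).eval i x w = x l • -eps • diagOp V (fun H : T => H.1.aCoeff l i) w +
      (Ω.laplace eps l T).slice l i x w +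
      constMap T V (eps • Ω.lin l i (Ω.resolvent eps l S x (x l) (Ω.resSum T w))) := by
  have heps : eps ≠ 0 := left_ne_zero_of_mul_eq_one he
  have h1 : (Ω.laplace eps l T).lin l i = -eps • diagOp V fun H : T => H.1.aCoeff l i := by
    rw [laplace_lin_self hi]
    refine LinearMap.ext fun w => funext fun H => ?_
    simp [mul_smul]
  rw [eval_of_ne (h.laplace_finite heps hS) h.laplace_lin_symm (h.laplace_res_mem heps hS) hS hi,
    h1, LinearMap.sub_apply, LinearMap.add_apply, LinearMap.sum_apply, resolvent,
    LinearMap.sum_apply, map_sum, Finset.smul_sum, map_sum, sub_eq_add_neg,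
    ← Finset.sum_neg_distrib]
  congr 1
  refine Finset.sum_congr rfl fun G _ => ?_
  have h2 := (mem_eigSpace_iff.1 (h.eigProj_mem heps hS (hS _ G.2) (Ω.resSum T w))).2 i hi
  rw [LinearMap.smul_apply, laplace_res_apply (hS _ G.2), LinearMap.smul_apply,
    map_smul (Ω.lin l i), h2, ← map_smul (constMap T V), ← map_neg]
  congr 1
  rw [smul_neg, neg_neg, smul_smul, smul_smul]
  congr 1
  linear_combination (-(G.1.aCoeff l i * (1 / (x l - G.1.aFun l x)))) * he

theorem Adapted.smul_resolvent (h : Ω.Adapted eps l T S) (he : eps * eps = 1)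
    (hS : ∀ G ∈ S, G.DependsOn l) {p : Fin n → ℂ} {t : ℂ}
    (ht : ∀ G : S, t ≠ G.1.aFun l p) (v : V) :
    t • Ω.resolvent eps l S p t v = v + eps • Ω.polyPart l p (Ω.resolvent eps l S p t v) := by
  have heps : eps ≠ 0 := left_ne_zero_of_mul_eq_one he
  have h1 : ∀ G : S, eps • Ω.polyPart l p ((1 / (t - G.1.aFun l p)) • Ω.eigProj eps l G.1 v) =
      (G.1.aFun l p * (1 / (t - G.1.aFun l p))) • Ω.eigProj eps l G.1 v := by
    intro G
    rw [map_smul, polyPart_apply_of_mem (h.eigProj_mem heps hS (hS _ G.2) v), smul_smul,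
      smul_smul]
    congr 1
    linear_combination ((1 / (t - G.1.aFun l p)) * G.1.aFun l p) * he
  simp only [resolvent, LinearMap.sum_apply, LinearMap.smul_apply, map_sum, Finset.smul_sum, h1]
  refine Eq.trans ?_ (congrArg (fun u => u + _) (h.sum_eigProj heps hS v))
  rw [← Finset.sum_add_distrib]
  refine Finset.sum_congr rfl fun G _ => ?_
  have h2 : t - G.1.aFun l p ≠ 0 := sub_ne_zero.2 (ht G)
  have h3 : t * (1 / (t - G.1.aFun l p)) = 1 + G.1.aFun l p * (1 / (t - G.1.aFun l p)) := by
    field_simp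
    ring
  rw [smul_smul, h3, add_smul, one_smul]

theorem Adapted.resolvent_comm (h : Ω.Adapted eps l T S) (heps : eps ≠ 0)
    (hS : ∀ G ∈ S, G.DependsOn l) {f : Module.End ℂ V} {c : Hyperplane n → ℂ}
    (hf : ∀ G, ∀ v ∈ Ω.eigSpace eps l G, f v = c G • v) (p : Fin n → ℂ) (t : ℂ) (v : V) :
    Ω.resolvent eps l S p t (f v) = f (Ω.resolvent eps l S p t v) := by
  simp only [resolvent, LinearMap.sum_apply, LinearMap.smul_apply, map_sum, map_smul]
  refine Finset.sum_congr rfl fun G _ => ?_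
  rw [h.eigProj_comp heps hS hf (hS _ G.2), hf _ _ (h.eigProj_mem heps hS (hS _ G.2) v)]

/-- The transform is integrable: at a generic point it arises from the swapped datum, so that its
coefficients commute. -/
theorem Adapted.laplace_integrable [FiniteDimensional ℂ V] (h : Ω.Adapted eps l T S)
    (he : eps * eps = 1) (hT : ∀ H ∈ T, H.DependsOn l) (hS : ∀ G ∈ S, G.DependsOn l) :
    (Ω.laplace eps l T).Integrable := by
  have heps : eps ≠ 0 := left_ne_zero_of_mul_eq_one he
  have hgen : ∀ᶠ x in generic n, ∀ G : S, x l ≠ G.1.aFun l x := by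
    rw [eventually_all]
    intro G
    filter_upwards [eventually_notMem_carrier G.1] with x hx
    rwa [(hS _ G.2).mem_carrier_iff] at hx
  have key : ∀ᶠ x in generic n, ∀ i j, (Ω.laplace eps l T).eval i x * (Ω.laplace eps l T).eval j x
      = (Ω.laplace eps l T).eval j x * (Ω.laplace eps l T).eval i x := by
    filter_upwards [h.dualDatum hT eps, hgen] with x hx hxS
    have hx' := hx.swap he
    have hpoly : ∀ G, ∀ v ∈ Ω.eigSpace eps l G, Ω.polyPart l x v = (eps * G.aFun l x) • v :=
      fun G v hv => polyPart_apply_of_mem hv x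
    have hDR := h.smul_resolvent he hS hxS
    have hRD : ∀ v, x l • Ω.resolvent eps l S x (x l) v =
        v + Ω.resolvent eps l S x (x l) ((eps • Ω.polyPart l x) v) := by
      intro v
      rw [hDR, LinearMap.smul_apply, map_smul, h.resolvent_comm heps hS hpoly]
    have hRdD : ∀ (i : {i // i ≠ l}) (v : V), Ω.resolvent eps l S x (x l) ((eps • Ω.lin l i) v) =
        (eps • Ω.lin l i) (Ω.resolvent eps l S x (x l) v) := by
      intro i v
      rw [LinearMap.smul_apply, LinearMap.smul_apply, map_smul,
        h.resolvent_comm heps hS fun G v hv => (mem_eigSpace_iff.1 hv).2 i i.2]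
    have hl : (Ω.laplace eps l T).eval l x = (-eps • diagOp V fun H : T => H.1.aFun l x) +
        (-constMap T V) ∘ₗ Ω.resolvent eps l S x (x l) ∘ₗ Ω.resSum T := by
      refine LinearMap.ext fun w => ?_
      rw [h.eval_laplace_self heps hS]
      simp [sub_eq_add_neg]
    have hi : ∀ i : {i // i ≠ l}, (Ω.laplace eps l T).eval i x =
        x l • (-eps • diagOp V fun H : T => H.1.aCoeff l i) + (Ω.laplace eps l T).slice l i x -
          (-constMap T V) ∘ₗ (eps • Ω.lin l i) ∘ₗ Ω.resolvent eps l S x (x l) ∘ₗ Ω.resSum T := by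
      intro i
      refine LinearMap.ext fun w => ?_
      rw [h.eval_laplace_of_ne he hS i.2]
      simp
    have c1 : ∀ i : {i // i ≠ l}, Commute ((Ω.laplace eps l T).eval l x)
        ((Ω.laplace eps l T).eval i x) := by
      intro i
      rw [hl, hi i]
      exact hx'.commute_eval hDR hRD hRdD i
    have c2 : ∀ i j : {i // i ≠ l}, Commute ((Ω.laplace eps l T).eval i x)
        ((Ω.laplace eps l T).eval j x) := by
      intro i j
      rw [hi i, hi j]
      exact hx'.commute_eval' hDR hRD hRdD i j
    intro i j
    by_cases hil : i = l
    · by_cases hjl : j = l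
      · rw [hil, hjl]
      · rw [hil]
        exact c1 ⟨j, hjl⟩
    · by_cases hjl : j = l
      · rw [hjl]
        exact (c1 ⟨i, hil⟩).symm
      · exact c2 ⟨i, hil⟩ ⟨j, hjl⟩
  exact integrable_of_eventually (h.laplace_finite heps hS) fun i j => key.mono fun x hx => hx i j

/-- The Laplace transform exchanges the singular hyperplanes in the direction of `x` and the
eigenvalues of the polynomial part. -/
theorem Adapted.laplace [FiniteDimensional ℂ V] (h : Ω.Adapted eps l T S)
    (he : eps * eps = 1) (hT : ∀ H ∈ T, H.DependsOn l) (hS : ∀ G ∈ S, G.DependsOn l)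
    (hTS : ¬ (Hyperplane.HasMixed l T ∧ Hyperplane.HasMixed l S)) :
    (Ω.laplace eps l T).Adapted (-eps) l S T := by
  have heps : eps ≠ 0 := left_ne_zero_of_mul_eq_one he
  refine ⟨⟨h.laplace_finite heps hS, fun i => if_pos rfl, h.laplace_lin_symm,
    h.laplace_integrable he hT hS, fun hm j hj => ?_, h.laplace_res_mem heps hS⟩, ?_⟩
  · rw [laplace_lin_self hj]
    refine LinearMap.ext fun w => funext fun H => ?_
    have : H.1.coeff j = 0 := by
      by_contra hne
      exact hTS ⟨⟨H.1, H.2, hT _ H.2, j, hj, hne⟩, hm⟩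
    simp [Hyperplane.aCoeff, this]
  · rw [eq_top_iff]
    intro w _
    rw [← Finset.univ_sum_single w]
    refine Submodule.sum_mem _ fun H _ => ?_
    exact le_iSup₂ (f := fun G (_ : G ∈ T) => (Ω.laplace eps l T).eigSpace (-eps) l G) H.1 H.2
      (single_mem_eigSpace_laplace H (w H))

theorem mem_kerSum {w : T → V} : w ∈ Ω.kerSum T ↔ ∀ H : T, Ω.res H.1 (w H) = 0 := by
  simp [kerSum, Submodule.mem_pi]

theorem resSum_eq_zero {w : T → V} (hw : w ∈ Ω.kerSum T) : Ω.resSum T w = 0 := by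
  rw [resSum_apply]
  exact Finset.sum_eq_zero fun H _ => mem_kerSum.1 hw H

theorem diagOp_mem_kerSum {w : T → V} (hw : w ∈ Ω.kerSum T) (a : T → ℂ) :
    diagOp V a w ∈ Ω.kerSum T := by
  rw [mem_kerSum] at hw ⊢
  intro H
  rw [diagOp_apply, map_smul, hw H, smul_zero]

/-- The coefficients of the transform preserve `𝒦`. Off the diagonal the blocks factor through the
`A_H`; for the diagonal blocks, this is the relation `P M = N P + ⋯`. -/
theorem Adapted.eval_laplace_mem_kerSum (h : Ω.Adapted eps l T S)
    (he : eps * eps = 1) (hT : ∀ H ∈ T, H.DependsOn l) (hS : ∀ G ∈ S, G.DependsOn l) :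
    ∀ᶠ x in generic n, ∀ i, ∀ w ∈ Ω.kerSum T, (Ω.laplace eps l T).eval i x w ∈ Ω.kerSum T := by
  have heps : eps ≠ 0 := left_ne_zero_of_mul_eq_one he
  filter_upwards [h.dualDatum hT eps] with x hx i w hw
  by_cases hi : i = l
  · subst hi
    rw [h.eval_laplace_self heps hS, resSum_eq_zero hw, map_zero, map_zero, sub_zero]
    exact Submodule.smul_mem _ _ (diagOp_mem_kerSum hw _)
  · rw [h.eval_laplace_of_ne he hS hi, resSum_eq_zero hw, map_zero, map_zero, smul_zero, map_zero,
      add_zero]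
    refine Submodule.add_mem _ (Submodule.smul_mem _ _ (Submodule.smul_mem _ _
      (diagOp_mem_kerSum hw _))) ?_
    rw [← Finset.univ_sum_single w, map_sum]
    refine Submodule.sum_mem _ fun H _ => ?_
    have hu : Ω.res H.1 (w H) = 0 := mem_kerSum.1 hw H
    -- on `ker A_H` the transform has no off-diagonal blocks
    have hoff : ∀ H' : T, H' ≠ H →
        (Ω.laplace eps l T).slice l i x (Pi.single H (w H)) H' = 0 := by
      intro H' hne
      rw [h.laplace_slice hT eps hi, Pi.single_eq_of_ne hne]
      simp only [map_zero, smul_zero, zero_add, zero_sub, map_neg, smul_neg]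
      refine Finset.sum_eq_zero fun H'' _ => ?_
      by_cases hH : H'' = H
      · subst hH
        rw [Pi.single_eq_same, hu, smul_zero, neg_zero]
      · rw [Pi.single_eq_of_ne hH, map_zero, smul_zero, neg_zero]
    have hs : (Pi.single H (w H) : T → V) ∈ Ω.kerSum T := by
      rw [mem_kerSum]
      intro H'
      by_cases hH : H' = H
      · subst hH
        rw [Pi.single_eq_same, hu]
      · rw [Pi.single_eq_of_ne hH, map_zero]
    have hP := hx.P_M ⟨i, hi⟩ (Pi.single H (w H))
    rw [resSum_eq_zero hs, resSum_eq_zero (diagOp_mem_kerSum hs _),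
      resSum_eq_zero (diagOp_mem_kerSum hs _), map_zero, map_zero, map_zero, add_zero, add_zero,
      resSum_apply, Finset.sum_eq_single H (fun H' _ hne => by rw [hoff H' hne, map_zero])
      (fun h' => absurd (Finset.mem_univ H) h')] at hP
    rw [mem_kerSum]
    intro H'
    by_cases hH : H' = H
    · subst hH
      exact hP
    · rw [hoff H' hH, map_zero]

theorem Adapted.kerInvariant (h : Ω.Adapted eps l T S)
    (he : eps * eps = 1) (hT : ∀ H ∈ T, H.DependsOn l) (hS : ∀ G ∈ S, G.DependsOn l) :
    Ω.KerInvariant eps l T := by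
  have heps : eps ≠ 0 := left_ne_zero_of_mul_eq_one he
  have key : ∀ w ∈ Ω.kerSum T,
      (∀ i, (Ω.kerSum T).mkQ ((Ω.laplace eps l T).const i w) = 0) ∧
      (∀ i j, i ≠ j → (Ω.kerSum T).mkQ ((Ω.laplace eps l T).lin i j w) = 0) ∧
      ∀ H, (Ω.kerSum T).mkQ ((Ω.laplace eps l T).res H w) = 0 := by
    intro w hw
    refine coeff_eq_of_eval_eq (A := (Ω.kerSum T).mkQ ∘ₗ LinearMap.applyₗ w)
      (B := (0 : Module.End ℂ (T → V) →ₗ[ℂ] _)) (h.laplace_finite heps hS)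
      (h.laplace_finite heps hS) fun i => ?_
    filter_upwards [h.eval_laplace_mem_kerSum he hT hS] with x hx
    exact (Submodule.Quotient.mk_eq_zero _).2 (hx i w hw)
  refine ⟨fun i w hw => (Submodule.Quotient.mk_eq_zero (Ω.kerSum T)).1 ((key w hw).1 i),
    fun i j w hw => ?_,
    fun G w hw => (Submodule.Quotient.mk_eq_zero (Ω.kerSum T)).1 ((key w hw).2.2 G)⟩
  by_cases hij : i = j
  · have : (Ω.laplace eps l T).lin i j = 0 := if_pos hij
    rw [Submodule.mem_comap, this, LinearMap.zero_apply]
    exact Submodule.zero_mem _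
  · exact (Submodule.Quotient.mk_eq_zero (Ω.kerSum T)).1 ((key w hw).2.1 i j hij)

theorem KerInvariant.intertwines (h : Ω.KerInvariant eps l T) :
    Intertwines (Ω.kerSum T).mkQ (Ω.laplace eps l T) (Ω.middleLaplace eps l T) where
  const i v := by
    simp [middleLaplace, quotMap, dif_pos (h.1 i)]
  lin i j v := by
    simp [middleLaplace, quotMap, dif_pos (h.2.1 i j)]
  res G v := by
    simp [middleLaplace, quotMap, dif_pos (h.2.2 G)]

theorem Adapted.middleLaplace [FiniteDimensional ℂ V] (h : Ω.Adapted eps l T S)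
    (he : eps * eps = 1) (hT : ∀ H ∈ T, H.DependsOn l) (hS : ∀ G ∈ S, G.DependsOn l)
    (hTS : ¬ (Hyperplane.HasMixed l T ∧ Hyperplane.HasMixed l S)) :
    (Ω.middleLaplace eps l T).Adapted (-eps) l S T :=
  (h.laplace he hT hS hTS).of_surjective (h.kerInvariant he hT hS).intertwines
    (Submodule.mkQ_surjective _)

end Laplace

/-! ### Additions -/

section Addition

variable {n : ℕ} {V : Type u} [AddCommGroup V] [Module ℂ V] {eps : ℂ} {l : Fin n}
  {T S : Finset (Hyperplane n)} {Ω : System n V}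

theorem addition_finite (hfin : {H | Ω.res H ≠ 0}.Finite) (α : T → ℂ) :
    {H | (Ω.addition T α).res H ≠ 0}.Finite := by
  refine (hfin.union T.finite_toSet).subset fun H hH => ?_
  by_contra h0
  simp only [Set.mem_union, Set.mem_ofPred_eq, Finset.mem_coe, not_or, not_not] at h0
  exact hH (by simp [addition, h0.1, h0.2])

/-- An addition changes the coefficients of the form by scalars. -/
theorem eval_addition (hfin : {H | Ω.res H ≠ 0}.Finite) (α : T → ℂ) (i : Fin n)
    (x : Fin n → ℂ) : ∃ c : ℂ, (Ω.addition T α).eval i x = Ω.eval i x + c • 1 := by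
  refine ⟨∑ H : T, (H.1.coeff i / H.1.poly x) * α H, ?_⟩
  have h1 : (∑ H : T, (H.1.coeff i / H.1.poly x) * α H) • (1 : Module.End ℂ V) =
      ∑ᶠ H : Hyperplane n, (H.coeff i / H.poly x) •
        (if h : H ∈ T then α ⟨H, h⟩ • (1 : Module.End ℂ V) else 0) := by
    rw [finsum_eq_sum_of_support_subset (s := T), ← Finset.sum_coe_sort T, Finset.sum_smul]
    · refine Finset.sum_congr rfl fun H _ => ?_
      rw [dif_pos H.2, smul_smul]
    · intro H hH
      by_contra h0
      rw [Finset.mem_coe] at h0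
      exact hH (by simp [h0])
  rw [h1, eval, eval, add_assoc, ← finsum_add_distrib]
  · congr 1
    exact finsum_congr fun H => smul_add _ _ _
  · exact hfin.subset fun H hH h0 => hH (by simp [h0])
  · refine T.finite_toSet.subset fun H hH => ?_
    by_contra h0
    rw [Finset.mem_coe] at h0
    exact hH (by simp [h0])

theorem Adapted.addition [FiniteDimensional ℂ V] (h : Ω.Adapted eps l T S) (α : T → ℂ) :
    (Ω.addition T α).Adapted eps l T S := by
  refine ⟨⟨addition_finite h.finite α, h.lin_self, h.lin_symm, ?_, h.lin_eq_zero, ?_⟩,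
    h.iSup_eigSpace⟩
  · refine integrable_of_eventually (addition_finite h.finite α) fun i j => ?_
    filter_upwards [eventually_integrable h.finite h.integrable] with x hx
    obtain ⟨c, hc⟩ := eval_addition h.finite α i x
    obtain ⟨d, hd⟩ := eval_addition h.finite α j x
    rw [hc, hd]
    simp only [add_mul, mul_add, hx i j, smul_mul_assoc, mul_smul_comm, one_mul, mul_one]
    module
  · intro H hd hne
    by_contra hH
    refine hH (h.res_mem H hd fun h0 => hne ?_)
    simp [System.addition, h0, hH]

theorem addition_addition (α β : T → ℂ) :
    (Ω.addition T α).addition T β = Ω.addition T (α + β) := by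
  ext : 1
  · rfl
  · rfl
  · funext H
    simp only [addition, Pi.add_apply, add_assoc]
    congr 1
    split_ifs
    · rw [add_smul]
    · rw [add_zero]

theorem addition_zero : Ω.addition T 0 = Ω := by
  ext : 1
  · rfl
  · rfl
  · funext H
    simp [addition]

theorem Intertwines.addition {W : Type v} [AddCommGroup W] [Module ℂ W] {Ω' : System n W}
    {Φ : V →ₗ[ℂ] W} (h : Intertwines Φ Ω Ω') (α : T → ℂ) :
    Intertwines Φ (Ω.addition T α) (Ω'.addition T α) where
  const := h.const
  lin := h.lin
  res H v := by
    simp only [System.addition, LinearMap.add_apply, map_add, h.res]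
    split_ifs <;> simp

end Addition

/-! ### The class `𝔓_{T,S}` -/

section Mem

/-- The coefficients of the polynomial part in the direction of `x` commute. -/
theorem Tame.commute {n : ℕ} {V : Type u} [AddCommGroup V] [Module ℂ V] {l : Fin n}
    {T : Finset (Hyperplane n)} {Ω : System n V} (h : Ω.Tame l T)
    (hT : ∀ H ∈ T, H.DependsOn l) {i : Fin n} (hi : i ≠ l) :
    (∀ v, Ω.const l (Ω.lin l i v) = Ω.lin l i (Ω.const l v)) ∧
      ∀ j, j ≠ l → ∀ v, Ω.lin l i (Ω.lin l j v) = Ω.lin l j (Ω.lin l i v) := by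
  obtain ⟨p, hp⟩ := (h.dualDatum hT 1).exists
  have h2 : ∀ j, j ≠ l → ∀ v, Ω.lin l i (Ω.lin l j v) = Ω.lin l j (Ω.lin l i v) :=
    fun j hj v => hp.dS_dS ⟨i, hi⟩ ⟨j, hj⟩ v
  refine ⟨fun v => ?_, h2⟩
  have h1 := hp.S_dS ⟨i, hi⟩ v
  simp only [polyPart, LinearMap.add_apply, LinearMap.sum_apply, LinearMap.smul_apply, map_add,
    map_sum, map_smul] at h1
  rw [Finset.sum_congr rfl fun j hj => by rw [← h2 j (Finset.ne_of_mem_erase hj)]] at h1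
  exact add_right_cancel h1

variable {n : ℕ} {V : Type u} [AddCommGroup V] [Module ℂ V] [FiniteDimensional ℂ V] {l : Fin n}
  {T S : Finset (Hyperplane n)} {Ω : System n V}

theorem iSup_iInf_eigenspace_eq_top {f : Fin n → Module.End ℂ V}
    (hcomm : ∀ i j v, f i (f j v) = f j (f i v))
    (hdiag : ∀ i, ⨆ c, (f i).eigenspace c = ⊤) (J : Finset (Fin n)) :
    ⨆ χ : Fin n → ℂ, ⨅ j ∈ J, (f j).eigenspace (χ j) = ⊤ := by
  induction J using Finset.induction_on with
  | empty => simp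
  | insert k J hk ih =>
    rw [eq_top_iff, ← ih]
    refine iSup_le fun χ => ?_
    have hinv : ∀ v ∈ ⨅ j ∈ J, (f j).eigenspace (χ j), f k v ∈ ⨅ j ∈ J, (f j).eigenspace (χ j) := by
      intro v hv
      simp only [Submodule.mem_iInf, Module.End.mem_eigenspace_iff] at hv ⊢
      intro j hj
      rw [hcomm, hv j hj, map_smul]
    have := Submodule.inf_iSup_genEigenspace hinv 1
    rw [show (⨆ μ, (f k).genEigenspace μ 1) = ⊤ from hdiag k, inf_top_eq] at this
    rw [this]
    refine iSup_le fun c => ?_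
    refine le_trans ?_ (le_iSup _ (Function.update χ k c))
    refine le_iInf₂ fun j hj => ?_
    rcases Finset.mem_insert.1 hj with rfl | hj'
    · rw [Function.update_self]
      exact inf_le_right
    · rw [Function.update_of_ne (fun h : j = k => hk (h ▸ hj'))]
      exact inf_le_left.trans (iInf₂_le (f := fun j (_ : j ∈ J) => (f j).eigenspace (χ j)) j hj')

/-- Commuting diagonalizable matrices have joint eigenspaces, and a joint eigenvalue of the
polynomial part is an affine function whose graph lies in `{det (x - S_x) = 0}`, hence in the union
of `S`. Since finitely many other hyperplanes do not cover it, the graph belongs to `S`. -/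
theorem Mem.adapted (h : Ω.Mem l T S) (hT : ∀ H ∈ T, H.DependsOn l) :
    Ω.Adapted 1 l T S := by
  refine ⟨h.tame, ?_⟩
  let f : Fin n → Module.End ℂ V := fun j => if j = l then Ω.const l else Ω.lin l j
  have hfl : f l = Ω.const l := if_pos rfl
  have hfj : ∀ j, j ≠ l → f j = Ω.lin l j := fun j hj => if_neg hj
  have hcomm : ∀ i j v, f i (f j v) = f j (f i v) := by
    intro i j v
    by_cases hi : i = l
    · by_cases hj : j = l
      · rw [hi, hj]
      · rw [hi, hfl, hfj j hj, (h.tame.commute hT hj).1]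
    · by_cases hj : j = l
      · rw [hj, hfl, hfj i hi, (h.tame.commute hT hi).1]
      · rw [hfj j hj, hfj i hi, (h.tame.commute hT hi).2 j hj]
  have hdiag : ∀ i, ⨆ c, (f i).eigenspace c = ⊤ := by
    intro i
    by_cases hi : i = l
    · rw [hi, hfl]
      exact h.diag_const
    · rw [hfj i hi]
      exact h.diag_lin i hi
  rw [eq_top_iff, ← iSup_iInf_eigenspace_eq_top hcomm hdiag Finset.univ]
  refine iSup_le fun χ => ?_
  by_cases hbot : (⨅ j ∈ Finset.univ, (f j).eigenspace (χ j)) = ⊥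
  · rw [hbot]
    exact bot_le
  -- the zero set of `x - χ_ℓ - ∑ χⱼ xⱼ` lies in that of the determinant
  let c : Fin n → ℂ := fun j => if j = l then 1 else -χ j
  have hcl : c l = 1 := if_pos rfl
  have hcj : ∀ j, j ≠ l → c j = -χ j := fun j hj => if_neg hj
  have hc : c ≠ 0 := fun h0 => one_ne_zero (hcl.symm.trans (congrFun h0 l))
  let G := Hyperplane.ofAffine c (-χ l) hc
  obtain ⟨k, hk, hGc, hGd⟩ := Hyperplane.exists_eq_mul_of_carrier_eq (G := G) hc rfl
  have hG0 : G.aConst l = χ l := by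
    rw [Hyperplane.aConst, hGd, hGc, hcl]
    field_simp
  have hGj : ∀ j, j ≠ l → G.aCoeff l j = χ j := by
    intro j hj
    rw [Hyperplane.aCoeff, if_neg hj, hGc, hGc, hcl, hcj j hj]
    field_simp
  have hGl : G.DependsOn l := by
    rw [Hyperplane.DependsOn, hGc, hcl, mul_one]
    exact hk
  have hle : (⨅ j ∈ Finset.univ, (f j).eigenspace (χ j)) ≤ Ω.eigSpace 1 l G := by
    intro v hv
    simp only [Submodule.mem_iInf, Module.End.mem_eigenspace_iff, Finset.mem_univ,
      true_implies] at hv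
    rw [mem_eigSpace_iff]
    refine ⟨?_, fun j hj => ?_⟩
    · rw [hG0, one_mul, ← hfl, hv]
    · rw [hGj j hj, one_mul, ← hfj j hj, hv]
  obtain ⟨v, hv, hv0⟩ := (Submodule.ne_bot_iff _).1 hbot
  have hGS : G ∈ S := by
    by_contra hGS
    obtain ⟨x, hxG, hxS⟩ := G.exists_mem_forall_notMem S hGS
    have hdet : LinearMap.det (x l • (1 : Module.End ℂ V) - Ω.polyPart l x) = 0 := by
      rw [LinearMap.det_eq_zero_iff_ker_ne_bot, Submodule.ne_bot_iff]
      refine ⟨v, ?_, hv0⟩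
      rw [LinearMap.mem_ker, LinearMap.sub_apply, polyPart_apply_of_mem (hle hv), one_mul,
        ← (hGl.mem_carrier_iff x).1 hxG]
      simp
    obtain ⟨H, hH, hxH⟩ := Set.mem_iUnion₂.1 (h.det_subset hdet)
    exact hxS H hH hxH
  exact hle.trans (le_iSup₂ (f := fun G (_ : G ∈ S) => Ω.eigSpace 1 l G) G hGS)

theorem Adapted.mem (h : Ω.Adapted 1 l T S) (hS : ∀ G ∈ S, G.DependsOn l) : Ω.Mem l T S where
  finite := h.finite
  lin_self := h.lin_self
  lin_symm := h.lin_symm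
  integrable := h.integrable
  diag_const := by
    rw [eq_top_iff, ← h.iSup_eigSpace]
    exact iSup₂_le fun G _ => le_trans inf_le_left (le_iSup _ (1 * G.aConst l))
  diag_lin j hj := by
    rw [eq_top_iff, ← h.iSup_eigSpace]
    refine iSup₂_le fun G _ => le_trans ?_ (le_iSup _ (1 * G.aCoeff l j))
    exact inf_le_right.trans (iInf₂_le j hj)
  lin_eq_zero := h.lin_eq_zero
  res_mem := h.res_mem
  det_subset := by
    intro x hx
    by_contra hxS
    simp only [Set.mem_iUnion, not_exists] at hxS
    have hsurj : LinearMap.range (x l • (1 : Module.End ℂ V) - Ω.polyPart l x) = ⊤ := by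
      rw [eq_top_iff, ← h.iSup_eigSpace]
      refine iSup₂_le fun G hG v hv => ?_
      have hne : x l - G.aFun l x ≠ 0 := fun h0 =>
        hxS G hG (((hS G hG).mem_carrier_iff x).2 (sub_eq_zero.1 h0))
      refine ⟨(x l - G.aFun l x)⁻¹ • v, ?_⟩
      rw [map_smul, LinearMap.sub_apply, polyPart_apply_of_mem hv, LinearMap.smul_apply,
        Module.End.one_apply, one_mul, ← sub_smul, smul_smul, inv_mul_cancel₀ hne, one_smul]
    rw [Set.mem_ofPred_eq, LinearMap.det_eq_zero_iff_ker_ne_bot] at hx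
    exact hx (LinearMap.ker_eq_bot_iff_range_eq_top.2 hsurj)

end Mem

/-! ### Irreducibility and inversion -/

section Inversion

variable {n : ℕ} {V : Type u} [AddCommGroup V] [Module ℂ V] {eps : ℂ} {l : Fin n}
  {T S : Finset (Hyperplane n)} {Ω : System n V}

/-- An invariant subspace contains the components of its elements in the eigenspaces. -/
theorem mem_of_sum_eigenvectors_mem {ι : Type*} [Fintype ι] {B : Module.End ℂ V}
    {U : Submodule ℂ V} (hU : U ≤ U.comap B) {a : ι → ℂ} (ha : Function.Injective a) {u : ι → V}
    (hu : ∀ k, B (u k) = a k • u k) (hsum : ∑ k, u k ∈ U) (k : ι) : u k ∈ U := by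
  have := eq_zero_of_sum_eigenvectors (B := U.mapQ U B hU) ha (u := fun k => U.mkQ (u k))
    (fun k => by
      simp only [Submodule.mkQ_apply, Submodule.mapQ_apply, hu, Submodule.Quotient.mk_smul]) (by
      rw [← map_sum]
      exact (Submodule.Quotient.mk_eq_zero U).2 hsum) k
  exact (Submodule.Quotient.mk_eq_zero U).1 this

theorem polyPart_mem {U : Submodule ℂ V} (hc : U ≤ U.comap (Ω.const l))
    (hl : ∀ j, j ≠ l → U ≤ U.comap (Ω.lin l j)) (p : Fin n → ℂ) :
    U ≤ U.comap (Ω.polyPart l p) := by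
  intro v hv
  rw [Submodule.mem_comap, polyPart, LinearMap.add_apply, LinearMap.sum_apply]
  refine U.add_mem (hc hv) (U.sum_mem fun j hj => U.smul_mem _ ?_)
  exact hl j (Finset.ne_of_mem_erase hj) hv

theorem res_comap_of_notMem (h : Ω.Tame l T) {H : Hyperplane n} (hd : H.DependsOn l) (hH : H ∉ T)
    (U : Submodule ℂ V) : U ≤ U.comap (Ω.res H) := by
  have : Ω.res H = 0 := by
    by_contra hne
    exact hH (h.res_mem H hd hne)
  intro v _
  rw [Submodule.mem_comap, this, LinearMap.zero_apply]
  exact U.zero_mem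

theorem resSum_single (H : T) (v : V) : Ω.resSum T (Pi.single H v) = Ω.res H.1 v := by
  rw [resSum_apply, Finset.sum_eq_single H]
  · rw [Pi.single_eq_same]
  · intro H' _ hne
    rw [Pi.single_eq_of_ne hne, map_zero]
  · simp

/-- For irreducible systems, no vector in a joint eigenspace of the polynomial part is annihilated
by all residues. -/
theorem Adapted.eq_zero_of_res_eigProj (h : Ω.Adapted eps l T S) (heps : eps ≠ 0)
    (hS : ∀ G ∈ S, G.DependsOn l) (hirr : Ω.Irreducible l) (hpole : Ω.HasPole T) {v : V}
    (hv : ∀ H ∈ T, ∀ G ∈ S, Ω.res H (Ω.eigProj eps l G v) = 0) : v = 0 := by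
  let U : Submodule ℂ V :=
    ⨅ H ∈ T, ⨅ G ∈ S, LinearMap.ker (Ω.res H ∘ₗ Ω.eigProj eps l G)
  have hmem : ∀ v, v ∈ U ↔ ∀ H ∈ T, ∀ G ∈ S, Ω.res H (Ω.eigProj eps l G v) = 0 := by
    intro v
    simp [U, Submodule.mem_iInf]
  have hres : ∀ v ∈ U, ∀ H ∈ T, Ω.res H v = 0 := by
    intro v hv H hH
    rw [← h.sum_eigProj heps hS v, map_sum]
    exact Finset.sum_eq_zero fun G _ => (hmem v).1 hv H hH G.1 G.2
  have hU : U = ⊥ ∨ U = ⊤ := by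
    refine hirr.2 U ?_ ?_ ?_
    · intro v hv
      rw [Submodule.mem_comap, hmem]
      intro H hH G hG
      rw [h.eigProj_comp heps hS (fun G v hv => (mem_eigSpace_iff.1 hv).1) (hS G hG), map_smul,
        (hmem v).1 hv H hH G hG, smul_zero]
    · intro j hj v hv
      rw [Submodule.mem_comap, hmem]
      intro H hH G hG
      rw [h.eigProj_comp heps hS (fun G v hv => (mem_eigSpace_iff.1 hv).2 j hj) (hS G hG),
        map_smul, (hmem v).1 hv H hH G hG, smul_zero]
    · intro H hd
      by_cases hH : H ∈ T
      · intro v hv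
        rw [Submodule.mem_comap, hres v hv H hH]
        exact U.zero_mem
      · exact res_comap_of_notMem h.toTame hd hH U
  have hvU : v ∈ U := (hmem v).2 hv
  rcases hU with hU | hU
  · rwa [hU, Submodule.mem_bot] at hvU
  · obtain ⟨H, hH, hne⟩ := hpole
    refine absurd (LinearMap.ext fun u => ?_) hne
    exact hres u (hU ▸ Submodule.mem_top) H hH

theorem exists_resSum_ne_zero (hpole : Ω.HasPole T) : ∃ w : T → V, Ω.resSum T w ≠ 0 := by
  obtain ⟨H, hH, hne⟩ := hpole
  obtain ⟨v, hv⟩ := DFunLike.ne_iff.1 hne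
  refine ⟨Pi.single ⟨H, hH⟩ v, ?_⟩
  rw [resSum_single]
  exact hv

/-- The preimage `U` in `V^T` of an invariant subspace of the transform is a direct sum of blocks. By
irreducibility, the space of the `v` for which `U` contains the diagonal images of all `E_G v` is `0`
or `V`. It contains `A_H w_H` for `w ∈ U`, so that `U ⊆ 𝒦` in the first case; in the second one,
`U = V^T`. -/
theorem Adapted.middleLaplace_irreducible (h : Ω.Adapted eps l T S)
    (he : eps * eps = 1) (hT : ∀ H ∈ T, H.DependsOn l) (hS : ∀ G ∈ S, G.DependsOn l)
    (hirr : Ω.Irreducible l) (hpole : Ω.HasPole T) : (Ω.middleLaplace eps l T).Irreducible l := by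
  have heps : eps ≠ 0 := left_ne_zero_of_mul_eq_one he
  have hmk := (h.kerInvariant he hT hS).intertwines
  constructor
  · obtain ⟨w, hw⟩ := exists_resSum_ne_zero hpole
    exact ⟨(Ω.kerSum T).mkQ w, 0, fun h0 =>
      hw (resSum_eq_zero ((Submodule.Quotient.mk_eq_zero _).1 h0))⟩
  intro U' hUc hUl hUr
  let U : Submodule ℂ (T → V) := U'.comap (Ω.kerSum T).mkQ
  have hK : Ω.kerSum T ≤ U := by
    intro w hw
    rw [Submodule.mem_comap, Submodule.mkQ_apply, (Submodule.Quotient.mk_eq_zero _).2 hw]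
    exact U'.zero_mem
  have hc : U ≤ U.comap ((Ω.laplace eps l T).const l) := by
    intro w hw
    rw [Submodule.mem_comap, Submodule.mem_comap, hmk.const]
    exact hUc hw
  have hl : ∀ j, j ≠ l → U ≤ U.comap ((Ω.laplace eps l T).lin l j) := by
    intro j hj w hw
    rw [Submodule.mem_comap, Submodule.mem_comap, hmk.lin]
    exact hUl j hj hw
  have hr : ∀ G ∈ S, ∀ w ∈ U, constMap T V (Ω.eigProj eps l G (Ω.resSum T w)) ∈ U := by
    intro G hG w hw
    have : (Ω.laplace eps l T).res G w ∈ U := by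
      rw [Submodule.mem_comap, hmk.res]
      exact hUr G (hS G hG) hw
    rw [laplace_res_apply (hS G hG), map_neg] at this
    exact U.neg_mem_iff.1 this
  -- `U` is the direct sum of its blocks
  have hblock : ∀ w ∈ U, ∀ H : T, (Pi.single H (w H) : T → V) ∈ U := by
    obtain ⟨p, hp⟩ := (Hyperplane.eventually_injective_aFun hT).exists
    intro w hw
    refine mem_of_sum_eigenvectors_mem (polyPart_mem hc hl p)
      (a := fun H : T => -eps * H.1.aFun l p) ?_
      (fun H => polyPart_apply_of_mem (single_mem_eigSpace_laplace H (w H)) p) ?_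
    · intro H H' hH
      exact hp (mul_left_cancel₀ (neg_ne_zero.2 heps) hH)
    · rwa [Finset.univ_sum_single]
  let X : Submodule ℂ V := ⨅ G ∈ S, U.comap (constMap T V ∘ₗ Ω.eigProj eps l G)
  have hmem : ∀ v, v ∈ X ↔ ∀ G ∈ S, constMap T V (Ω.eigProj eps l G v) ∈ U := by
    intro v
    simp [X, Submodule.mem_iInf]
  have hconst : ∀ v ∈ X, constMap T V v ∈ U := by
    intro v hv
    rw [← h.sum_eigProj heps hS v, map_sum]
    exact U.sum_mem fun G _ => (hmem v).1 hv G.1 G.2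
  have hX : X = ⊥ ∨ X = ⊤ := by
    refine hirr.2 X ?_ ?_ ?_
    · intro v hv
      rw [Submodule.mem_comap, hmem]
      intro G hG
      rw [h.eigProj_comp heps hS (fun G v hv => (mem_eigSpace_iff.1 hv).1) (hS G hG), map_smul]
      exact U.smul_mem _ ((hmem v).1 hv G hG)
    · intro j hj v hv
      rw [Submodule.mem_comap, hmem]
      intro G hG
      rw [h.eigProj_comp heps hS (fun G v hv => (mem_eigSpace_iff.1 hv).2 j hj) (hS G hG),
        map_smul]
      exact U.smul_mem _ ((hmem v).1 hv G hG)
    · intro H hd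
      by_cases hH : H ∈ T
      · intro v hv
        rw [Submodule.mem_comap, hmem]
        intro G hG
        have := hr G hG _ (hblock _ (hconst v hv) ⟨H, hH⟩)
        rwa [resSum_single, constMap_apply] at this
      · exact res_comap_of_notMem h.toTame hd hH X
  rcases hX with hX | hX
  · left
    rw [eq_bot_iff]
    intro q hq
    obtain ⟨w, rfl⟩ := Submodule.mkQ_surjective _ q
    rw [Submodule.mem_bot, Submodule.mkQ_apply, Submodule.Quotient.mk_eq_zero, mem_kerSum]
    intro H
    have : Ω.res H.1 (w H) ∈ X := by
      rw [hmem]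
      intro G hG
      have := hr G hG _ (hblock w hq H)
      rwa [resSum_single] at this
    rwa [hX, Submodule.mem_bot] at this
  · right
    rw [eq_top_iff]
    intro q _
    obtain ⟨w, rfl⟩ := Submodule.mkQ_surjective _ q
    have : w ∈ U := by
      rw [← Finset.univ_sum_single w]
      refine U.sum_mem fun H _ => ?_
      exact hblock _ (hconst (w H) (hX ▸ Submodule.mem_top)) H
    exact this

theorem Adapted.middleLaplace_hasPole (h : Ω.Adapted eps l T S)
    (he : eps * eps = 1) (hT : ∀ H ∈ T, H.DependsOn l) (hS : ∀ G ∈ S, G.DependsOn l)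
    (hirr : Ω.Irreducible l) (hpole : Ω.HasPole T) : (Ω.middleLaplace eps l T).HasPole S := by
  have heps : eps ≠ 0 := left_ne_zero_of_mul_eq_one he
  have hmk := (h.kerInvariant he hT hS).intertwines
  by_contra hno
  obtain ⟨w, hw⟩ := exists_resSum_ne_zero hpole
  refine hw (h.eq_zero_of_res_eigProj heps hS hirr hpole fun H hH G hG => ?_)
  have h0 : (Ω.middleLaplace eps l T).res G = 0 := by
    by_contra hne
    exact hno ⟨G, hG, hne⟩
  have h1 := hmk.res G w
  rw [h0, LinearMap.zero_apply, laplace_res_apply (hS G hG), Submodule.mkQ_apply,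
    Submodule.Quotient.mk_eq_zero, mem_kerSum] at h1
  have := h1 ⟨H, hH⟩
  rwa [constMap_apply, map_neg, neg_eq_zero] at this

/-- The map `V^T / 𝒦 → V` induced by `v ↦ ∑_H A_H v_H`. -/
def resSumQ (T : Finset (Hyperplane n)) (Ω : System n V) : Ω.MLSpace T →ₗ[ℂ] V :=
  (Ω.kerSum T).liftQ (Ω.resSum T) fun _ hw => resSum_eq_zero hw

@[simp]
theorem resSumQ_mkQ (w : T → V) : Ω.resSumQ T ((Ω.kerSum T).mkQ w) = Ω.resSum T w := rfl

/-- The map `(w_G)_G ↦ ∑_G E_G ∑_H A_H (w_G)_H`, from which the isomorphism of the inverse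
transform of the transform with the original system arises. -/
def inversionMap (eps : ℂ) (l : Fin n) (T S : Finset (Hyperplane n)) (Ω : System n V) :
    (S → Ω.MLSpace T) →ₗ[ℂ] V :=
  ∑ G : S, Ω.eigProj eps l G.1 ∘ₗ Ω.resSumQ T ∘ₗ LinearMap.proj G

theorem inversionMap_apply (w : S → Ω.MLSpace T) : Ω.inversionMap eps l T S w =
    ∑ G : S, Ω.eigProj eps l G.1 (Ω.resSumQ T (w G)) := by
  simp [inversionMap, LinearMap.sum_apply]

theorem Intertwines.slice {W : Type v} [AddCommGroup W] [Module ℂ W] {Ω' : System n W}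
    {Φ : V →ₗ[ℂ] W} (h : Intertwines Φ Ω Ω') (hfin : {H | Ω.res H ≠ 0}.Finite)
    (hfin' : {H | Ω'.res H ≠ 0}.Finite) (i : Fin n) (x : Fin n → ℂ) (v : V) :
    Φ (Ω.slice l i x v) = Ω'.slice l i x (Φ v) := by
  have e1 : (∑ᶠ G : Hyperplane n, if G.DependsOn l then 0 else (G.coeff i / G.poly x) • Ω.res G) =
      ∑ G ∈ hfin.toFinset ∪ hfin'.toFinset,
        if G.DependsOn l then 0 else (G.coeff i / G.poly x) • Ω.res G :=
    finsum_eq_sum_of_support_subset _ fun H hH => by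
      rw [Finset.mem_coe, Finset.mem_union, Set.Finite.mem_toFinset]
      exact Or.inl fun h0 => hH (by simp [h0])
  have e2 : (∑ᶠ G : Hyperplane n, if G.DependsOn l then 0 else
      (G.coeff i / G.poly x) • Ω'.res G) =
      ∑ G ∈ hfin.toFinset ∪ hfin'.toFinset,
        if G.DependsOn l then 0 else (G.coeff i / G.poly x) • Ω'.res G :=
    finsum_eq_sum_of_support_subset _ fun H hH => by
      rw [Finset.mem_coe, Finset.mem_union, Set.Finite.mem_toFinset, Set.Finite.mem_toFinset]
      exact Or.inr fun h0 => hH (by simp [h0])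
  rw [System.slice, System.slice, e1, e2]
  simp only [LinearMap.add_apply, LinearMap.sum_apply, map_add, map_sum, LinearMap.smul_apply,
    map_smul, h.const, h.lin]
  congr 1
  refine Finset.sum_congr rfl fun G _ => ?_
  split_ifs
  · simp
  · rw [LinearMap.smul_apply, LinearMap.smul_apply, map_smul, h.res]

theorem Adapted.middleLaplace_eigProj [FiniteDimensional ℂ V] (h : Ω.Adapted eps l T S)
    (he : eps * eps = 1) (hT : ∀ H ∈ T, H.DependsOn l) (hS : ∀ G ∈ S, G.DependsOn l)
    (hTS : ¬ (Hyperplane.HasMixed l T ∧ Hyperplane.HasMixed l S)) (H : T) (w : T → V) :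
    (Ω.middleLaplace eps l T).eigProj (-eps) l H.1 ((Ω.kerSum T).mkQ w) =
      (Ω.kerSum T).mkQ (Pi.single H (w H)) := by
  have heps : -eps ≠ 0 := neg_ne_zero.2 (left_ne_zero_of_mul_eq_one he)
  have hL := h.laplace he hT hS hTS
  rw [← (h.kerInvariant he hT hS).intertwines.eigProj hL (h.middleLaplace he hT hS hTS) heps hT
    (hT _ H.2)]
  congr 1
  conv_lhs => rw [← Finset.univ_sum_single w]
  rw [map_sum, Finset.sum_eq_single H]
  · exact hL.eigProj_apply_self heps hT (hT _ H.2) (single_mem_eigSpace_laplace H _)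
  · intro H' _ hne
    exact hL.eigProj_apply_of_ne heps hT (hT _ H.2) (hT _ H'.2)
      (fun h' => hne (Subtype.ext h')) (single_mem_eigSpace_laplace H' _)
  · simp

theorem Adapted.middleLaplace_resolvent [FiniteDimensional ℂ V] (h : Ω.Adapted eps l T S)
    (he : eps * eps = 1) (hT : ∀ H ∈ T, H.DependsOn l) (hS : ∀ G ∈ S, G.DependsOn l)
    (hTS : ¬ (Hyperplane.HasMixed l T ∧ Hyperplane.HasMixed l S)) (p : Fin n → ℂ) (t : ℂ)
    (w : T → V) :
    (Ω.middleLaplace eps l T).resolvent (-eps) l T p t ((Ω.kerSum T).mkQ w) =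
      (Ω.kerSum T).mkQ (diagOp V (fun H : T => 1 / (t - H.1.aFun l p)) w) := by
  rw [resolvent, LinearMap.sum_apply,
    ← Finset.univ_sum_single (diagOp V (fun H : T => 1 / (t - H.1.aFun l p)) w), map_sum]
  refine Finset.sum_congr rfl fun H _ => ?_
  rw [LinearMap.smul_apply, h.middleLaplace_eigProj he hT hS hTS, ← map_smul, diagOp_apply,
    Pi.single_smul]

theorem Adapted.middleLaplace_res_apply (h : Ω.Adapted eps l T S) (he : eps * eps = 1)
    (hT : ∀ H ∈ T, H.DependsOn l) (hS : ∀ G ∈ S, G.DependsOn l) (G : S) (q : Ω.MLSpace T) :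
    (Ω.middleLaplace eps l T).res G.1 q =
      -(Ω.kerSum T).mkQ (constMap T V (Ω.eigProj eps l G.1 (Ω.resSumQ T q))) := by
  obtain ⟨w, rfl⟩ := Submodule.mkQ_surjective _ q
  rw [← (h.kerInvariant he hT hS).intertwines.res, laplace_res_apply (hS _ G.2), map_neg, map_neg,
    resSumQ_mkQ]

theorem Adapted.resSum_middleLaplace (h : Ω.Adapted eps l T S) (he : eps * eps = 1)
    (hT : ∀ H ∈ T, H.DependsOn l) (hS : ∀ G ∈ S, G.DependsOn l) (w : S → Ω.MLSpace T) :
    (Ω.middleLaplace eps l T).resSum S w =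
      -(Ω.kerSum T).mkQ (constMap T V (Ω.inversionMap eps l T S w)) := by
  rw [resSum_apply, inversionMap_apply, map_sum, map_sum, ← Finset.sum_neg_distrib]
  exact Finset.sum_congr rfl fun G _ => h.middleLaplace_res_apply he hT hS G (w G)

theorem Adapted.inversionMap_const (h : Ω.Adapted eps l T S) (heps : eps ≠ 0)
    (hS : ∀ G ∈ S, G.DependsOn l) (q : Ω.MLSpace T) :
    Ω.inversionMap eps l T S (constMap S _ q) = Ω.resSumQ T q := by
  rw [inversionMap_apply]
  simp only [constMap_apply]
  exact h.sum_eigProj heps hS (Ω.resSumQ T q)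

/-- Under the inversion map, an endomorphism that acts on the joint eigenspaces by `ε c_G`
corresponds to multiplication by `ε c_G` on the copies that belong to the `G ∈ S`. -/
theorem Adapted.apply_inversionMap (h : Ω.Adapted eps l T S) (heps : eps ≠ 0)
    (hS : ∀ G ∈ S, G.DependsOn l) {f : Module.End ℂ V} {c : Hyperplane n → ℂ}
    (hf : ∀ G, ∀ v ∈ Ω.eigSpace eps l G, f v = (eps * c G) • v) (w : S → Ω.MLSpace T) :
    f (Ω.inversionMap eps l T S w) =
      eps • Ω.inversionMap eps l T S (diagOp _ (fun G : S => c G.1) w) := by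
  rw [inversionMap_apply, inversionMap_apply, map_sum, Finset.smul_sum]
  refine Finset.sum_congr rfl fun G _ => ?_
  rw [hf _ _ (h.eigProj_mem heps hS (hS _ G.2) _), diagOp_apply, map_smul, map_smul, smul_smul]

/-- The inversion map intertwines the parts of the coefficients in the directions `xᵢ ≠ x` that do
not involve `x`. The difference of the two sides intertwines the diagonal map with entries `ε a_G`
and the polynomial part in the direction of `x`, and it vanishes on the diagonal. -/
theorem Adapted.inversionMap_slice [FiniteDimensional ℂ V] (h : Ω.Adapted eps l T S)
    (he : eps * eps = 1) (hT : ∀ H ∈ T, H.DependsOn l) (hS : ∀ G ∈ S, G.DependsOn l)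
    (hTS : ¬ (Hyperplane.HasMixed l T ∧ Hyperplane.HasMixed l S)) {i : Fin n} (hi : i ≠ l) :
    ∀ᶠ x in generic n, ∀ w : S → Ω.MLSpace T,
      Ω.inversionMap eps l T S
        (((Ω.middleLaplace eps l T).laplace (-eps) l S).slice l i x w) =
      Ω.slice l i x (Ω.inversionMap eps l T S w) := by
  have heps : eps ≠ 0 := left_ne_zero_of_mul_eq_one he
  have hM := h.middleLaplace he hT hS hTS
  have hmk := (h.kerInvariant he hT hS).intertwines
  filter_upwards [h.dualDatum hT eps, hM.dualDatum hS (-eps),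
    Hyperplane.eventually_injective_aFun hS] with x hx hx' hinj
  have hSΦ := h.apply_inversionMap heps hS
    (fun G v (hv : v ∈ Ω.eigSpace eps l G) => polyPart_apply_of_mem hv x)
  have hdSΦ := h.apply_inversionMap heps hS
    (fun G v (hv : v ∈ Ω.eigSpace eps l G) => (mem_eigSpace_iff.1 hv).2 i hi)
  have hP := h.resSum_middleLaplace he hT hS
  have hconst := h.inversionMap_const heps hS
  have hY := eq_zero_of_intertwines_diagOp (V := Ω.MLSpace T)
    (f := Ω.inversionMap eps l T S ∘ₗ
      ((Ω.middleLaplace eps l T).laplace (-eps) l S).slice l i x -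
      Ω.slice l i x ∘ₗ Ω.inversionMap eps l T S) (B := Ω.polyPart l x)
    (a := fun G : S => eps * G.1.aFun l x) (fun G G' hG => hinj (mul_left_cancel₀ heps hG))
    (fun w => ?_) (fun q => ?_)
  · intro w
    exact sub_eq_zero.1 (LinearMap.congr_fun hY w)
  · have hdiag : diagOp (Ω.MLSpace T) (fun G : S => eps * G.1.aFun l x) w =
        eps • diagOp _ (fun G : S => G.1.aFun l x) w :=
      funext fun G => by rw [diagOp_apply, Pi.smul_apply, diagOp_apply, mul_smul]
    have e1 := congrArg (Ω.inversionMap eps l T S) (hx'.D_M ⟨i, hi⟩ w)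
    have e2 := hx.S_N ⟨i, hi⟩ (Ω.inversionMap eps l T S w)
    simp only [hP, map_add, map_sub, map_neg, map_zero] at e1
    have e3 := congrArg (fun u => eps • u) e1
    simp only [smul_add, smul_sub, smul_neg, smul_zero, ← hSΦ] at e3
    have e4 : eps • Ω.inversionMap eps l T S (diagOp _ (fun G : S => G.1.aCoeff l i)
        (constMap S _ ((Ω.kerSum T).mkQ (constMap T V (Ω.inversionMap eps l T S w))))) =
        Ω.lin l i (Ω.resSum T (constMap T V (Ω.inversionMap eps l T S w))) := by
      rw [← hdSΦ, hconst, resSumQ_mkQ]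
    have e5 : eps • Ω.inversionMap eps l T S (constMap S _ ((Ω.kerSum T).mkQ (constMap T V
        (Ω.inversionMap eps l T S (diagOp _ (fun G : S => G.1.aCoeff l i) w))))) =
        Ω.resSum T (constMap T V (Ω.lin l i (Ω.inversionMap eps l T S w))) := by
      rw [hconst, resSumQ_mkQ, hdSΦ, map_smul, map_smul]
    rw [e4, e5] at e3
    simp only [LinearMap.sub_apply, LinearMap.comp_apply, hdiag, map_sub, map_smul]
    have e6 := congrArg (Ω.slice l i x) (hSΦ w)
    rw [map_smul] at e6
    linear_combination (norm := module) e3 - e2 - e6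
  · obtain ⟨u, rfl⟩ := Submodule.mkQ_surjective _ q
    have e1 := congrArg (Ω.inversionMap eps l T S) (hx'.M_Q ⟨i, hi⟩ ((Ω.kerSum T).mkQ u))
    have e2 := hx.P_M ⟨i, hi⟩ u
    have hD : (Ω.middleLaplace eps l T).polyPart l x ((Ω.kerSum T).mkQ u) =
        -eps • (Ω.kerSum T).mkQ (diagOp V (fun H : T => H.1.aFun l x) u) := by
      rw [← hmk.polyPart, laplace_polyPart, LinearMap.smul_apply, map_smul]
    have hdD : (Ω.middleLaplace eps l T).lin l i ((Ω.kerSum T).mkQ u) =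
        -eps • (Ω.kerSum T).mkQ (diagOp V (fun H : T => H.1.aCoeff l i) u) := by
      rw [← hmk.lin, laplace_lin_self hi, ← map_smul]
      congr 1
      exact funext fun H => mul_smul _ _ _
    have hM' : (Ω.middleLaplace eps l T).slice l i x ((Ω.kerSum T).mkQ u) =
        (Ω.kerSum T).mkQ ((Ω.laplace eps l T).slice l i x u) :=
      (hmk.slice (h.laplace_finite heps hS) hM.finite i x u).symm
    simp only [hD, hdD, hM', map_add, hconst, resSumQ_mkQ, map_smul] at e1
    have e3 : -eps • Ω.inversionMap eps l T S (diagOp _ (fun G : S => G.1.aCoeff l i)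
        (constMap S _ ((Ω.kerSum T).mkQ (diagOp V (fun H : T => H.1.aFun l x) u)))) =
        -Ω.lin l i (Ω.resSum T (diagOp V (fun H : T => H.1.aFun l x) u)) := by
      rw [neg_smul, ← hdSΦ, hconst, resSumQ_mkQ]
    have e4 : -eps • Ω.inversionMap eps l T S (diagOp _ (fun G : S => G.1.aFun l x)
        (constMap S _ ((Ω.kerSum T).mkQ (diagOp V (fun H : T => H.1.aCoeff l i) u)))) =
        -Ω.polyPart l x (Ω.resSum T (diagOp V (fun H : T => H.1.aCoeff l i) u)) := by
      rw [neg_smul, ← hSΦ, hconst, resSumQ_mkQ]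
    rw [e3, e4] at e1
    simp only [LinearMap.sub_apply, LinearMap.comp_apply, hconst, resSumQ_mkQ]
    rw [sub_eq_zero, e1]
    linear_combination (norm := module) e2

/-- The inversion map is a morphism of systems. -/
theorem Adapted.inversionMap_intertwines [FiniteDimensional ℂ V] (h : Ω.Adapted eps l T S)
    (he : eps * eps = 1) (hT : ∀ H ∈ T, H.DependsOn l) (hS : ∀ G ∈ S, G.DependsOn l)
    (hTS : ¬ (Hyperplane.HasMixed l T ∧ Hyperplane.HasMixed l S)) :
    Intertwines (Ω.inversionMap eps l T S) ((Ω.middleLaplace eps l T).laplace (-eps) l S) Ω := by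
  have heps : eps ≠ 0 := left_ne_zero_of_mul_eq_one he
  have he' : -eps * -eps = 1 := by rw [neg_mul_neg, he]
  have hM := h.middleLaplace he hT hS hTS
  have hmk := (h.kerInvariant he hT hS).intertwines
  have hP := h.resSum_middleLaplace he hT hS
  have hconst := h.inversionMap_const heps hS
  have hres := h.middleLaplace_resolvent he hT hS hTS
  refine Intertwines.of_eval (hM.laplace_finite (neg_ne_zero.2 heps) hT) h.finite
    (fun i => if_pos rfl) h.lin_self fun i => ?_
  by_cases hi : i = l
  · subst hi
    refine Eventually.of_forall fun x w => ?_
    rw [hM.eval_laplace_self (neg_ne_zero.2 heps) hT, hP, neg_neg, map_neg, hres, map_sub, map_neg,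
      map_neg, hconst, resSumQ_mkQ, eval_self_eq_comp h.finite h.res_mem hT, LinearMap.add_apply,
      h.apply_inversionMap heps hS
        (fun G v (hv : v ∈ Ω.eigSpace eps i G) => polyPart_apply_of_mem hv x), map_smul,
      sub_neg_eq_add]
    rfl
  · filter_upwards [h.inversionMap_slice he hT hS hTS hi] with x hx w
    have hdD : ∀ u, (Ω.middleLaplace eps l T).lin l i ((Ω.kerSum T).mkQ u) =
        -eps • (Ω.kerSum T).mkQ (diagOp V (fun H : T => H.1.aCoeff l i) u) := by
      intro u
      rw [← hmk.lin, laplace_lin_self hi, ← map_smul]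
      congr 1
      exact funext fun H => mul_smul _ _ _
    rw [hM.eval_laplace_of_ne he' hT hi, hP, neg_neg, map_neg, hres, map_neg, hdD, map_add,
      map_add, hx, hconst, eval_of_ne_eq_comp h.finite h.lin_symm h.res_mem hT hi, map_smul,
      map_smul, LinearMap.sub_apply, LinearMap.add_apply, LinearMap.smul_apply,
      h.apply_inversionMap heps hS
        (fun G v (hv : v ∈ Ω.eigSpace eps l G) => (mem_eigSpace_iff.1 hv).2 i hi), sub_eq_add_neg]
    congr 1
    rw [map_smul, map_neg, map_smul, resSumQ_mkQ, smul_neg, smul_smul, he', one_smul]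
    rfl

/-- Both spaces consist of the `w` with `A_H E_G ∑ A_{H'} (w_G)_{H'} = 0` for all `H` and `G`, which
for an irreducible system means `E_G ∑ A_{H'} (w_G)_{H'} = 0`. -/
theorem Adapted.ker_inversionMap (h : Ω.Adapted eps l T S)
    (he : eps * eps = 1) (hT : ∀ H ∈ T, H.DependsOn l) (hS : ∀ G ∈ S, G.DependsOn l)
    (hirr : Ω.Irreducible l) (hpole : Ω.HasPole T) :
    LinearMap.ker (Ω.inversionMap eps l T S) = (Ω.middleLaplace eps l T).kerSum S := by
  have heps : eps ≠ 0 := left_ne_zero_of_mul_eq_one he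
  have hproj : ∀ (G G' : Hyperplane n), G ∈ S → G' ∈ S → ∀ v,
      Ω.eigProj eps l G (Ω.eigProj eps l G' v) = if G = G' then Ω.eigProj eps l G v else 0 := by
    intro G G' hG hG' v
    split_ifs with hGG
    · rw [← hGG]
      exact h.eigProj_apply_self heps hS (hS G hG) (h.eigProj_mem heps hS (hS G hG) v)
    · exact h.eigProj_apply_of_ne heps hS (hS G hG) (hS G' hG') (Ne.symm hGG)
        (h.eigProj_mem heps hS (hS G' hG') v)
  have h1 : ∀ w, w ∈ LinearMap.ker (Ω.inversionMap eps l T S) ↔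
      ∀ G : S, Ω.eigProj eps l G.1 (Ω.resSumQ T (w G)) = 0 := by
    intro w
    rw [LinearMap.mem_ker, inversionMap_apply]
    refine ⟨fun h0 G => ?_, fun h0 => Finset.sum_eq_zero fun G _ => h0 G⟩
    have := congrArg (Ω.eigProj eps l G.1) h0
    rw [map_sum, map_zero, Finset.sum_eq_single G] at this
    · rwa [hproj _ _ G.2 G.2, if_pos rfl] at this
    · intro G' _ hne
      rw [hproj _ _ G.2 G'.2, if_neg fun hGG => hne (Subtype.ext hGG.symm)]
    · simp
  ext w
  rw [h1, mem_kerSum]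
  refine forall_congr' fun G => ?_
  rw [h.middleLaplace_res_apply he hT hS, neg_eq_zero, Submodule.mkQ_apply,
    Submodule.Quotient.mk_eq_zero, mem_kerSum]
  refine ⟨fun h0 H => by rw [h0, map_zero]; exact map_zero _, fun h0 => ?_⟩
  refine h.eq_zero_of_res_eigProj heps hS hirr hpole fun H hH G' hG' => ?_
  rw [hproj _ _ hG' G.2]
  split_ifs with hGG
  · rw [hGG]
    exact h0 ⟨H, hH⟩
  · exact map_zero _

/-- The inverse middle Laplace transform undoes the middle Laplace transform of an irreducible
system: the inversion map has kernel `𝒦`, and its image is invariant. -/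
theorem Adapted.middleLaplace_middleLaplace [FiniteDimensional ℂ V] (h : Ω.Adapted eps l T S)
    (he : eps * eps = 1) (hT : ∀ H ∈ T, H.DependsOn l) (hS : ∀ G ∈ S, G.DependsOn l)
    (hTS : ¬ (Hyperplane.HasMixed l T ∧ Hyperplane.HasMixed l S))
    (hirr : Ω.Irreducible l) (hpole : Ω.HasPole T) :
    ((Ω.middleLaplace eps l T).middleLaplace (-eps) l S).GaugeEquiv Ω := by
  have heps : eps ≠ 0 := left_ne_zero_of_mul_eq_one he
  have he' : -eps * -eps = 1 := by rw [neg_mul_neg, he]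
  have hM := h.middleLaplace he hT hS hTS
  have hΦ := h.inversionMap_intertwines he hT hS hTS
  have hmk := (hM.kerInvariant he' hS hT).intertwines
  have hker := h.ker_inversionMap he hT hS hirr hpole
  have hrange : LinearMap.range (Ω.inversionMap eps l T S) = ⊤ := by
    refine (hirr.2 _ ?_ ?_ ?_).resolve_left ?_
    · rintro _ ⟨w, rfl⟩
      exact ⟨_, hΦ.const l w⟩
    · rintro j - _ ⟨w, rfl⟩
      exact ⟨_, hΦ.lin l j w⟩
    · rintro H - _ ⟨w, rfl⟩
      exact ⟨_, hΦ.res H w⟩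
    · intro hbot
      obtain ⟨w, hw⟩ := exists_resSum_ne_zero hpole
      have : Ω.resSum T w ∈ LinearMap.range (Ω.inversionMap eps l T S) :=
        ⟨_, h.inversionMap_const heps hS ((Ω.kerSum T).mkQ w)⟩
      rw [hbot, Submodule.mem_bot] at this
      exact hw this
  let Ψ : (Ω.middleLaplace eps l T).MLSpace S →ₗ[ℂ] V :=
    Submodule.liftQ _ (Ω.inversionMap eps l T S) hker.ge
  have hΨ : ∀ w, Ψ (Submodule.mkQ _ w) = Ω.inversionMap eps l T S w := fun w => rfl
  have hinj : Function.Injective Ψ := by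
    rw [← LinearMap.ker_eq_bot]
    exact Submodule.ker_liftQ_eq_bot _ _ _ hker.le
  have hsurj : Function.Surjective Ψ := by
    intro v
    obtain ⟨w, hw⟩ := LinearMap.range_eq_top.1 hrange v
    exact ⟨Submodule.mkQ _ w, hw⟩
  have hbij : Function.Bijective Ψ := ⟨hinj, hsurj⟩
  refine Intertwines.gaugeEquiv (P := LinearEquiv.ofBijective Ψ hbij) ⟨?_, ?_, ?_⟩
  · intro i q
    obtain ⟨w, rfl⟩ := Submodule.mkQ_surjective _ q
    change Ψ _ = Ω.const i (Ψ _)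
    rw [← hmk.const, hΨ, hΨ, hΦ.const]
  · intro i j q
    obtain ⟨w, rfl⟩ := Submodule.mkQ_surjective _ q
    change Ψ _ = Ω.lin i j (Ψ _)
    rw [← hmk.lin, hΨ, hΨ, hΦ.lin]
  · intro H q
    obtain ⟨w, rfl⟩ := Submodule.mkQ_surjective _ q
    change Ψ _ = Ω.res H (Ψ _)
    rw [← hmk.res, hΨ, hΨ, hΦ.res]

end Inversion

/-! ### Gauge invariance -/

section GaugeInvariance

variable {n : ℕ} {V : Type u} [AddCommGroup V] [Module ℂ V] {W : Type v} [AddCommGroup W]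
  [Module ℂ W] {eps : ℂ} {l : Fin n} {T S : Finset (Hyperplane n)} {Ω : System n V}
  {Ω' : System n W}

theorem GaugeEquiv.hasPole (h : Ω.GaugeEquiv Ω') (hp : Ω.HasPole T) : Ω'.HasPole T := by
  obtain ⟨P, hP⟩ := h.exists_intertwines
  obtain ⟨H, hH, hne⟩ := hp
  refine ⟨H, hH, fun h0 => hne (LinearMap.ext fun v => P.injective ?_)⟩
  have := hP.res H v
  rwa [h0, LinearMap.zero_apply, LinearEquiv.coe_coe, ← P.map_zero] at this

theorem GaugeEquiv.irreducible (h : Ω.GaugeEquiv Ω') (hi : Ω.Irreducible l) :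
    Ω'.Irreducible l := by
  obtain ⟨P, hP⟩ := h.exists_intertwines
  have := hi.1
  refine ⟨P.symm.toEquiv.nontrivial, fun U hc hl hr => ?_⟩
  have hU : ∀ {f : Module.End ℂ V} {g : Module.End ℂ W}, (∀ v, P (f v) = g (P v)) →
      U ≤ U.comap g → U.comap P.toLinearMap ≤ (U.comap P.toLinearMap).comap f := by
    intro f g hfg hg v hv
    have := hg (Submodule.mem_comap.1 hv)
    rw [Submodule.mem_comap] at this
    rw [Submodule.mem_comap, Submodule.mem_comap, LinearEquiv.coe_coe, hfg]
    exact this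
  have hback : (U.comap P.toLinearMap).map P.toLinearMap = U :=
    Submodule.map_comap_eq_of_surjective P.surjective U
  rcases hi.2 (U.comap P.toLinearMap) (hU (hP.const l) hc)
    (fun j hj => hU (hP.lin l j) (hl j hj)) (fun H hH => hU (hP.res H) (hr H hH)) with h0 | h0
  · left
    rw [← hback, h0, Submodule.map_bot]
  · right
    rw [← hback, h0, Submodule.map_top, LinearMap.range_eq_top.2 P.surjective]

theorem GaugeEquiv.addition (h : Ω.GaugeEquiv Ω') (α : S → ℂ) :
    (Ω.addition S α).GaugeEquiv (Ω'.addition S α) := by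
  obtain ⟨P, hP⟩ := h.exists_intertwines
  exact (hP.addition α).gaugeEquiv

theorem Irreducible.addition (h : Ω.Irreducible l) (α : S → ℂ) :
    (Ω.addition S α).Irreducible l := by
  refine ⟨h.1, fun U hc hl hr => h.2 U hc hl fun H hH v hv => ?_⟩
  have h1 := hr H hH hv
  rw [Submodule.mem_comap, System.addition, LinearMap.add_apply] at h1
  refine (U.add_mem_iff_left ?_).1 h1
  split_ifs
  · exact U.smul_mem _ hv
  · exact U.zero_mem

/-- The Laplace transform is functorial. -/
theorem Intertwines.laplace {Φ : V →ₗ[ℂ] W} (hΦ : Intertwines Φ Ω Ω')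
    (h : Ω.Adapted eps l T S) (h' : Ω'.Adapted eps l T S) (heps : eps ≠ 0)
    (hS : ∀ G ∈ S, G.DependsOn l) :
    Intertwines (Φ.compLeft T) (Ω.laplace eps l T) (Ω'.laplace eps l T) where
  const i w := by
    ext H
    by_cases hi : i = l
    · simp [System.laplace, hi, blockDiag]
    · simp [System.laplace, hi, blockDiag, hΦ.const, hΦ.lin]
  lin i j w := by
    ext H
    simp only [System.laplace]
    split_ifs <;> simp [blockDiag, hΦ.lin]
  res G w := by
    ext H
    by_cases hG : G.DependsOn l
    · rw [laplace_res_apply hG, laplace_res_apply hG]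
      change Φ (-Ω.eigProj eps l G (Ω.resSum T w)) = -Ω'.eigProj eps l G (Ω'.resSum T _)
      rw [map_neg, hΦ.eigProj h h' heps hS hG, resSum_apply, resSum_apply, map_sum]
      simp [hΦ.res]
    · simp only [System.laplace, if_neg hG, LinearMap.compLeft_apply, Function.comp_apply,
        LinearMap.pi_apply, LinearMap.add_apply, LinearMap.comp_apply, LinearMap.proj_apply,
        LinearMap.sum_apply, map_add, map_sum, hΦ.res]
      congr 1
      refine Finset.sum_congr rfl fun H' _ => ?_
      split_ifs <;> simp [hΦ.res]

theorem GaugeEquiv.middleLaplace [FiniteDimensional ℂ V] [FiniteDimensional ℂ W]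
    (hg : Ω.GaugeEquiv Ω') (h : Ω.Adapted eps l T S) (he : eps * eps = 1)
    (hT : ∀ H ∈ T, H.DependsOn l) (hS : ∀ G ∈ S, G.DependsOn l) :
    (Ω.middleLaplace eps l T).GaugeEquiv (Ω'.middleLaplace eps l T) := by
  have h' := h.of_gaugeEquiv hg
  obtain ⟨P, hP⟩ := hg.exists_intertwines
  have hL := hP.laplace h h' (left_ne_zero_of_mul_eq_one he) hS
  have hmk := (h.kerInvariant he hT hS).intertwines
  have hmk' := (h'.kerInvariant he hT hS).intertwines
  let R : (T → V) ≃ₗ[ℂ] (T → W) := LinearEquiv.piCongrRight fun _ => P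
  have hR : R.toLinearMap = P.toLinearMap.compLeft T := rfl
  have hmap : (Ω.kerSum T).map R.toLinearMap = Ω'.kerSum T := by
    ext w
    rw [Submodule.mem_map, mem_kerSum]
    constructor
    · rintro ⟨v, hv, rfl⟩ H
      change Ω'.res H.1 (P (v H)) = 0
      rw [← LinearEquiv.coe_coe, ← hP.res, mem_kerSum.1 hv H, map_zero]
    · intro hw
      refine ⟨R.symm w, mem_kerSum.2 fun H => ?_, R.apply_symm_apply w⟩
      change Ω.res H.1 (P.symm (w H)) = 0
      rw [← LinearEquiv.coe_coe, ← hP.symm.res, hw H, map_zero]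
  let Q := Submodule.Quotient.equiv (Ω.kerSum T) (Ω'.kerSum T) R hmap
  have hQ : ∀ w, Q ((Ω.kerSum T).mkQ w) = (Ω'.kerSum T).mkQ (P.toLinearMap.compLeft T w) :=
    fun _ => rfl
  refine Intertwines.gaugeEquiv (P := Q) ⟨fun i q => ?_, fun i j q => ?_, fun H q => ?_⟩
  · obtain ⟨w, rfl⟩ := Submodule.mkQ_surjective _ q
    rw [LinearEquiv.coe_coe, ← hmk.const, hQ, hQ, hL.const, hmk'.const]
  · obtain ⟨w, rfl⟩ := Submodule.mkQ_surjective _ q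
    rw [LinearEquiv.coe_coe, ← hmk.lin, hQ, hQ, hL.lin, hmk'.lin]
  · obtain ⟨w, rfl⟩ := Submodule.mkQ_surjective _ q
    rw [LinearEquiv.coe_coe, ← hmk.res, hQ, hQ, hL.res, hmk'.res]

end GaugeInvariance

/-! ### The middle convolution -/

section MiddleConvolution

variable {n : ℕ} {V : Type u} [AddCommGroup V] [Module ℂ V] [FiniteDimensional ℂ V] {W : Type v}
  [AddCommGroup W] [Module ℂ W] [FiniteDimensional ℂ W] {l : Fin n}
  {T S : Finset (Hyperplane n)} {Ω : System n V} {Ω' : System n W}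

theorem Adapted.shiftedML (h : Ω.Adapted 1 l T S) (hT : ∀ H ∈ T, H.DependsOn l)
    (hS : ∀ G ∈ S, G.DependsOn l) (hTS : ¬ (Hyperplane.HasMixed l T ∧ Hyperplane.HasMixed l S))
    (lam : S → ℂ) : (Ω.shiftedML l T S lam).Adapted (-1) l S T :=
  (h.middleLaplace (one_mul 1) hT hS hTS).addition _

theorem Adapted.mc (h : Ω.Adapted 1 l T S) (hT : ∀ H ∈ T, H.DependsOn l)
    (hS : ∀ G ∈ S, G.DependsOn l) (hTS : ¬ (Hyperplane.HasMixed l T ∧ Hyperplane.HasMixed l S))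
    (lam : S → ℂ) : (Ω.mc l T S lam).Adapted 1 l T S := by
  have := (h.shiftedML hT hS hTS lam).middleLaplace (by norm_num) hS hT
    fun hm => hTS ⟨hm.2, hm.1⟩
  rwa [neg_neg] at this

theorem GaugeEquiv.shiftedML (hg : Ω.GaugeEquiv Ω') (h : Ω.Adapted 1 l T S)
    (hT : ∀ H ∈ T, H.DependsOn l) (hS : ∀ G ∈ S, G.DependsOn l) (lam : S → ℂ) :
    (Ω.shiftedML l T S lam).GaugeEquiv (Ω'.shiftedML l T S lam) :=
  (hg.middleLaplace h (one_mul 1) hT hS).addition _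

theorem GaugeEquiv.mc (hg : Ω.GaugeEquiv Ω') (h : Ω.Adapted 1 l T S)
    (hT : ∀ H ∈ T, H.DependsOn l) (hS : ∀ G ∈ S, G.DependsOn l)
    (hTS : ¬ (Hyperplane.HasMixed l T ∧ Hyperplane.HasMixed l S)) (lam : S → ℂ) :
    (Ω.mc l T S lam).GaugeEquiv (Ω'.mc l T S lam) :=
  (hg.shiftedML h hT hS lam).middleLaplace (h.shiftedML hT hS hTS lam) (by norm_num) hS hT

theorem GaugeEquiv.memIrr (hg : Ω.GaugeEquiv Ω') (h : Ω.MemIrr l T S)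
    (hT : ∀ H ∈ T, H.DependsOn l) (hS : ∀ G ∈ S, G.DependsOn l) : Ω'.MemIrr l T S :=
  ⟨((h.mem.adapted hT).of_gaugeEquiv hg).mem hS, hg.irreducible h.irreducible,
    hg.hasPole h.hasPole⟩

theorem MemIrr.irreducible_shiftedML (h : Ω.MemIrr l T S) (hT : ∀ H ∈ T, H.DependsOn l)
    (hS : ∀ G ∈ S, G.DependsOn l) (lam : S → ℂ) : (Ω.shiftedML l T S lam).Irreducible l :=
  ((h.mem.adapted hT).middleLaplace_irreducible (one_mul 1) hT hS h.irreducible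
    h.hasPole).addition _

theorem MemIrr.mc (h : Ω.MemIrr l T S) (hT : ∀ H ∈ T, H.DependsOn l)
    (hS : ∀ G ∈ S, G.DependsOn l) (hTS : ¬ (Hyperplane.HasMixed l T ∧ Hyperplane.HasMixed l S))
    {lam : S → ℂ} (hlam : Ω.Admissible l T S lam) : (Ω.mc l T S lam).MemIrr l T S := by
  have hA := (h.mem.adapted hT).shiftedML hT hS hTS lam
  have hI := h.irreducible_shiftedML hT hS lam
  exact ⟨((h.mem.adapted hT).mc hT hS hTS lam).mem hS,
    hA.middleLaplace_irreducible (by norm_num) hS hT hI hlam,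
    hA.middleLaplace_hasPole (by norm_num) hS hT hI hlam⟩

theorem MemIrr.mc_zero (h : Ω.MemIrr l T S) (hT : ∀ H ∈ T, H.DependsOn l)
    (hS : ∀ G ∈ S, G.DependsOn l) (hTS : ¬ (Hyperplane.HasMixed l T ∧ Hyperplane.HasMixed l S)) :
    (Ω.mc l T S 0).GaugeEquiv Ω := by
  have h0 : Ω.shiftedML l T S 0 = Ω.middleLaplace 1 l T := by
    rw [System.shiftedML, neg_zero, addition_zero]
  have key : ∀ Ω₁ : System n (Ω.MLSpace T), Ω₁ = Ω.middleLaplace 1 l T →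
      (Ω₁.middleLaplace (-1) l S).GaugeEquiv Ω := by
    rintro _ rfl
    exact (h.mem.adapted hT).middleLaplace_middleLaplace (one_mul 1) hT hS hTS h.irreducible
      h.hasPole
  exact key _ h0

/-- The shifted Laplace transform of `mc_μ(Ω)` is a shift of the one of `Ω`, since `𝓜𝓛^{x}`
cancels the `𝓜𝓛^{-x}` in `mc_μ`. -/
theorem MemIrr.shiftedML_mc (h : Ω.MemIrr l T S) (hT : ∀ H ∈ T, H.DependsOn l)
    (hS : ∀ G ∈ S, G.DependsOn l) (hTS : ¬ (Hyperplane.HasMixed l T ∧ Hyperplane.HasMixed l S))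
    (lam : S → ℂ) {mu : S → ℂ} (hmu : Ω.Admissible l T S mu) :
    ((Ω.mc l T S mu).shiftedML l T S lam).GaugeEquiv (Ω.shiftedML l T S (lam + mu)) := by
  have h1 := ((h.mem.adapted hT).shiftedML hT hS hTS mu).middleLaplace_middleLaplace (by norm_num)
    hS hT (fun hm => hTS ⟨hm.2, hm.1⟩) (h.irreducible_shiftedML hT hS mu) hmu
  rw [neg_neg] at h1
  have h2 := h1.addition (-lam)
  rwa [System.shiftedML, addition_addition, ← neg_add, add_comm mu lam] at h2

theorem MemIrr.mc_mc (h : Ω.MemIrr l T S) (hT : ∀ H ∈ T, H.DependsOn l)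
    (hS : ∀ G ∈ S, G.DependsOn l) (hTS : ¬ (Hyperplane.HasMixed l T ∧ Hyperplane.HasMixed l S))
    (lam : S → ℂ) {mu : S → ℂ} (hmu : Ω.Admissible l T S mu) :
    ((Ω.mc l T S mu).mc l T S lam).GaugeEquiv (Ω.mc l T S (lam + mu)) :=
  (h.shiftedML_mc hT hS hTS lam hmu).middleLaplace
    (((h.mem.adapted hT).mc hT hS hTS mu).shiftedML hT hS hTS lam) (by norm_num) hS hT

theorem MemIrr.mc_neg_mc (h : Ω.MemIrr l T S) (hT : ∀ H ∈ T, H.DependsOn l)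
    (hS : ∀ G ∈ S, G.DependsOn l) (hTS : ¬ (Hyperplane.HasMixed l T ∧ Hyperplane.HasMixed l S))
    {lam : S → ℂ} (hlam : Ω.Admissible l T S lam) :
    ((Ω.mc l T S lam).mc l T S (-lam)).GaugeEquiv Ω := by
  have := h.mc_mc hT hS hTS (-lam) hlam
  rw [neg_add_cancel] at this
  exact this.trans (h.mc_zero hT hS hTS)

/-- Since `𝓜𝓛^{x}(mc_λ(Ω))` is a shift of `𝓜𝓛^{x}(Ω)` by `-λ`, the shift by `λ` gives back
`𝓜𝓛^{x}(Ω)`, which has a pole along a hyperplane in `S`. -/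
theorem MemIrr.admissible_neg_mc (h : Ω.MemIrr l T S) (hT : ∀ H ∈ T, H.DependsOn l)
    (hS : ∀ G ∈ S, G.DependsOn l) (hTS : ¬ (Hyperplane.HasMixed l T ∧ Hyperplane.HasMixed l S))
    {lam : S → ℂ} (hlam : Ω.Admissible l T S lam) :
    (Ω.mc l T S lam).Admissible l T S (-lam) := by
  refine (h.shiftedML_mc hT hS hTS (-lam) hlam).symm.hasPole ?_
  rw [neg_add_cancel, System.shiftedML, neg_zero, addition_zero]
  exact (h.mem.adapted hT).middleLaplace_hasPole (one_mul 1) hT hS h.irreducible h.hasPole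

end MiddleConvolution

end System

/-! ### Gauge classes -/

section GaugeClasses

variable {n : ℕ} {V : Type u} [AddCommGroup V] [Module ℂ V] [FiniteDimensional ℂ V] {W : Type v}
  [AddCommGroup W] [Module ℂ W] [FiniteDimensional ℂ W] {l : Fin n}
  {T S : Finset (Hyperplane n)} {Ω : System n V} {Ω' : System n W}

theorem gaugeClass_eq_iff : gaugeClass Ω = gaugeClass Ω' ↔ Ω.GaugeEquiv Ω' := by
  have h1 := (System.intertwines_conj (Module.finBasis ℂ V).equivFun Ω).gaugeEquiv
  have h2 := (System.intertwines_conj (Module.finBasis ℂ W).equivFun Ω').gaugeEquiv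
  rw [gaugeClass, gaugeClass, Quotient.eq]
  exact ⟨fun h => (h1.trans h).trans h2.symm, fun h => (h1.symm.trans h).trans h2⟩

theorem gaugeClass_mem_irrClasses (h : Ω.MemIrr l T S) (hT : ∀ H ∈ T, H.DependsOn l)
    (hS : ∀ G ∈ S, G.DependsOn l) {lam : S → ℂ} (hlam : Ω.Admissible l T S lam) :
    gaugeClass Ω ∈ irrClasses l T S lam := by
  have hg := (System.intertwines_conj (Module.finBasis ℂ V).equivFun Ω).gaugeEquiv
  exact ⟨_, _, hg.memIrr h hT hS, (hg.shiftedML (h.mem.adapted hT) hT hS lam).hasPole hlam,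
    gaugeClass_eq_iff.2 hg.symm⟩

/-- The map on gauge classes induced by `mc_λ`; classes without a representative in `𝔓_{T,S}` are
left alone. -/
def mcClass (l : Fin n) (T S : Finset (Hyperplane n)) (lam : S → ℂ) (c : GaugeClass n) :
    GaugeClass n :=
  if h : ∃ A : MatrixSystem n, A.2.Mem l T S ∧ gaugeClass A.2 = c then
    gaugeClass (h.choose.2.mc l T S lam)
  else c

theorem mcClass_gaugeClass (h : Ω.Mem l T S) (hT : ∀ H ∈ T, H.DependsOn l)
    (hS : ∀ G ∈ S, G.DependsOn l) (hTS : ¬ (Hyperplane.HasMixed l T ∧ Hyperplane.HasMixed l S))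
    (lam : S → ℂ) : mcClass l T S lam (gaugeClass Ω) = gaugeClass (Ω.mc l T S lam) := by
  have hg := (System.intertwines_conj (Module.finBasis ℂ V).equivFun Ω).gaugeEquiv
  have hex : ∃ A : MatrixSystem n, A.2.Mem l T S ∧ gaugeClass A.2 = gaugeClass Ω :=
    ⟨⟨_, _⟩, ((h.adapted hT).of_gaugeEquiv hg).mem hS, gaugeClass_eq_iff.2 hg.symm⟩
  rw [mcClass, dif_pos hex, gaugeClass_eq_iff]
  exact (gaugeClass_eq_iff.1 hex.choose_spec.2).mc (hex.choose_spec.1.adapted hT) hT hS hTS lam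

theorem bijOn_mcClass (hT : ∀ H ∈ T, H.DependsOn l) (hS : ∀ G ∈ S, G.DependsOn l)
    (hTS : ¬ (Hyperplane.HasMixed l T ∧ Hyperplane.HasMixed l S)) (lam : S → ℂ) :
    Set.BijOn (mcClass l T S lam) (irrClasses l T S lam) (irrClasses l T S (-lam)) := by
  have hmaps : ∀ mu : S → ℂ, Set.MapsTo (mcClass l T S mu) (irrClasses l T S mu)
      (irrClasses l T S (-mu)) := by
    rintro mu _ ⟨N, Ω, h, hmu, rfl⟩
    rw [mcClass_gaugeClass h.mem hT hS hTS]
    exact gaugeClass_mem_irrClasses (h.mc hT hS hTS hmu) hT hS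
      (h.admissible_neg_mc hT hS hTS hmu)
  have hinv : ∀ mu : S → ℂ, Set.LeftInvOn (mcClass l T S (-mu)) (mcClass l T S mu)
      (irrClasses l T S mu) := by
    rintro mu _ ⟨N, Ω, h, hmu, rfl⟩
    rw [mcClass_gaugeClass h.mem hT hS hTS, mcClass_gaugeClass (h.mc hT hS hTS hmu).mem hT hS hTS,
      gaugeClass_eq_iff]
    exact h.mc_neg_mc hT hS hTS hmu
  have hmaps' := hmaps (-lam)
  have hinv' := hinv (-lam)
  rw [neg_neg] at hmaps' hinv'
  exact Set.InvOn.bijOn ⟨hinv lam, hinv'⟩ (hmaps lam) hmaps'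

end GaugeClasses

end Pfaffian

end

theorem mainTheorem4 {n : ℕ} (l : Fin n) (T S : Finset (Pfaffian.Hyperplane n))
    (hT : ∀ H ∈ T, H.DependsOn l) (hS : ∀ H ∈ S, H.DependsOn l)
    (hTS : ¬ (Pfaffian.Hyperplane.HasMixed l T ∧ Pfaffian.Hyperplane.HasMixed l S)) :
    -- the middle convolution is well defined on the whole class
    (∀ (V : Type u) [AddCommGroup V] [Module ℂ V] [FiniteDimensional ℂ V]
      (Ω : Pfaffian.System n V), Ω.Mem l T S → ∀ lam : S → ℂ,
        Ω.KerInvariant 1 l T ∧ (Ω.shiftedML l T S lam).KerInvariant (-1) l S ∧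
        (Ω.mc l T S lam).Mem l T S) ∧
    -- irreducible systems
    (∀ (V : Type u) [AddCommGroup V] [Module ℂ V] [FiniteDimensional ℂ V]
      (Ω : Pfaffian.System n V), Ω.MemIrr l T S →
        (∀ lam : S → ℂ, Ω.Admissible l T S lam → (Ω.mc l T S lam).MemIrr l T S) ∧
        (Ω.mc l T S 0).GaugeEquiv Ω ∧
        (∀ lam mu : S → ℂ, Ω.Admissible l T S mu →
          ((Ω.mc l T S mu).mc l T S lam).GaugeEquiv (Ω.mc l T S (lam + mu)))) ∧
    -- the induced map on gauge classes
    (∀ lam : S → ℂ, ∃ F : Pfaffian.GaugeClass n → Pfaffian.GaugeClass n,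
      (∀ (N : ℕ) (Ω : Pfaffian.System n (Fin N → ℂ)), Ω.Mem l T S →
        F (Pfaffian.gaugeClass Ω) = Pfaffian.gaugeClass (Ω.mc l T S lam)) ∧
      Set.BijOn F (Pfaffian.irrClasses l T S lam) (Pfaffian.irrClasses l T S (-lam))) := by
  refine ⟨fun V _ _ _ Ω h lam => ?_, fun V _ _ _ Ω h => ?_, fun lam => ?_⟩
  · have hA := h.adapted hT
    exact ⟨hA.kerInvariant (one_mul 1) hT hS,
      (hA.shiftedML hT hS hTS lam).kerInvariant (by norm_num) hS hT,
      (hA.mc hT hS hTS lam).mem hS⟩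
  · exact ⟨fun lam hlam => h.mc hT hS hTS hlam, h.mc_zero hT hS hTS,
      fun lam mu hmu => h.mc_mc hT hS hTS lam hmu⟩
  · exact ⟨Pfaffian.mcClass l T S lam,
      fun N Ω h => Pfaffian.mcClass_gaugeClass h hT hS hTS lam,
      Pfaffian.bijOn_mcClass hT hS hTS lam⟩
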